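/- Let $x_L<x_R$, $T>0$, $a,b>0$, let $k\ge 1$ be an integer, and let $0<\underline d\le\overline d$ and $L,M\ge 0$. Then there is a constant $C$, depending only on $k,x_L,x_R,T,a,b,\underline d,\overline d,L,M$, such that the following holds for every mesh $x_L=x_0<x_1<\dots<x_N=x_R$ with elements $T_n=[x_{n-1},x_n]$ and mesh size $h=\max_n(x_n-x_{n-1})$. Let $d\in L^\infty(x_L,x_R)$ with $\underline d\le d\le\overline d$ a.e., and let $d$ have on every element a weak derivative bounded by $L$ (so $d\in W^{1,\infty}(T_h)$). Let $(p,m)$ be a solution of $$a\,\partial_t p+\partial_x m=f,\qquad b\,\partial_t m+\partial_x p+d\,m=g\qquad\text{on }(x_L,x_R)\times(0,T)$$ with $p(x_L,t)=p(x_R,t)=0$ for $0\le t\le T$ that is sufficiently smooth in the following sense: $p$ and $m$ are continuous on $[x_L,x_R]\times[0,T]$ and of class $C^{k+2}$ on each $T_n\times[0,T]$, with all derivatives of order at most $k+2$ bounded by $M$. Let $P_j(T_h)$ be the space of (discontinuous) piecewise polynomials of degree at most $j$ on the mesh, let $V_h=P_k(T_h)\cap H^1(x_L,x_R)$ and $Q_h=P_k(T_h)\cap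 H^1_0(x_L,x_R)$, let $(\cdot,\cdot)$ and $\|\cdot\|$ be the scalar product and norm of $L^2(x_L,x_R)$, let $\pi_h^{k-1}$ be the $L^2$-orthogonal projection onto $P_{k-1}(T_h)$, and for $v\in H^1(x_L,x_R)$ let $I_h^kv\in V_h$ be given by $(I_h^kv)(x_n)=v(x_n)$ for $0\le n\le N$ and $(\partial_xI_h^kv,w)=(\partial_xv,w)$ for all $w\in P_{k-1}(T_h)$. Let $p_h\in H^1(0,T;Q_h)$ and $m_h\in H^1(0,T;V_h)$ satisfy, for almost every $t\in(0,T)$ and all $q,v\in P_{k-1}(T_h)$, $$(a\,\partial_tp_h(t),q)+(\partial_xm_h(t),q)=(f(t),q),$$ $$(b\,\partial_tm_h(t),v)+(\partial_xp_h(t),v)+(d\,\pi_h^{k-1}m_h(t),v)=(g(t),v),$$ with the initial conditions $p_h(0)=I_h^kp(0)$ and $\pi_h^{k-1}m_h(0)=\pi_h^{k-1}I_h^km(0)$; the latter holds in particular if $m_h(0)=I_h^km(0)$. Then $$\|p(t)-p_h(t)\|+\|m(t)-m_h(t)\|\le C\,h^{k+1}\qquad\text{for all }0\le t\le T.$$ 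-/

import Mathlib

open MeasureTheory Set

noncomputable section

namespace PetrovGalerkin

/-- A partition `xL = x₀ < x₁ < ... < x_N = xR` of the interval `[xL, xR]`. -/
structure Mesh (xL xR : ℝ) where
  /-- the number of elements -/
  N : ℕ
  /-- the nodes of the partition -/
  node : Fin (N + 1) → ℝ
  strictMono_node : StrictMono node
  node_zero : node 0 = xL
  node_last : node (Fin.last N) = xR

variable {xL xR : ℝ}

/-- The `i`-th closed element. -/
def Mesh.elem (τ : Mesh xL xR) (i : Fin τ.N) : Set ℝ :=
  Icc (τ.node i.castSucc) (τ.node i.succ)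

/-- The interior of the `i`-th element. -/
def Mesh.openElem (τ : Mesh xL xR) (i : Fin τ.N) : Set ℝ :=
  Ioo (τ.node i.castSucc) (τ.node i.succ)

/-- The global mesh size, the maximum of the lengths of the elements. -/
def Mesh.size (τ : Mesh xL xR) : ℝ :=
  ⨆ i : Fin τ.N, (τ.node i.succ - τ.node i.castSucc)

/-- `P_j(T_h)`: (discontinuous) piecewise polynomials of degree at most `j`. As members of
`L²(xL, xR)` their values at the nodes are irrelevant. -/
def Mesh.PiecewisePoly (τ : Mesh xL xR) (j : ℕ) : Set (ℝ → ℝ) :=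
  {v | ∀ i : Fin τ.N, ∃ q : Polynomial ℝ, q.natDegree ≤ j ∧ ∀ x ∈ τ.openElem i, v x = q.eval x}

/-- `V_h = P_k(T_h) ∩ H¹(xL, xR)`: continuous piecewise polynomials. -/
def Mesh.V (τ : Mesh xL xR) (k : ℕ) : Set (ℝ → ℝ) :=
  {v | v ∈ τ.PiecewisePoly k ∧ ContinuousOn v (Icc xL xR)}

/-- `Q_h = P_k(T_h) ∩ H¹₀(xL, xR)`: those members of `V_h` that vanish at both end points. -/
def Mesh.Q (τ : Mesh xL xR) (k : ℕ) : Set (ℝ → ℝ) :=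
  {v | v ∈ τ.V k ∧ v xL = 0 ∧ v xR = 0}

/-- The scalar product of `L²(xL, xR)`. -/
def ip (xL xR : ℝ) (v w : ℝ → ℝ) : ℝ := ∫ x in xL..xR, v x * w x

/-- The norm of `L²(xL, xR)`. -/
def l2norm (xL xR : ℝ) (v : ℝ → ℝ) : ℝ := Real.sqrt (ip xL xR v v)

/-- `w` is the `L²`-orthogonal projection of `v` onto `P_j(T_h)`. -/
def Mesh.IsL2Proj (τ : Mesh xL xR) (j : ℕ) (v w : ℝ → ℝ) : Prop :=
  w ∈ τ.PiecewisePoly j ∧ ∀ q ∈ τ.PiecewisePoly j, ip xL xR w q = ip xL xR v q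

/-- `w` is the `H¹`-projection of `v` onto `P_k(T_h) ∩ H¹(xL, xR)`: it agrees with `v` at all
nodes, and `(∂ₓ w, q) = (∂ₓ v, q)` for all `q ∈ P_{k-1}(T_h)`. -/
def Mesh.IsH1Proj (τ : Mesh xL xR) (k : ℕ) (v w : ℝ → ℝ) : Prop :=
  w ∈ τ.V k ∧ (∀ i, w (τ.node i) = v (τ.node i)) ∧
    ∀ q ∈ τ.PiecewisePoly (k - 1), ip xL xR (deriv w) q = ip xL xR (deriv v) q

/-- `e` is a weak derivative of `d` on the open interval `(s, t)`. -/
def IsWeakDeriv (s t : ℝ) (d e : ℝ → ℝ) : Prop :=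
  ∀ φ : ℝ → ℝ, ContDiff ℝ (⊤ : ℕ∞) φ → HasCompactSupport φ → tsupport φ ⊆ Ioo s t →
    ∫ x in s..t, d x * deriv φ x = -∫ x in s..t, e x * φ x

/-- The friction coefficient is measurable on `(xL, xR)`, with `dlo ≤ d ≤ dhi` almost everywhere. -/
def IsBoundedCoeff (xL xR dlo dhi : ℝ) (d : ℝ → ℝ) : Prop :=
  AEStronglyMeasurable d (volume.restrict (Ioo xL xR)) ∧
    ∀ᵐ x ∂volume.restrict (Ioo xL xR), dlo ≤ d x ∧ d x ≤ dhi

/-- For a bounded measurable `d`: `d ∈ W^{1,∞}(T_h)`, where on every element the weak derivative of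
`d` is bounded by `L`. -/
def Mesh.HasBoundedPiecewiseWeakDeriv (τ : Mesh xL xR) (L : ℝ) (d : ℝ → ℝ) : Prop :=
  ∀ i : Fin τ.N, ∃ e : ℝ → ℝ,
    AEStronglyMeasurable e (volume.restrict (τ.openElem i)) ∧
    (∀ᵐ x ∂volume.restrict (τ.openElem i), |e x| ≤ L) ∧
    IsWeakDeriv (τ.node i.castSucc) (τ.node i.succ) d e

/-- `u = u(t, x)` is of class `C^r` on `[0, T] × K` for every closed element `K`, and all its
derivatives of order at most `r` are bounded by `M` there. As `u` is single-valued at the nodes,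
it is continuous on all of `[0, T] × [xL, xR]`. -/
def Mesh.PiecewiseSmooth (τ : Mesh xL xR) (T : ℝ) (r : ℕ) (M : ℝ) (u : ℝ → ℝ → ℝ) : Prop :=
  ∀ i : Fin τ.N,
    ContDiffOn ℝ r (fun z : ℝ × ℝ => u z.1 z.2) (Icc 0 T ×ˢ τ.elem i) ∧
    ∀ s ≤ r, ∀ z ∈ Icc 0 T ×ˢ τ.elem i,
      ‖iteratedFDerivWithin ℝ s (fun z : ℝ × ℝ => u z.1 z.2) (Icc 0 T ×ˢ τ.elem i) z‖ ≤ M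

/-- `(p, m)` (with `p t x` the value at time `t` and position `x`) satisfies the damped hyperbolic
system `a ∂ₜp + ∂ₓm = f`, `b ∂ₜm + ∂ₓp + d m = g` on `(0, T) × (xL, xR)`, with homogeneous boundary
conditions for `p`. The derivatives are classical ones when `p` and `m` are piecewise smooth. -/
structure IsSolution (xL xR T a b : ℝ) (d : ℝ → ℝ) (f g p m : ℝ → ℝ → ℝ) : Prop where
  eq_p : ∀ᵐ t ∂volume.restrict (Ioo 0 T), ∀ᵐ x ∂volume.restrict (Ioo xL xR),
    a * deriv (fun s => p s x) t + deriv (m t) x = f t x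
  eq_m : ∀ᵐ t ∂volume.restrict (Ioo 0 T), ∀ᵐ x ∂volume.restrict (Ioo xL xR),
    b * deriv (fun s => m s x) t + deriv (p t) x + d x * m t x = g t x
  bc_left : ∀ t ∈ Icc 0 T, p t xL = 0
  bc_right : ∀ t ∈ Icc 0 T, p t xR = 0

/-- `u ∈ H¹(0, T; X)` with time derivative `u' ∈ L²(0, T; X)`, for a finite-dimensional space `X` of
continuous functions on `[xL, xR]`: `u` is a primitive of the square-integrable function `u'`
(pointwise in `x`, as point evaluations determine the elements of `X`). -/
structure IsH1InTime (xL xR T : ℝ) (X : Set (ℝ → ℝ)) (u u' : ℝ → ℝ → ℝ) : Prop where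
  mem : ∀ t ∈ Icc 0 T, u t ∈ X
  mem' : ∀ t ∈ Icc 0 T, u' t ∈ X
  memLp : ∀ x ∈ Icc xL xR, MemLp (fun t => u' t x) 2 (volume.restrict (Ioo 0 T))
  eq_integral : ∀ x ∈ Icc xL xR, ∀ t ∈ Icc 0 T, u t x = u 0 x + ∫ s in (0 : ℝ)..t, u' s x

/-- `(ph, mh)` solves the differential equations of the inexact Petrov-Galerkin method of order `k`:
trial spaces `Q_h` and `V_h`, test spaces `P_{k-1}(T_h)`, and the friction term evaluated at the
`L²`-projection of `mh` onto `P_{k-1}(T_h)`. Initial conditions are not part of this definition. -/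
structure IsSemidiscreteSolution (τ : Mesh xL xR) (k : ℕ) (T a b : ℝ) (d : ℝ → ℝ)
    (f g ph mh : ℝ → ℝ → ℝ) : Prop where
  exists_deriv : ∃ ph' mh' : ℝ → ℝ → ℝ,
    IsH1InTime xL xR T (τ.Q k) ph ph' ∧ IsH1InTime xL xR T (τ.V k) mh mh' ∧
    (∀ᵐ t ∂volume.restrict (Ioo 0 T), ∀ q ∈ τ.PiecewisePoly (k - 1),
      ip xL xR (fun x => a * ph' t x) q + ip xL xR (deriv (mh t)) q = ip xL xR (f t) q) ∧
    (∀ᵐ t ∂volume.restrict (Ioo 0 T), ∃ w, τ.IsL2Proj (k - 1) (mh t) w ∧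
      ∀ v ∈ τ.PiecewisePoly (k - 1),
        ip xL xR (fun x => b * mh' t x) v + ip xL xR (deriv (ph t)) v
          + ip xL xR (fun x => d x * w x) v = ip xL xR (g t) v)

end PetrovGalerkin

end

/-! Write `k = j + 1` and split the error as `p - p_h = (p - I_h p) + ε_p`, `m - m_h = (m - I_h m) +
ε_m`, where `I_h` is the `H¹`-projection (`Mesh.ONB.interp`). The first parts are of order `h^{k+1}`
by approximation (`Mesh.ONB.abs_sub_interp_le`). The discrete parts `ε_p ∈ Q_h`, `ε_m ∈ V_h` are
treated by energy estimates.

Let `π` be the `L²`-projection onto `P_{k-1}(T_h)`. Since `π ∂ₓ I_h = π ∂ₓ`, the spatial derivatives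
of the projection errors drop out, and `y = π ε_p`, `z = π ε_m` satisfy `y' = ρ - a⁻¹ N`, `z' = σ -
b⁻¹ (P + G + A z)`. Here `N = ∂ₓ ε_m`, `P = ∂ₓ ε_p`, `A` is the positive semidefinite friction
operator, `ρ` and `σ` are projected errors of `I_h` on the time derivatives, and `G = π (d (m - π
I_h m))`. The pair `(N, P)` is skew: both derivatives lie in `P_{k-1}(T_h)`, so `(N, y) + (P, z) =
(∂ₓ ε_m, ε_p) + (∂ₓ ε_p, ε_m)`, which vanishes by the boundary conditions
(`Mesh.ONB.inner_coef_deriv_add`).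

All data are of order `h^{k+1}`. For `G` this is a superconvergence effect
(`Mesh.ONB.norm_coef_friction_le`): `I_h m - π I_h m` is only of order `h^k`, but it is orthogonal
to piecewise constants times test functions, so `d` may be replaced by `d` minus a piecewise
constant, which is of order `h`. The energy estimate and the vanishing initial values give `‖y‖ +
‖z‖ = O(h^{k+1})`.

The energy sees only `π ε`. To recover `ε`, use `‖V‖ ≤ ‖π V‖ + h ‖∂ₓ V‖` (`Mesh.ONB.l2norm_le`);
thus `∂ₓ ε = O(h^k)` suffices. The energy estimate for time differences of `(y, z)` bounds their
Lipschitz constants in time, hence `y'` and `z'`, and the equations are then solved for `N` and `P`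
(`exists_stability_const`). Differences instead of time derivatives keep the regularity requirement
at `C^{k+2}`: the data need only be Lipschitz in time with constant `O(h^k)`.

The argument is carried out for coefficient vectors in an `L²`-orthonormal basis of `P_{k-1}(T_h)`;
the stability constant does not depend on the dimension, hence not on the mesh. -/

namespace PetrovGalerkin

variable {xL xR : ℝ}

/-- Lebesgue measure on the interval `(xL, xR)`. -/
noncomputable abbrev dom (xL xR : ℝ) : Measure ℝ := volume.restrict (Ioo xL xR)

/-! ### Elements of a mesh -/

lemma Mesh.node_lt (τ : Mesh xL xR) (i : Fin τ.N) : τ.node i.castSucc < τ.node i.succ :=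
  τ.strictMono_node i.castSucc_lt_succ

lemma Mesh.node_mem (τ : Mesh xL xR) (i : Fin (τ.N + 1)) : τ.node i ∈ Icc xL xR := by
  constructor
  · exact τ.node_zero.symm.le.trans (τ.strictMono_node.monotone (Fin.zero_le i))
  · exact (τ.strictMono_node.monotone (Fin.le_last i)).trans τ.node_last.le

lemma Mesh.openElem_subset_elem (τ : Mesh xL xR) (i : Fin τ.N) : τ.openElem i ⊆ τ.elem i :=
  Ioo_subset_Icc_self

lemma Mesh.elem_subset (τ : Mesh xL xR) (i : Fin τ.N) : τ.elem i ⊆ Icc xL xR :=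
  Icc_subset_Icc (τ.node_mem _).1 (τ.node_mem _).2

lemma Mesh.openElem_subset (τ : Mesh xL xR) (i : Fin τ.N) : τ.openElem i ⊆ Ioo xL xR :=
  Ioo_subset_Ioo (τ.node_mem _).1 (τ.node_mem _).2

lemma Mesh.left_mem (τ : Mesh xL xR) (i : Fin τ.N) : τ.node i.castSucc ∈ τ.elem i :=
  ⟨le_rfl, (τ.node_lt i).le⟩

lemma Mesh.elem_mem_nhds (τ : Mesh xL xR) {i : Fin τ.N} {x : ℝ} (hx : x ∈ τ.openElem i) :
    τ.elem i ∈ nhds x :=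
  Icc_mem_nhds hx.1 hx.2

lemma Mesh.openElem_mem_nhds (τ : Mesh xL xR) {i : Fin τ.N} {x : ℝ} (hx : x ∈ τ.openElem i) :
    τ.openElem i ∈ nhds x :=
  Ioo_mem_nhds hx.1 hx.2

lemma Mesh.length_le_size (τ : Mesh xL xR) (i : Fin τ.N) :
    τ.node i.succ - τ.node i.castSucc ≤ τ.size :=
  le_ciSup (f := fun i : Fin τ.N => τ.node i.succ - τ.node i.castSucc)
    (Set.finite_range _).bddAbove i

lemma Mesh.N_ne_zero (τ : Mesh xL xR) (hx : xL < xR) : τ.N ≠ 0 := by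
  intro h
  have h1 : Fin.last τ.N = 0 := by
    apply Fin.ext
    simp [h]
  have := τ.node_last
  rw [h1, τ.node_zero] at this
  exact hx.ne this

lemma Mesh.size_le (τ : Mesh xL xR) (hx : xL < xR) : τ.size ≤ xR - xL := by
  have : Nonempty (Fin τ.N) := ⟨⟨0, Nat.pos_of_ne_zero (τ.N_ne_zero hx)⟩⟩
  refine ciSup_le fun i => ?_
  have h1 := (τ.node_mem i.succ).2
  have h2 := (τ.node_mem i.castSucc).1
  linarith

lemma Mesh.size_pos (τ : Mesh xL xR) (hx : xL < xR) : 0 < τ.size := by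
  have h := τ.length_le_size ⟨0, Nat.pos_of_ne_zero (τ.N_ne_zero hx)⟩
  have h' := τ.node_lt ⟨0, Nat.pos_of_ne_zero (τ.N_ne_zero hx)⟩
  linarith

lemma Mesh.exists_mem_elem (τ : Mesh xL xR) (hx : xL < xR) {x : ℝ} (h : x ∈ Icc xL xR) :
    ∃ i, x ∈ τ.elem i := by
  by_contra! hc
  have step : ∀ i : Fin τ.N, τ.node i.castSucc ≤ x → τ.node i.succ < x := by
    intro i hi
    by_contra! h2
    exact hc i ⟨hi, h2⟩
  have all : ∀ i, τ.node i ≤ x := by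
    intro i
    induction i using Fin.induction with
    | zero => rw [τ.node_zero]; exact h.1
    | succ i ih => exact (step i ih).le
  have hN := τ.N_ne_zero hx
  obtain ⟨j, hj⟩ := Fin.exists_succ_eq.2
    (show Fin.last τ.N ≠ 0 by intro h0; apply hN; simpa using congrArg Fin.val h0)
  have := step j (all _)
  rw [hj, τ.node_last] at this
  exact absurd this (not_lt.2 h.2)

lemma Mesh.openElem_inj (τ : Mesh xL xR) {i j : Fin τ.N} {x : ℝ} (hi : x ∈ τ.openElem i)
    (hj : x ∈ τ.openElem j) : i = j := by
  have key : ∀ i j : Fin τ.N, x ∈ τ.openElem i → x ∈ τ.openElem j → ¬ i < j := by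
    intro i j hi hj hlt
    have : τ.node i.succ ≤ τ.node j.castSucc := by
      apply τ.strictMono_node.monotone
      rw [Fin.le_def]
      simpa using hlt
    linarith [hi.2, hj.1]
  exact le_antisymm (not_lt.1 (key j i hj hi)) (not_lt.1 (key i j hi hj))

/-- Open elements are disjoint, so local choices (Taylor polynomials, constants) assemble into one
global function; its values at the nodes never matter. -/
lemma Mesh.exists_glue (τ : Mesh xL xR) (c : Fin τ.N → ℝ → ℝ) :
    ∃ g : ℝ → ℝ, ∀ i, ∀ x ∈ τ.openElem i, g x = c i x := by
  classical
  refine ⟨fun x => if h : ∃ i, x ∈ τ.openElem i then c h.choose x else 0, fun i x hx => ?_⟩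
  have h : ∃ i, x ∈ τ.openElem i := ⟨i, hx⟩
  simp only [h, dif_pos]
  rw [τ.openElem_inj h.choose_spec hx]

/-- The finitely many nodes form a null set. All later identities are therefore checked on open
elements only, where piecewise polynomials are honest polynomials. -/
lemma Mesh.ae_mem_openElem (τ : Mesh xL xR) (hx : xL < xR) :
    ∀ᵐ x ∂dom xL xR, ∃ i, x ∈ τ.openElem i := by
  have h0 : ∀ᵐ x ∂dom xL xR, x ∉ range τ.node :=
    ae_restrict_of_ae ((Set.finite_range _).measure_zero volume |> measure_eq_zero_iff_ae_notMem.1)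
  filter_upwards [h0, ae_restrict_mem measurableSet_Ioo] with x h1 h2
  obtain ⟨i, hi⟩ := τ.exists_mem_elem hx ⟨h2.1.le, h2.2.le⟩
  refine ⟨i, lt_of_le_of_ne hi.1 ?_, lt_of_le_of_ne hi.2 ?_⟩
  · intro h
    exact h1 ⟨_, h⟩
  · intro h
    exact h1 ⟨_, h.symm⟩

lemma Mesh.ae_of_openElem (τ : Mesh xL xR) (hx : xL < xR) {P : ℝ → Prop}
    (h : ∀ i, ∀ x ∈ τ.openElem i, P x) : ∀ᵐ x ∂dom xL xR, P x := by
  filter_upwards [τ.ae_mem_openElem hx] with x ⟨i, hi⟩ using h i x hi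

lemma Mesh.measurableSet_openElem (τ : Mesh xL xR) (i : Fin τ.N) :
    MeasurableSet (τ.openElem i) := measurableSet_Ioo

lemma Mesh.dom_eq (τ : Mesh xL xR) (hx : xL < xR) :
    dom xL xR = volume.restrict (⋃ i, τ.openElem i) := by
  apply Measure.restrict_congr_set
  apply Filter.eventuallyLE_antisymm_iff.2
  constructor
  · have := (ae_restrict_iff' (measurableSet_Ioo (a := xL) (b := xR))).1 (τ.ae_mem_openElem hx)
    filter_upwards [this] with x h h2
    exact mem_iUnion.2 (h h2)
  · exact LE.le.eventuallyLE (iUnion_subset τ.openElem_subset)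

lemma Mesh.ae_of_ae_openElem (τ : Mesh xL xR) (hx : xL < xR) {P : ℝ → Prop}
    (h : ∀ i, ∀ᵐ x ∂volume.restrict (τ.openElem i), P x) : ∀ᵐ x ∂dom xL xR, P x := by
  rw [τ.dom_eq hx, ae_restrict_iUnion_iff]
  exact h

lemma Mesh.integral_eq_sum (τ : Mesh xL xR) (hx : xL < xR) {f : ℝ → ℝ}
    (hf : Integrable f (dom xL xR)) :
    ∫ x, f x ∂dom xL xR = ∑ i, ∫ x in τ.openElem i, f x := by
  rw [τ.dom_eq hx]
  refine integral_iUnion_fintype τ.measurableSet_openElem ?_ fun i => ?_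
  · intro i j hij
    exact Set.disjoint_left.2 fun x hi hj => hij (τ.openElem_inj hi hj)
  · exact hf.mono_measure (Measure.restrict_mono (τ.openElem_subset i) le_rfl)

/-! ### Bounded functions and the scalar product -/

/-- Essentially bounded measurable functions on `(xL, xR)`. -/
abbrev Bdd (xL xR : ℝ) (f : ℝ → ℝ) : Prop := MemLp f ⊤ (dom xL xR)

/-- Working in `L^∞` rather than `L²` makes the admissible functions closed under products, so that
every integrand below is integrable without further argument. -/
lemma Bdd.mul {f g : ℝ → ℝ} (hf : Bdd xL xR f) (hg : Bdd xL xR g) :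
    Bdd xL xR (fun x => f x * g x) := by
  have := MemLp.mul (p := ⊤) (q := ⊤) (r := ⊤) hf hg
  convert this using 2
  simp [mul_comm]

lemma Bdd.of_bound {f : ℝ → ℝ} (hf : AEStronglyMeasurable f (dom xL xR)) (C : ℝ)
    (h : ∀ᵐ x ∂dom xL xR, |f x| ≤ C) : Bdd xL xR f :=
  memLp_top_of_bound hf C h

lemma Bdd.add {f g : ℝ → ℝ} (hf : Bdd xL xR f) (hg : Bdd xL xR g) :
    Bdd xL xR (fun x => f x + g x) := MemLp.add hf hg

lemma Bdd.sub {f g : ℝ → ℝ} (hf : Bdd xL xR f) (hg : Bdd xL xR g) :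
    Bdd xL xR (fun x => f x - g x) := MemLp.sub hf hg

lemma Bdd.two {f : ℝ → ℝ} (hf : Bdd xL xR f) : MemLp f 2 (dom xL xR) :=
  hf.mono_exponent le_top

lemma Bdd.integrable {f : ℝ → ℝ} (hf : Bdd xL xR f) : Integrable f (dom xL xR) :=
  memLp_one_iff_integrable.1 (hf.mono_exponent le_top)

lemma Bdd.const (c : ℝ) : Bdd xL xR (fun _ => c) := memLp_const c

lemma Bdd.congr {f g : ℝ → ℝ} (hf : Bdd xL xR f) (h : f =ᵐ[dom xL xR] g) : Bdd xL xR g :=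
  (memLp_congr_ae h).1 hf

lemma ip_eq (hx : xL < xR) (v w : ℝ → ℝ) : ip xL xR v w = ∫ x, v x * w x ∂dom xL xR := by
  rw [ip, intervalIntegral.integral_of_le hx.le, integral_Ioc_eq_integral_Ioo]

lemma ip_comm (v w : ℝ → ℝ) : ip xL xR v w = ip xL xR w v := by
  simp only [ip, mul_comm]

lemma ip_congr (hx : xL < xR) {v v' w w' : ℝ → ℝ} (h : v =ᵐ[dom xL xR] v')
    (h' : w =ᵐ[dom xL xR] w') : ip xL xR v w = ip xL xR v' w' := by
  rw [ip_eq hx, ip_eq hx]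
  apply integral_congr_ae
  filter_upwards [h, h'] with x h1 h2
  rw [h1, h2]

lemma ip_eq_inner (hx : xL < xR) {v w : ℝ → ℝ} (hv : Bdd xL xR v) (hw : Bdd xL xR w) :
    ip xL xR v w = inner ℝ (hv.two.toLp v) (hw.two.toLp w) := by
  rw [ip_eq hx, L2.inner_def]
  apply integral_congr_ae
  filter_upwards [hv.two.coeFn_toLp, hw.two.coeFn_toLp] with x h1 h2
  rw [h1, h2]
  simp [mul_comm]

lemma l2norm_eq_norm (hx : xL < xR) {v : ℝ → ℝ} (hv : Bdd xL xR v) :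
    l2norm xL xR v = ‖hv.two.toLp v‖ := by
  rw [l2norm, ip_eq_inner hx hv hv, real_inner_self_eq_norm_sq, Real.sqrt_sq (norm_nonneg _)]

lemma l2norm_nonneg (v : ℝ → ℝ) : 0 ≤ l2norm xL xR v := Real.sqrt_nonneg _

lemma l2norm_sq (hx : xL < xR) (v : ℝ → ℝ) : l2norm xL xR v ^ 2 = ip xL xR v v := by
  rw [l2norm, Real.sq_sqrt]
  rw [ip_eq hx]
  exact integral_nonneg fun x => mul_self_nonneg _

lemma l2norm_congr (hx : xL < xR) {v w : ℝ → ℝ} (h : v =ᵐ[dom xL xR] w) :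
    l2norm xL xR v = l2norm xL xR w := by
  rw [l2norm, l2norm, ip_congr hx h h]

lemma abs_ip_le (hx : xL < xR) {v w : ℝ → ℝ} (hv : Bdd xL xR v) (hw : Bdd xL xR w) :
    |ip xL xR v w| ≤ l2norm xL xR v * l2norm xL xR w := by
  rw [ip_eq_inner hx hv hw, l2norm_eq_norm hx hv, l2norm_eq_norm hx hw]
  exact abs_real_inner_le_norm _ _

lemma l2norm_add_le (hx : xL < xR) {v w : ℝ → ℝ} (hv : Bdd xL xR v) (hw : Bdd xL xR w) :
    l2norm xL xR (fun x => v x + w x) ≤ l2norm xL xR v + l2norm xL xR w := by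
  rw [l2norm_eq_norm hx hv, l2norm_eq_norm hx hw]
  exact (l2norm_eq_norm hx (Bdd.add hv hw)).le.trans
    (norm_add_le (hv.two.toLp v) (hw.two.toLp w))

lemma l2norm_le_of_bound (hx : xL < xR) {v : ℝ → ℝ} {K : ℝ} (hK : 0 ≤ K)
    (h : ∀ᵐ x ∂dom xL xR, |v x| ≤ K) : l2norm xL xR v ≤ Real.sqrt (xR - xL) * K := by
  rw [l2norm, ← Real.sqrt_sq hK, ← Real.sqrt_mul (by linarith)]
  apply Real.sqrt_le_sqrt
  rw [ip_eq hx]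
  calc ∫ x, v x * v x ∂dom xL xR ≤ ∫ _, K ^ 2 ∂dom xL xR := by
        apply integral_mono_of_nonneg
        · exact Filter.Eventually.of_forall fun x => mul_self_nonneg _
        · exact integrable_const _
        · filter_upwards [h] with x hx
          change v x * v x ≤ K ^ 2
          rw [← sq, ← sq_abs]
          exact pow_le_pow_left₀ (abs_nonneg _) hx 2
    _ = (xR - xL) * K ^ 2 := by
        simp [hx.le]

lemma l2norm_mono (hx : xL < xR) {v w : ℝ → ℝ} (hw : Bdd xL xR w)
    (h : ∀ᵐ x ∂dom xL xR, |v x| ≤ |w x|) : l2norm xL xR v ≤ l2norm xL xR w := by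
  apply Real.sqrt_le_sqrt
  rw [ip_eq hx, ip_eq hx]
  apply integral_mono_of_nonneg
  · exact Filter.Eventually.of_forall fun x => mul_self_nonneg _
  · exact (hw.mul hw).integrable
  · filter_upwards [h] with x hx
    change v x * v x ≤ w x * w x
    rw [← abs_mul_abs_self (v x), ← abs_mul_abs_self (w x)]
    exact mul_self_le_mul_self (abs_nonneg _) hx

lemma l2norm_smul (c : ℝ) (v : ℝ → ℝ) :
    l2norm xL xR (fun x => c * v x) = |c| * l2norm xL xR v := by
  rw [l2norm, l2norm, ← Real.sqrt_sq_eq_abs, ← Real.sqrt_mul (sq_nonneg c)]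
  congr 1
  simp only [ip]
  rw [← intervalIntegral.integral_const_mul]
  congr 1
  ext x
  ring

lemma ip_add_left (hx : xL < xR) {u v w : ℝ → ℝ} (hu : Bdd xL xR u) (hv : Bdd xL xR v)
    (hw : Bdd xL xR w) :
    ip xL xR (fun x => u x + v x) w = ip xL xR u w + ip xL xR v w := by
  simp only [ip_eq hx, add_mul]
  exact integral_add (hu.mul hw).integrable (hv.mul hw).integrable

lemma ip_sub_left (hx : xL < xR) {u v w : ℝ → ℝ} (hu : Bdd xL xR u) (hv : Bdd xL xR v)
    (hw : Bdd xL xR w) :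
    ip xL xR (fun x => u x - v x) w = ip xL xR u w - ip xL xR v w := by
  simp only [ip_eq hx, sub_mul]
  exact integral_sub (hu.mul hw).integrable (hv.mul hw).integrable

lemma ip_smul_left (c : ℝ) (v w : ℝ → ℝ) :
    ip xL xR (fun x => c * v x) w = c * ip xL xR v w := by
  simp only [ip]
  rw [← intervalIntegral.integral_const_mul]
  simp only [mul_assoc]

lemma ip_sum_left (hx : xL < xR) {ι : Type*} [Fintype ι] {u : ι → ℝ → ℝ} {w : ℝ → ℝ}
    (hu : ∀ r, Bdd xL xR (u r)) (hw : Bdd xL xR w) :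
    ip xL xR (fun x => ∑ r, u r x) w = ∑ r, ip xL xR (u r) w := by
  simp only [ip_eq hx, Finset.sum_mul]
  exact integral_finsetSum _ fun r _ => ((hu r).mul hw).integrable

lemma Bdd.sum {ι : Type*} [Fintype ι] {u : ι → ℝ → ℝ} (hu : ∀ r, Bdd xL xR (u r)) :
    Bdd xL xR (fun x => ∑ r, u r x) :=
  memLp_finsetSum _ fun r _ => hu r

/-! ### Piecewise polynomials -/

lemma Bdd.of_continuousOn_elem (τ : Mesh xL xR) (hx : xL < xR) {v : ℝ → ℝ} {c : Fin τ.N → ℝ → ℝ}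
    (hc : ∀ i, ContinuousOn (c i) (τ.elem i)) (h : ∀ i, ∀ x ∈ τ.openElem i, v x = c i x) :
    Bdd xL xR v := by
  classical
  have h1 : ∀ i, Bdd xL xR ((τ.openElem i).indicator (c i)) := by
    intro i
    obtain ⟨C, hC⟩ := isCompact_Icc.exists_bound_of_continuousOn (hc i)
    refine Bdd.of_bound ?_ (max C 0) (Filter.Eventually.of_forall fun x => ?_)
    · have := ((hc i).mono (τ.openElem_subset_elem i)).aestronglyMeasurable
        (μ := volume) (τ.measurableSet_openElem i)
      exact ((aestronglyMeasurable_indicator_iff (τ.measurableSet_openElem i)).2 this).restrict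
    · by_cases hxi : x ∈ τ.openElem i
      · rw [indicator_of_mem hxi]
        exact (hC x (τ.openElem_subset_elem i hxi)).trans (le_max_left _ _)
      · rw [indicator_of_notMem hxi]
        simp
  refine (Bdd.sum h1).congr (τ.ae_of_openElem hx fun i x hxi => ?_)
  change ∑ r, (τ.openElem r).indicator (c r) x = v x
  rw [Finset.sum_eq_single i, indicator_of_mem hxi, h i x hxi]
  · intro j _ hj
    exact indicator_of_notMem (fun hxj => hj (τ.openElem_inj hxj hxi)) _
  · simp

/-- Piecewise polynomials as a linear subspace. -/
def Mesh.ppSubmodule (τ : Mesh xL xR) (j : ℕ) : Submodule ℝ (ℝ → ℝ) where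
  carrier := τ.PiecewisePoly j
  add_mem' := by
    intro v w hv hw i
    obtain ⟨q, hq, h⟩ := hv i
    obtain ⟨q', hq', h'⟩ := hw i
    refine ⟨q + q', (Polynomial.natDegree_add_le _ _).trans (max_le hq hq'), fun x hx => ?_⟩
    simp [h x hx, h' x hx]
  zero_mem' := fun i => ⟨0, by simp, by simp⟩
  smul_mem' := by
    intro c v hv i
    obtain ⟨q, hq, h⟩ := hv i
    refine ⟨Polynomial.C c * q, (Polynomial.natDegree_C_mul_le _ _).trans hq, fun x hx => ?_⟩
    simp [h x hx]

lemma Mesh.bdd_of_mem (τ : Mesh xL xR) (hx : xL < xR) {j : ℕ} {v : ℝ → ℝ}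
    (hv : v ∈ τ.PiecewisePoly j) : Bdd xL xR v := by
  choose q hq h using hv
  exact Bdd.of_continuousOn_elem τ hx (fun i => (q i).continuous.continuousOn) h

lemma Mesh.sum_smul_mem (τ : Mesh xL xR) {j : ℕ} {ι : Type*} [Fintype ι] {u : ι → ℝ → ℝ}
    (hu : ∀ r, u r ∈ τ.PiecewisePoly j) (c : ι → ℝ) :
    (fun x => ∑ r, c r * u r x) ∈ τ.PiecewisePoly j := by
  have : (∑ r, c r • u r) ∈ τ.ppSubmodule j :=
    Submodule.sum_mem _ fun r _ => Submodule.smul_mem _ _ (hu r)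
  have h : (fun x => ∑ r, c r * u r x) = ∑ r, c r • u r := by
    ext x
    simp
  rw [h]
  exact this

lemma Mesh.sub_mem (τ : Mesh xL xR) {j : ℕ} {u v : ℝ → ℝ} (hu : u ∈ τ.PiecewisePoly j)
    (hv : v ∈ τ.PiecewisePoly j) : (fun x => u x - v x) ∈ τ.PiecewisePoly j :=
  (τ.ppSubmodule j).sub_mem hu hv

lemma Mesh.piecewisePoly_mono (τ : Mesh xL xR) {j l : ℕ} (h : j ≤ l) {v : ℝ → ℝ}
    (hv : v ∈ τ.PiecewisePoly j) : v ∈ τ.PiecewisePoly l := by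
  intro i
  obtain ⟨q, hq, hv⟩ := hv i
  exact ⟨q, hq.trans h, hv⟩

lemma Mesh.mul_mem (τ : Mesh xL xR) {j : ℕ} {u v : ℝ → ℝ} (hu : u ∈ τ.PiecewisePoly 0)
    (hv : v ∈ τ.PiecewisePoly j) : (fun x => u x * v x) ∈ τ.PiecewisePoly j := by
  intro i
  obtain ⟨q, hq, h⟩ := hu i
  obtain ⟨q', hq', h'⟩ := hv i
  refine ⟨q * q', Polynomial.natDegree_mul_le.trans (by omega), fun x hx => ?_⟩
  simp [h x hx, h' x hx]

lemma Mesh.deriv_eq (τ : Mesh xL xR) {i : Fin τ.N} {v : ℝ → ℝ} {q : Polynomial ℝ}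
    (h : ∀ x ∈ τ.openElem i, v x = q.eval x) {x : ℝ} (hx : x ∈ τ.openElem i) :
    HasDerivAt v (q.derivative.eval x) x := by
  refine (q.hasDerivAt x).congr_of_eventuallyEq ?_
  filter_upwards [τ.openElem_mem_nhds hx] with y hy using h y hy

lemma Mesh.deriv_mem (τ : Mesh xL xR) {j : ℕ} {v : ℝ → ℝ} (hv : v ∈ τ.PiecewisePoly j) :
    deriv v ∈ τ.PiecewisePoly (j - 1) := by
  intro i
  obtain ⟨q, hq, h⟩ := hv i
  exact ⟨q.derivative, (Polynomial.natDegree_derivative_le q).trans (by omega),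
    fun x hx => (τ.deriv_eq h hx).deriv⟩

lemma Mesh.hasDerivAt_of_mem (τ : Mesh xL xR) {j : ℕ} {v : ℝ → ℝ} (hv : v ∈ τ.PiecewisePoly j)
    {i : Fin τ.N} {x : ℝ} (hx : x ∈ τ.openElem i) : HasDerivAt v (deriv v x) x := by
  obtain ⟨q, hq, h⟩ := hv i
  exact (τ.deriv_eq h hx).differentiableAt.hasDerivAt

/-- Restricting a polynomial to one element gives a piecewise polynomial. -/
lemma Mesh.indicator_mem (τ : Mesh xL xR) {j : ℕ} (i : Fin τ.N) {v : ℝ → ℝ}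
    (hv : v ∈ τ.PiecewisePoly j) : (τ.openElem i).indicator v ∈ τ.PiecewisePoly j := by
  intro l
  by_cases hil : i = l
  · subst hil
    obtain ⟨q, hq, h⟩ := hv i
    exact ⟨q, hq, fun x hx => by rw [indicator_of_mem hx, h x hx]⟩
  · refine ⟨0, by simp, fun x hx => ?_⟩
    rw [indicator_of_notMem (fun hxi => hil (τ.openElem_inj hxi hx))]
    simp

lemma Mesh.eval_mem (τ : Mesh xL xR) {j : ℕ} {q : Polynomial ℝ} (hq : q.natDegree ≤ j) :
    (fun x => q.eval x) ∈ τ.PiecewisePoly j :=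
  fun _ => ⟨q, hq, fun _ _ => rfl⟩

/-- Interpolation at finitely many points determines a piecewise polynomial and its derivative. -/
lemma Mesh.exists_lagrange (τ : Mesh xL xR) (j : ℕ) :
    ∃ (s : Fin τ.N × Fin (j + 1) → ℝ) (l l' : Fin τ.N × Fin (j + 1) → ℝ → ℝ),
      (∀ r, s r ∈ Icc xL xR) ∧ (∀ r, l r ∈ τ.PiecewisePoly j) ∧
      (∀ r, l' r ∈ τ.PiecewisePoly (j - 1)) ∧
      ∀ u ∈ τ.PiecewisePoly j, ∀ i, ∀ x ∈ τ.openElem i,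
        u x = ∑ r, u (s r) * l r x ∧ deriv u x = ∑ r, u (s r) * l' r x := by
  classical
  -- The fractions `(m + 1) / (j + 2)` lie strictly between 0 and 1: sample points must avoid the
  -- nodes, where a member of `PiecewisePoly` may take any value.
  let pt : Fin τ.N → ℕ → ℝ := fun i m =>
    τ.node i.castSucc + ((m : ℝ) + 1) / (j + 2) * (τ.node i.succ - τ.node i.castSucc)
  have hpt : ∀ i, ∀ m < j + 1, pt i m ∈ τ.openElem i := by
    intro i m hm
    have hm' : (m : ℝ) < j + 1 := by exact_mod_cast hm
    have hlen : 0 < τ.node i.succ - τ.node i.castSucc := sub_pos.2 (τ.node_lt i)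
    have h1 : 0 < ((m : ℝ) + 1) / (j + 2) := by positivity
    have h2 : ((m : ℝ) + 1) / (j + 2) < 1 := by
      rw [div_lt_one (by positivity)]
      linarith
    constructor
    · simp only [pt]
      nlinarith
    · simp only [pt]
      nlinarith
  have hinj : ∀ i, Set.InjOn (pt i) (Finset.range (j + 1)) := by
    intro i m _ m' _ h
    have hlen : τ.node i.succ - τ.node i.castSucc ≠ 0 := (sub_pos.2 (τ.node_lt i)).ne'
    have h2 : ((j : ℝ) + 2) ≠ 0 := by positivity
    simp only [pt] at h
    have h3 := mul_right_cancel₀ hlen (add_left_cancel h)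
    rw [div_left_inj' h2] at h3
    exact_mod_cast add_right_cancel h3
  let Lb : Fin τ.N → ℕ → Polynomial ℝ := fun i m => Lagrange.basis (Finset.range (j + 1)) (pt i) m
  have hLb : ∀ i, ∀ m < j + 1, (Lb i m).natDegree ≤ j := by
    intro i m hm
    have := Lagrange.degree_basis (hinj i) (Finset.mem_range.2 hm)
    rw [Polynomial.natDegree_le_iff_degree_le, this]
    simp
  have hsum : ∀ q : Polynomial ℝ, q.natDegree ≤ j → ∀ i,
      q = ∑ m ∈ Finset.range (j + 1), Polynomial.C (q.eval (pt i m)) * Lb i m := by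
    intro q hq i
    have := Lagrange.eq_interpolate (f := q) (hinj i) (by
      rw [Finset.card_range]
      refine lt_of_le_of_lt Polynomial.degree_le_natDegree ?_
      exact_mod_cast Nat.lt_succ_of_le hq)
    rw [Lagrange.interpolate_apply] at this
    exact this
  refine ⟨fun r => pt r.1 r.2, fun r => (τ.openElem r.1).indicator fun x => (Lb r.1 r.2).eval x,
    fun r => (τ.openElem r.1).indicator fun x => (Lb r.1 r.2).derivative.eval x, ?_, ?_, ?_, ?_⟩
  · exact fun r => Ioo_subset_Icc_self (τ.openElem_subset _ (hpt r.1 r.2 r.2.2))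
  · exact fun r => τ.indicator_mem _ (τ.eval_mem (hLb _ _ r.2.2))
  · intro r
    refine τ.indicator_mem _ (τ.eval_mem ?_)
    have := hLb r.1 r.2 r.2.2
    exact (Polynomial.natDegree_derivative_le _).trans (by omega)
  · intro u hu i x hx
    obtain ⟨q, hq, h⟩ := hu i
    -- Only sample points in the element of `x` contribute, because the other indicators vanish at
    -- `x`.
    have hcollapse : ∀ F : Fin τ.N → ℕ → ℝ → ℝ,
        ∑ r : Fin τ.N × Fin (j + 1), u (pt r.1 r.2) * (τ.openElem r.1).indicator (F r.1 r.2) x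
          = ∑ m ∈ Finset.range (j + 1), q.eval (pt i m) * F i m x := by
      intro F
      rw [Fintype.sum_prod_type, Finset.sum_eq_single i, Finset.sum_range]
      · refine Finset.sum_congr rfl fun m _ => ?_
        rw [indicator_of_mem hx, h _ (hpt i m m.2)]
      · intro i' _ hi'
        refine Finset.sum_eq_zero fun m _ => ?_
        rw [indicator_of_notMem (fun hxi => hi' (τ.openElem_inj hxi hx)), mul_zero]
      · simp
    constructor
    · rw [hcollapse fun i m x => (Lb i m).eval x, h x hx]
      conv_lhs => rw [hsum q hq i]
      simp [Polynomial.eval_finsetSum]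
    · rw [hcollapse fun i m x => (Lb i m).derivative.eval x, (τ.deriv_eq h hx).deriv]
      conv_lhs => rw [hsum q hq i]
      simp [Polynomial.eval_finsetSum]

/-! ### Orthonormal bases of piecewise polynomials -/

/-- An `L²`-orthonormal basis of the piecewise polynomials of degree at most `j`. -/
structure Mesh.ONB (τ : Mesh xL xR) (j : ℕ) where
  /-- the dimension of the space -/
  n : ℕ
  /-- the basis functions -/
  φ : Fin n → ℝ → ℝ
  mem : ∀ α, φ α ∈ τ.PiecewisePoly j
  ip_φ : ∀ α β, ip xL xR (φ α) (φ β) = if α = β then 1 else 0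
  expand : ∀ q ∈ τ.PiecewisePoly j,
    q =ᵐ[dom xL xR] fun x => ∑ α, ip xL xR q (φ α) * φ α x

lemma Bdd.toLp_sum_smul {ι : Type*} [Fintype ι] {u : ι → ℝ → ℝ}
    (hu : ∀ r, Bdd xL xR (u r)) (c : ι → ℝ) (h : Bdd xL xR fun x => ∑ r, c r * u r x) :
    h.two.toLp _ = ∑ r, c r • (hu r).two.toLp _ := by
  have hcr : ∀ r, c r • (hu r).two.toLp _ = ((hu r).two.const_smul (c r)).toLp _ := fun r => rfl
  simp_rw [hcr]
  apply Lp.ext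
  have h1 := Lp.coeFn_finsetSum (p := 2) (μ := dom xL xR) Finset.univ
    (fun r => ((hu r).two.const_smul (c r)).toLp _)
  have h2 : ∀ᵐ x ∂dom xL xR, ∀ r,
      (((hu r).two.const_smul (c r)).toLp _ : ℝ → ℝ) x = (c r • u r) x :=
    ae_all_iff.2 fun r => MemLp.coeFn_toLp _
  filter_upwards [h.two.coeFn_toLp, h1, h2] with x h0 h1 h2
  rw [h0, h1, Finset.sum_apply]
  refine Finset.sum_congr rfl fun r _ => ?_
  rw [h2 r]
  rfl

/-- The Lagrange functions span a finite-dimensional subspace of `L²`, which has an orthonormal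
basis. -/
lemma Mesh.exists_onb (τ : Mesh xL xR) (hx : xL < xR) (j : ℕ) : Nonempty (τ.ONB j) := by
  classical
  obtain ⟨s, l, l', -, hl, -, hrep⟩ := τ.exists_lagrange j
  have hb : ∀ r, Bdd xL xR (l r) := fun r => τ.bdd_of_mem hx (hl r)
  let b : Fin τ.N × Fin (j + 1) → Lp ℝ 2 (dom xL xR) := fun r => (hb r).two.toLp
  let S := Submodule.span ℝ (Set.range b)
  have : FiniteDimensional ℝ S := FiniteDimensional.span_of_finite ℝ (Set.finite_range b)
  let B := stdOrthonormalBasis ℝ S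
  -- The basis vectors are classes of functions; expanding them in the Lagrange functions provides
  -- representatives that are piecewise polynomials.
  have hmem : ∀ α, ∃ c : Fin τ.N × Fin (j + 1) → ℝ, ∑ r, c r • b r = (B α : Lp ℝ 2 (dom xL xR)) :=
    fun α => (Submodule.mem_span_range_iff_exists_fun ℝ).1 (B α).2
  choose c hc using hmem
  let φ : Fin (Module.finrank ℝ S) → ℝ → ℝ := fun α x => ∑ r, c α r * l r x
  have hφ : ∀ α, φ α ∈ τ.PiecewisePoly j := fun α => τ.sum_smul_mem hl (c α)
  have hφb : ∀ α, Bdd xL xR (φ α) := fun α => τ.bdd_of_mem hx (hφ α)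
  have hφL : ∀ α, (hφb α).two.toLp = (B α : Lp ℝ 2 (dom xL xR)) := fun α => by
    rw [← hc α]
    exact Bdd.toLp_sum_smul hb (c α) (hφb α)
  refine ⟨⟨_, φ, hφ, fun α β => ?_, fun q hq => ?_⟩⟩
  · rw [ip_eq_inner hx (hφb α) (hφb β), hφL, hφL, ← Submodule.coe_inner]
    exact orthonormal_iff_ite.1 B.orthonormal α β
  · have hqb := τ.bdd_of_mem hx hq
    have hq1 : q =ᵐ[dom xL xR] fun x => ∑ r, q (s r) * l r x :=
      τ.ae_of_openElem hx fun i x hxi => (hrep q hq i x hxi).1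
    have hsb := hqb.congr hq1
    have hq2 : hqb.two.toLp = ∑ r, q (s r) • b r := by
      rw [← Bdd.toLp_sum_smul hb _ hsb]
      exact (MemLp.toLp_eq_toLp_iff _ _).2 hq1
    have hqS : hqb.two.toLp ∈ S := by
      rw [hq2]
      exact Submodule.sum_mem _ fun r _ => Submodule.smul_mem _ _
        (Submodule.subset_span (Set.mem_range_self r))
    have hfb : Bdd xL xR fun x => ∑ α, ip xL xR q (φ α) * φ α x :=
      τ.bdd_of_mem hx (τ.sum_smul_mem hφ _)
    apply (MemLp.toLp_eq_toLp_iff hqb.two hfb.two).1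
    rw [Bdd.toLp_sum_smul hφb _ hfb]
    have h3 := B.sum_repr' ⟨_, hqS⟩
    have h4 := congrArg (Subtype.val) h3
    simp only [Submodule.coe_sum, Submodule.coe_smul, Submodule.coe_inner] at h4
    rw [← h4]
    refine Finset.sum_congr rfl fun α _ => ?_
    rw [ip_eq_inner hx hqb (hφb α), hφL, real_inner_comm]

namespace Mesh.ONB

variable {τ : Mesh xL xR} {j : ℕ} (B : τ.ONB j)

/-- The coefficients of the `L²`-projection with respect to an orthonormal basis. -/
noncomputable def coef (v : ℝ → ℝ) : EuclideanSpace ℝ (Fin B.n) :=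
  WithLp.toLp 2 fun α => ip xL xR v (B.φ α)

/-- The piecewise polynomial with given coefficients. -/
def syn (c : EuclideanSpace ℝ (Fin B.n)) : ℝ → ℝ := fun x => ∑ α, c α * B.φ α x

@[simp] lemma coef_apply (v : ℝ → ℝ) (α : Fin B.n) : B.coef v α = ip xL xR v (B.φ α) := rfl

lemma syn_mem (c : EuclideanSpace ℝ (Fin B.n)) : B.syn c ∈ τ.PiecewisePoly j :=
  τ.sum_smul_mem B.mem c

lemma bdd_syn (hx : xL < xR) (c : EuclideanSpace ℝ (Fin B.n)) : Bdd xL xR (B.syn c) :=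
  τ.bdd_of_mem hx (B.syn_mem c)

lemma bdd_φ (hx : xL < xR) (α : Fin B.n) : Bdd xL xR (B.φ α) := τ.bdd_of_mem hx (B.mem α)

lemma ae_eq_syn {q : ℝ → ℝ} (hq : q ∈ τ.PiecewisePoly j) :
    q =ᵐ[dom xL xR] B.syn (B.coef q) := B.expand q hq

lemma inner_coef (hx : xL < xR) {v : ℝ → ℝ} (hv : Bdd xL xR v) (c : EuclideanSpace ℝ (Fin B.n)) :
    inner ℝ (B.coef v) c = ip xL xR v (B.syn c) := by
  rw [ip_comm, show B.syn c = fun x => ∑ α, c α * B.φ α x from rfl,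
    ip_sum_left hx (fun α => (Bdd.const _).mul (B.bdd_φ hx α)) hv, PiLp.inner_apply]
  refine Finset.sum_congr rfl fun α _ => ?_
  rw [ip_smul_left, ip_comm]
  simp

lemma coef_congr (hx : xL < xR) {v w : ℝ → ℝ} (h : v =ᵐ[dom xL xR] w) : B.coef v = B.coef w := by
  ext α
  exact ip_congr hx h Filter.EventuallyEq.rfl

lemma coef_add (hx : xL < xR) {v w : ℝ → ℝ} (hv : Bdd xL xR v) (hw : Bdd xL xR w) :
    B.coef (fun x => v x + w x) = B.coef v + B.coef w := by
  ext α
  exact ip_add_left hx hv hw (B.bdd_φ hx α)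

lemma coef_sub (hx : xL < xR) {v w : ℝ → ℝ} (hv : Bdd xL xR v) (hw : Bdd xL xR w) :
    B.coef (fun x => v x - w x) = B.coef v - B.coef w := by
  ext α
  exact ip_sub_left hx hv hw (B.bdd_φ hx α)

lemma coef_smul (r : ℝ) (v : ℝ → ℝ) : B.coef (fun x => r * v x) = r • B.coef v := by
  ext α
  exact ip_smul_left r v (B.φ α)

lemma coef_syn (hx : xL < xR) (c : EuclideanSpace ℝ (Fin B.n)) : B.coef (B.syn c) = c := by
  ext α
  rw [coef_apply, show B.syn c = fun x => ∑ α, c α * B.φ α x from rfl,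
    ip_sum_left hx (fun α => (Bdd.const _).mul (B.bdd_φ hx α)) (B.bdd_φ hx α)]
  simp [ip_smul_left, B.ip_φ]

lemma l2norm_syn (hx : xL < xR) (c : EuclideanSpace ℝ (Fin B.n)) :
    l2norm xL xR (B.syn c) = ‖c‖ := by
  rw [l2norm, ← B.inner_coef hx (B.bdd_syn hx c), B.coef_syn hx, real_inner_self_eq_norm_sq,
    Real.sqrt_sq (norm_nonneg _)]

lemma norm_coef_le_of_dual (hx : xL < xR) {v : ℝ → ℝ} (hv : Bdd xL xR v) {K : ℝ}
    (hK : 0 ≤ K) (h : ∀ c, ip xL xR v (B.syn c) ≤ K * ‖c‖) : ‖B.coef v‖ ≤ K := by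
  have h1 := h (B.coef v)
  rw [← B.inner_coef hx hv, real_inner_self_eq_norm_sq] at h1
  by_contra! hlt
  nlinarith

lemma norm_coef_le (hx : xL < xR) {v : ℝ → ℝ} (hv : Bdd xL xR v) :
    ‖B.coef v‖ ≤ l2norm xL xR v := by
  refine B.norm_coef_le_of_dual hx hv (l2norm_nonneg v) fun c => ?_
  rw [← B.l2norm_syn hx c]
  exact (le_abs_self _).trans (abs_ip_le hx hv (B.bdd_syn hx c))

lemma l2norm_eq_norm_coef (hx : xL < xR) {q : ℝ → ℝ} (hq : q ∈ τ.PiecewisePoly j) :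
    l2norm xL xR q = ‖B.coef q‖ := by
  rw [l2norm_congr hx (B.ae_eq_syn hq), B.l2norm_syn hx]

lemma ip_sub_proj (hx : xL < xR) {v q : ℝ → ℝ} (hv : Bdd xL xR v) (hq : q ∈ τ.PiecewisePoly j) :
    ip xL xR (fun x => v x - B.syn (B.coef v) x) q = 0 := by
  rw [ip_congr hx Filter.EventuallyEq.rfl (B.ae_eq_syn hq),
    ← B.inner_coef hx (Bdd.sub hv (B.bdd_syn hx _)), B.coef_sub hx hv (B.bdd_syn hx _),
    B.coef_syn hx, sub_self, inner_zero_left]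

/-- The `L²`-projection is the best approximation. -/
lemma l2norm_sub_proj_le (hx : xL < xR) {v q : ℝ → ℝ} (hv : Bdd xL xR v)
    (hq : q ∈ τ.PiecewisePoly j) :
    l2norm xL xR (fun x => v x - B.syn (B.coef v) x) ≤ l2norm xL xR (fun x => v x - q x) := by
  set e := fun x => v x - B.syn (B.coef v) x with he
  have heb : Bdd xL xR e := Bdd.sub hv (B.bdd_syn hx _)
  have hqb := τ.bdd_of_mem hx hq
  -- `e` and `v - q` differ by the piecewise polynomial `π v - q`, to which `e` is orthogonal;
  -- Cauchy-Schwarz then finishes the proof.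
  have h1 : ip xL xR e e = ip xL xR e (fun x => v x - q x) := by
    have h2 : ip xL xR e (fun x => e x - (v x - q x)) = 0 := by
      have : (fun x => e x - (v x - q x)) = fun x => q x - B.syn (B.coef v) x := by
        ext x
        simp only [he]
        ring
      rw [this]
      exact B.ip_sub_proj hx hv (τ.sub_mem hq (B.syn_mem _))
    rw [ip_comm, ip_sub_left hx heb (Bdd.sub hv hqb) heb, ip_comm _ e] at h2
    rw [ip_comm e (fun x => v x - q x)]
    linarith
  have h3 := (le_abs_self _).trans (abs_ip_le hx heb (Bdd.sub hv hqb))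
  change ip xL xR e (fun x => v x - q x) ≤ _ at h3
  rw [← h1, ← l2norm_sq hx, sq] at h3
  by_contra! hlt
  have h4 : 0 ≤ l2norm xL xR (fun x => v x - q x) := l2norm_nonneg _
  nlinarith

end Mesh.ONB

/-! ### Integration on the elements -/

lemma Bdd.intervalIntegrable (hx : xL < xR) {f : ℝ → ℝ} (hf : Bdd xL xR f) {s t : ℝ}
    (hs : s ∈ Icc xL xR) (ht : t ∈ Icc xL xR) : IntervalIntegrable f volume s t := by
  have h1 : IntervalIntegrable f volume xL xR := by
    rw [intervalIntegrable_iff_integrableOn_Ioo_of_le hx.le]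
    exact hf.integrable
  refine h1.mono_set ?_
  rw [uIcc_of_le hx.le]
  exact (uIcc_subset_Icc hs ht)

lemma Mesh.exists_mem_openElem (τ : Mesh xL xR) (hx : xL < xR) {x : ℝ} (h : x ∈ Ioo xL xR)
    (hn : x ∉ range τ.node) : ∃ i, x ∈ τ.openElem i := by
  obtain ⟨i, hi⟩ := τ.exists_mem_elem hx ⟨h.1.le, h.2.le⟩
  refine ⟨i, lt_of_le_of_ne hi.1 ?_, lt_of_le_of_ne hi.2 ?_⟩
  · intro h
    exact hn ⟨_, h⟩
  · intro h
    exact hn ⟨_, h.symm⟩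

lemma Mesh.continuousOn_of_elem (τ : Mesh xL xR) (hx : xL < xR) {v : ℝ → ℝ}
    (h : ∀ i, ContinuousOn v (τ.elem i)) : ContinuousOn v (Icc xL xR) := by
  refine ((locallyFinite_of_finite τ.elem).continuousOn_iUnion (fun i => isClosed_Icc) h).mono ?_
  intro x hxx
  obtain ⟨i, hi⟩ := τ.exists_mem_elem hx hxx
  exact mem_iUnion.2 ⟨i, hi⟩

/-- The fundamental theorem of calculus for continuous, piecewise differentiable functions. -/
lemma Mesh.integral_eq_sub (τ : Mesh xL xR) (hx : xL < xR) {v v' : ℝ → ℝ}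
    (hv : ContinuousOn v (Icc xL xR)) (hd : ∀ i, ∀ x ∈ τ.openElem i, HasDerivAt v (v' x) x)
    (hb : Bdd xL xR v') {s t : ℝ} (hs : s ∈ Icc xL xR) (ht : t ∈ Icc xL xR) :
    ∫ x in s..t, v' x = v t - v s := by
  refine integral_eq_of_hasDerivAt_off_countable v v' (s := range τ.node)
    (Set.finite_range _).countable (hv.mono (uIcc_subset_Icc hs ht)) ?_
    (hb.intervalIntegrable hx hs ht)
  rintro x ⟨hxx, hxn⟩
  obtain ⟨i, hi⟩ := τ.exists_mem_openElem hx
    (Ioo_subset_Ioo (le_min hs.1 ht.1) (max_le hs.2 ht.2) hxx) hxn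
  exact hd i x hi

/-- This is Cauchy-Schwarz against the constant 1, obtained from the nonnegativity of the variance
`∫ (|e| - m)²` with `m` the mean of `|e|`. -/
lemma sq_integral_abs_le {s t : ℝ} (hst : s < t) {e : ℝ → ℝ} (h1 : IntegrableOn e (Ioo s t))
    (h2 : IntegrableOn (fun x => e x * e x) (Ioo s t)) :
    (∫ x in Ioo s t, |e x|) ^ 2 ≤ (t - s) * ∫ x in Ioo s t, e x * e x := by
  set J := ∫ x in Ioo s t, |e x|
  have hl : 0 < t - s := sub_pos.2 hst
  set m := J / (t - s) with hm
  have h0 : 0 ≤ ∫ x in Ioo s t, (|e x| - m) ^ 2 := integral_nonneg fun x => sq_nonneg _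
  have h3 : ∫ x in Ioo s t, (|e x| - m) ^ 2
      = (∫ x in Ioo s t, e x * e x) - 2 * m * J + m ^ 2 * (t - s) := by
    have : ∀ x, (|e x| - m) ^ 2 = e x * e x - 2 * m * |e x| + m ^ 2 := by
      intro x
      rw [sub_sq, sq_abs]
      ring
    simp_rw [this]
    have i1 : IntegrableOn (fun x => 2 * m * |e x|) (Ioo s t) := h1.abs.const_mul _
    have i2 : IntegrableOn (fun x => e x * e x - 2 * m * |e x|) (Ioo s t) := h2.sub i1
    rw [integral_add i2 (integrable_const _), integral_sub h2 i1, integral_const_mul]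
    congr 1
    simp [hst.le, mul_comm]
  rw [h3] at h0
  have h4 : J = m * (t - s) := by
    rw [hm]
    field_simp
  have h5 : 0 ≤ (∫ x in Ioo s t, e x * e x) - m ^ 2 * (t - s) := by
    have : 2 * m * J = 2 * (m ^ 2 * (t - s)) := by rw [h4]; ring
    linarith
  have h6 := mul_nonneg hl.le h5
  rw [h4]
  nlinarith

/-! ### Piecewise smooth functions of one variable -/

/-- On every element, `v` has `n` derivatives, where `v` and the first `r` derivatives are bounded
by `K`. -/
def Mesh.SmoothBound (τ : Mesh xL xR) (n r : ℕ) (K : ℝ) (v : ℝ → ℝ) : Prop :=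
  ∀ i, ∃ c : ℕ → ℝ → ℝ, (∀ x ∈ τ.elem i, c 0 x = v x) ∧
    (∀ j < n, ∀ x ∈ τ.elem i, HasDerivWithinAt (c j) (c (j + 1) x) (τ.elem i) x) ∧
    ∀ j ≤ r, ∀ x ∈ τ.elem i, |c j x| ≤ K

namespace Mesh.SmoothBound

variable {τ : Mesh xL xR} {n r : ℕ} {K : ℝ} {v : ℝ → ℝ}

lemma nonneg (h : τ.SmoothBound n r K v) (hx : xL < xR) : 0 ≤ K := by
  obtain ⟨c, -, -, hK⟩ := h ⟨0, Nat.pos_of_ne_zero (τ.N_ne_zero hx)⟩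
  exact (abs_nonneg _).trans (hK 0 (Nat.zero_le _) _ (τ.left_mem _))

lemma abs_le (h : τ.SmoothBound n r K v) (hx : xL < xR) {x : ℝ} (hxx : x ∈ Icc xL xR) :
    |v x| ≤ K := by
  obtain ⟨i, hi⟩ := τ.exists_mem_elem hx hxx
  obtain ⟨c, h0, -, hK⟩ := h i
  rw [← h0 x hi]
  exact hK 0 (Nat.zero_le _) x hi

/-- Derivatives within a closed element are two-sided derivatives at interior points, so `deriv v`
agrees there with the first member of the chain. -/
lemma hasDerivAt_chain (h : 0 < n) {i : Fin τ.N} {c : ℕ → ℝ → ℝ}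
    (h0 : ∀ x ∈ τ.elem i, c 0 x = v x)
    (hd : ∀ j < n, ∀ x ∈ τ.elem i, HasDerivWithinAt (c j) (c (j + 1) x) (τ.elem i) x)
    {x : ℝ} (hxx : x ∈ τ.openElem i) : HasDerivAt v (c 1 x) x := by
  refine ((hd 0 h x (τ.openElem_subset_elem i hxx)).hasDerivAt
    (τ.elem_mem_nhds hxx)).congr_of_eventuallyEq ?_
  filter_upwards [τ.elem_mem_nhds hxx] with y hy using (h0 y hy).symm

lemma hasDerivAt (h : τ.SmoothBound n r K v) (hn : 0 < n) {i : Fin τ.N} {x : ℝ}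
    (hxx : x ∈ τ.openElem i) : HasDerivAt v (deriv v x) x := by
  obtain ⟨c, h0, hd, -⟩ := h i
  exact (hasDerivAt_chain hn h0 hd hxx).differentiableAt.hasDerivAt

lemma abs_deriv_le (h : τ.SmoothBound n r K v) (hn : 0 < n) (hr : 1 ≤ r) {i : Fin τ.N} {x : ℝ}
    (hxx : x ∈ τ.openElem i) : |deriv v x| ≤ K := by
  obtain ⟨c, h0, hd, hK⟩ := h i
  rw [(hasDerivAt_chain hn h0 hd hxx).deriv]
  exact hK 1 hr x (τ.openElem_subset_elem i hxx)

lemma continuousOn (h : τ.SmoothBound n r K v) (hx : xL < xR) (hn : 0 < n) :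
    ContinuousOn v (Icc xL xR) := by
  refine τ.continuousOn_of_elem hx fun i => ?_
  obtain ⟨c, h0, hd, -⟩ := h i
  exact (show ContinuousOn (c 0) (τ.elem i) from
    fun x hxi => (hd 0 hn x hxi).continuousWithinAt).congr fun x hxi => (h0 x hxi).symm

lemma bdd (h : τ.SmoothBound n r K v) (hx : xL < xR) (hn : 0 < n) : Bdd xL xR v :=
  Bdd.of_continuousOn_elem τ hx (c := fun _ => v)
    (fun i => (h.continuousOn hx hn).mono (τ.elem_subset i)) fun _ _ _ => rfl

lemma bdd_deriv (h : τ.SmoothBound n r K v) (hx : xL < xR) (hn : 2 ≤ n) :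
    Bdd xL xR (deriv v) := by
  choose c h0 hd hK using h
  exact Bdd.of_continuousOn_elem τ hx (c := fun i => c i 1)
    (fun i x hxi => (hd i 1 (by omega) x hxi).continuousWithinAt)
    fun i x hxi => (hasDerivAt_chain (by omega) (h0 i) (hd i) hxi).deriv

lemma sub {K' : ℝ} {w : ℝ → ℝ} (h : τ.SmoothBound n r K v) (h' : τ.SmoothBound n r K' w) :
    τ.SmoothBound n r (K + K') (fun x => v x - w x) := by
  intro i
  obtain ⟨c, h0, hd, hK⟩ := h i
  obtain ⟨c', h0', hd', hK'⟩ := h' i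
  refine ⟨fun j x => c j x - c' j x, fun x hxi => ?_, fun j hj x hxi => ?_, fun j hj x hxi => ?_⟩
  · simp only [h0 x hxi, h0' x hxi]
  · exact (hd j hj x hxi).sub (hd' j hj x hxi)
  · exact (abs_sub _ _).trans (add_le_add (hK j hj x hxi) (hK' j hj x hxi))

lemma smul (a : ℝ) (h : τ.SmoothBound n r K v) :
    τ.SmoothBound n r (|a| * K) (fun x => a * v x) := by
  intro i
  obtain ⟨c, h0, hd, hK⟩ := h i
  refine ⟨fun j x => a * c j x, fun x hxi => ?_, fun j hj x hxi => ?_, fun j hj x hxi => ?_⟩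
  · simp only [h0 x hxi]
  · exact (hd j hj x hxi).const_mul a
  · rw [abs_mul]
    exact mul_le_mul_of_nonneg_left (hK j hj x hxi) (abs_nonneg a)

end Mesh.SmoothBound

/-! ### Taylor polynomials and antiderivatives -/

/-- The Taylor polynomial of degree less than `n` at `s` for a sequence of successive
derivatives. -/
noncomputable def taylorPoly (n : ℕ) (c : ℕ → ℝ → ℝ) (s : ℝ) : Polynomial ℝ :=
  ∑ m ∈ Finset.range n, Polynomial.C (c m s / m.factorial) * (Polynomial.X - Polynomial.C s) ^ m

lemma natDegree_taylorPoly (n : ℕ) (c : ℕ → ℝ → ℝ) (s : ℝ) :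
    (taylorPoly n c s).natDegree ≤ n - 1 := by
  refine Polynomial.natDegree_sum_le_of_forall_le _ _ fun m hm => ?_
  refine (Polynomial.natDegree_C_mul_le _ _).trans ?_
  rw [Polynomial.natDegree_pow, Polynomial.natDegree_X_sub_C]
  have := Finset.mem_range.1 hm
  omega

lemma derivative_taylorPoly (n : ℕ) (c : ℕ → ℝ → ℝ) (s : ℝ) :
    (taylorPoly (n + 1) c s).derivative = taylorPoly n (fun j => c (j + 1)) s := by
  rw [taylorPoly, Finset.sum_range_succ', Polynomial.derivative_add, Polynomial.derivative_sum,
    taylorPoly]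
  simp only [Polynomial.derivative_C_mul, Polynomial.derivative_X_sub_C_pow]
  simp only [Nat.factorial_zero, Nat.cast_one, div_one, Nat.add_sub_cancel, mul_zero, Nat.cast_zero, Polynomial.C_0, zero_mul, add_zero]
  refine Finset.sum_congr rfl fun m _ => ?_
  rw [← mul_assoc, ← Polynomial.C_mul]
  congr 2
  rw [Nat.factorial_succ]
  push_cast
  have : (m.factorial : ℝ) ≠ 0 := by positivity
  have : (m : ℝ) + 1 ≠ 0 := by positivity
  field_simp

lemma eval_taylorPoly_self (n : ℕ) (c : ℕ → ℝ → ℝ) (s : ℝ) :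
    (taylorPoly (n + 1) c s).eval s = c 0 s := by
  rw [taylorPoly, Finset.sum_range_succ']
  simp [Polynomial.eval_finsetSum]

/-- Induction on the order: the derivative of a Taylor polynomial is the Taylor polynomial of the
shifted sequence, and the mean value inequality turns a bound for the derivative of the remainder
into one for the remainder. The factorials are given away. -/
lemma abs_sub_taylorPoly_le (n : ℕ) (c : ℕ → ℝ → ℝ) {s t K : ℝ} (hst : s ≤ t)
    (hd : ∀ j < n, ∀ x ∈ Icc s t, HasDerivWithinAt (c j) (c (j + 1) x) (Icc s t) x)
    (hK : ∀ x ∈ Icc s t, |c n x| ≤ K) :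
    ∀ x ∈ Icc s t, |c 0 x - (taylorPoly n c s).eval x| ≤ K * (t - s) ^ n := by
  induction n generalizing c with
  | zero => simpa [taylorPoly] using hK
  | succ n ih =>
    intro x hx
    have h1 := ih (fun j => c (j + 1)) (fun j hj => hd (j + 1) (by omega)) hK
    have h2 := (convex_Icc s t).norm_image_sub_le_of_norm_hasDerivWithin_le
      (f := fun x => c 0 x - (taylorPoly (n + 1) c s).eval x)
      (f' := fun x => c 1 x - (taylorPoly n (fun j => c (j + 1)) s).eval x)
      (C := K * (t - s) ^ n) (fun y hy => by
        rw [← derivative_taylorPoly]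
        exact (hd 0 (by omega) y hy).sub ((taylorPoly (n + 1) c s).hasDerivWithinAt y _)) h1
      (left_mem_Icc.2 hst) hx
    simp only [eval_taylorPoly_self, sub_self, sub_zero, Real.norm_eq_abs] at h2
    refine h2.trans ?_
    rw [pow_succ, ← mul_assoc]
    have h3 : 0 ≤ K * (t - s) ^ n := (abs_nonneg _).trans (h1 s (left_mem_Icc.2 hst))
    refine mul_le_mul_of_nonneg_left ?_ h3
    rw [abs_of_nonneg (sub_nonneg.2 hx.1)]
    linarith [hx.2]

lemma exists_antiderivative (q : Polynomial ℝ) :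
    ∃ Q : Polynomial ℝ, Q.derivative = q ∧ Q.natDegree ≤ q.natDegree + 1 := by
  refine ⟨∑ m ∈ Finset.range (q.natDegree + 1),
    Polynomial.C (q.coeff m / (m + 1)) * Polynomial.X ^ (m + 1), ?_, ?_⟩
  · conv_rhs => rw [q.as_sum_range_C_mul_X_pow]
    rw [Polynomial.derivative_sum]
    refine Finset.sum_congr rfl fun m _ => ?_
    have : (m : ℝ) + 1 ≠ 0 := by positivity
    rw [Polynomial.derivative_C_mul_X_pow]
    congr 2
    push_cast
    field_simp
  · refine Polynomial.natDegree_sum_le_of_forall_le _ _ fun m hm => ?_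
    refine (Polynomial.natDegree_C_mul_X_pow_le _ _).trans ?_
    have := Finset.mem_range.1 hm
    omega

/-! ### The `H¹`-projection -/

namespace Mesh.ONB

variable {τ : Mesh xL xR} {j : ℕ} (B : τ.ONB j)

/-- The continuous piecewise polynomial that agrees with `v` at the left end point and whose
derivative is the `L²`-projection of the derivative of `v`. -/
noncomputable def interp (v : ℝ → ℝ) : ℝ → ℝ :=
  fun x => v xL + ∫ y in xL..x, B.syn (B.coef (deriv v)) y

lemma interp_sub_interp (hx : xL < xR) (v : ℝ → ℝ) {s t : ℝ} (hs : s ∈ Icc xL xR)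
    (ht : t ∈ Icc xL xR) :
    B.interp v t - B.interp v s = ∫ y in s..t, B.syn (B.coef (deriv v)) y := by
  have hL : xL ∈ Icc xL xR := left_mem_Icc.2 hx.le
  have hb := B.bdd_syn hx (B.coef (deriv v))
  rw [interp, interp, ← intervalIntegral.integral_add_adjacent_intervals
    (hb.intervalIntegrable hx hL hs) (hb.intervalIntegrable hx hs ht)]
  ring

lemma continuousOn_interp (hx : xL < xR) (v : ℝ → ℝ) :
    ContinuousOn (B.interp v) (Icc xL xR) := by
  have hb := B.bdd_syn hx (B.coef (deriv v))
  have hL : xL ∈ Icc xL xR := left_mem_Icc.2 hx.le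
  have hR : xR ∈ Icc xL xR := right_mem_Icc.2 hx.le
  have := intervalIntegral.continuousOn_primitive_interval'
    (hb.intervalIntegrable hx hL hR) left_mem_uIcc
  rw [uIcc_of_le hx.le] at this
  exact continuousOn_const.add this

/-- On one element the integrand is a polynomial of degree at most `j`, so its integral is an
antiderivative, with the constant fixed at the left node. -/
lemma interp_eq_eval (hx : xL < xR) (v : ℝ → ℝ) (i : Fin τ.N) :
    ∃ q : Polynomial ℝ, q.natDegree ≤ j + 1 ∧ (∀ x ∈ τ.openElem i, B.interp v x = q.eval x) ∧
      ∀ x ∈ τ.openElem i, q.derivative.eval x = B.syn (B.coef (deriv v)) x := by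
  obtain ⟨g, hg, h⟩ := B.syn_mem (B.coef (deriv v)) i
  obtain ⟨Q, hQ, hdeg⟩ := exists_antiderivative g
  set s := τ.node i.castSucc
  refine ⟨Q + Polynomial.C (B.interp v s - Q.eval s), ?_, fun x hxi => ?_, fun x hxi => ?_⟩
  · rw [Polynomial.natDegree_add_C]
    omega
  · have hxe := τ.openElem_subset_elem i hxi
    have h1 := B.interp_sub_interp hx v (τ.node_mem i.castSucc) (τ.elem_subset i hxe)
    have h2 : ∫ y in s..x, B.syn (B.coef (deriv v)) y = ∫ y in s..x, Q.derivative.eval y := by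
      rw [intervalIntegral.integral_of_le hxe.1, intervalIntegral.integral_of_le hxe.1]
      refine setIntegral_congr_fun measurableSet_Ioc fun y hy => ?_
      rw [hQ]
      exact h y ⟨hy.1, hy.2.trans_lt hxi.2⟩
    rw [h2, intervalIntegral.integral_eq_sub_of_hasDerivAt (f := fun y => Q.eval y)
      (fun y _ => Q.hasDerivAt y) (Q.derivative.continuous.intervalIntegrable _ _)] at h1
    simp only [Polynomial.eval_add, Polynomial.eval_C]
    linarith
  · simp [hQ, h x hxi]

lemma interp_mem (hx : xL < xR) (v : ℝ → ℝ) : B.interp v ∈ τ.V (j + 1) := by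
  refine ⟨fun i => ?_, B.continuousOn_interp hx v⟩
  obtain ⟨q, hq, h, -⟩ := B.interp_eq_eval hx v i
  exact ⟨q, hq, h⟩

lemma deriv_interp (hx : xL < xR) (v : ℝ → ℝ) {i : Fin τ.N} {x : ℝ} (hxi : x ∈ τ.openElem i) :
    deriv (B.interp v) x = B.syn (B.coef (deriv v)) x := by
  obtain ⟨q, hq, h, h'⟩ := B.interp_eq_eval hx v i
  rw [(τ.deriv_eq h hxi).deriv, h' x hxi]

/-- This is the reason for comparing with the `H¹`-projection: the error equations contain no
consistency error from the spatial derivative. -/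
lemma coef_deriv_interp (hx : xL < xR) (v : ℝ → ℝ) :
    B.coef (deriv (B.interp v)) = B.coef (deriv v) := by
  rw [B.coef_congr hx (τ.ae_of_openElem hx fun i x hxi => B.deriv_interp hx v hxi),
    B.coef_syn hx]

lemma bdd_interp (hx : xL < xR) (v : ℝ → ℝ) : Bdd xL xR (B.interp v) :=
  τ.bdd_of_mem hx (B.interp_mem hx v).1

@[simp] lemma interp_left (v : ℝ → ℝ) : B.interp v xL = v xL := by
  simp [interp]

lemma sub_interp_sub (hx : xL < xR) {n r : ℕ} {K : ℝ} {v : ℝ → ℝ} (hv : τ.SmoothBound n r K v)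
    (hn : 2 ≤ n) {s t : ℝ} (hs : s ∈ Icc xL xR) (ht : t ∈ Icc xL xR) :
    (v t - B.interp v t) - (v s - B.interp v s)
      = ∫ y in s..t, (deriv v y - B.syn (B.coef (deriv v)) y) := by
  rw [intervalIntegral.integral_sub ((hv.bdd_deriv hx hn).intervalIntegrable hx hs ht)
    ((B.bdd_syn hx _).intervalIntegrable hx hs ht), ← B.interp_sub_interp hx v hs ht,
    τ.integral_eq_sub hx (hv.continuousOn hx (by omega))
      (fun i x hxi => hv.hasDerivAt (by omega) hxi) (hv.bdd_deriv hx hn) hs ht]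
  ring

/-- The error at a node is the integral of `v' - π v'` from `xL` up to that node. This is a scalar
product with a piecewise constant function, hence zero. -/
lemma interp_node (hx : xL < xR) {n r : ℕ} {K : ℝ} {v : ℝ → ℝ} (hv : τ.SmoothBound n r K v)
    (hn : 2 ≤ n) (l : Fin (τ.N + 1)) : B.interp v (τ.node l) = v (τ.node l) := by
  classical
  set e := fun y => deriv v y - B.syn (B.coef (deriv v)) y with he
  have h1 := B.sub_interp_sub hx hv hn (left_mem_Icc.2 hx.le) (τ.node_mem l)
  have hmem : (Iio (τ.node l)).indicator (fun _ => (1 : ℝ)) ∈ τ.PiecewisePoly j := by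
    intro i
    by_cases hil : τ.node i.succ ≤ τ.node l
    · refine ⟨1, by simp, fun x hxi => ?_⟩
      rw [indicator_of_mem (show x ∈ Iio (τ.node l) from hxi.2.trans_le hil)]
      simp
    · refine ⟨0, by simp, fun x hxi => ?_⟩
      have hle : τ.node l ≤ τ.node i.castSucc := by
        apply τ.strictMono_node.monotone
        have := τ.strictMono_node.lt_iff_lt.1 (not_le.1 hil)
        rw [Fin.lt_def] at this
        rw [Fin.le_def]
        simp at this ⊢
        omega
      rw [indicator_of_notMem (fun h : x ∈ Iio (τ.node l) => absurd (hxi.1.trans h) hle.not_gt)]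
      simp
  have h2 := B.ip_sub_proj hx (hv.bdd_deriv hx hn) hmem
  rw [ip_eq hx] at h2
  have h3 : ∫ y in xL..τ.node l, e y = 0 := by
    rw [intervalIntegral.integral_of_le (τ.node_mem l).1, integral_Ioc_eq_integral_Ioo, ← h2]
    have h4 : ∀ x, e x * (Iio (τ.node l)).indicator (fun _ => (1 : ℝ)) x
        = (Iio (τ.node l)).indicator e x := by
      intro x
      by_cases hxl : x ∈ Iio (τ.node l) <;> simp [hxl]
    change _ = ∫ x in Ioo xL xR, e x * (Iio (τ.node l)).indicator (fun _ => (1 : ℝ)) x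
    simp_rw [h4]
    rw [integral_indicator measurableSet_Iio, Measure.restrict_restrict measurableSet_Iio]
    congr 2
    ext x
    simp only [mem_Ioo, mem_inter_iff, mem_Iio]
    constructor
    · exact fun h => ⟨h.2, h.1, h.2.trans_le (τ.node_mem l).2⟩
    · exact fun h => ⟨h.2.1, h.1⟩
  rw [h3] at h1
  simp at h1
  linarith

/-- The error of the `H¹`-projection. -/
lemma abs_sub_interp_le (hx : xL < xR) {n r : ℕ} {K : ℝ} {v : ℝ → ℝ} (hv : τ.SmoothBound n r K v)
    (hn : 2 ≤ n) {l : ℕ} (hl : l ≤ j + 1) (hln : l + 1 ≤ n) (hlr : l + 1 ≤ r) {x : ℝ}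
    (hxx : x ∈ Icc xL xR) : |v x - B.interp v x| ≤ K * τ.size ^ (l + 1) := by
  have hK := hv.nonneg hx
  obtain ⟨i, hxi⟩ := τ.exists_mem_elem hx hxx
  obtain ⟨c, h0, hd, hb⟩ := hv i
  set s := τ.node i.castSucc with hs
  set t := τ.node i.succ with ht
  have hst : s < t := τ.node_lt i
  set g := B.syn (B.coef (deriv v)) with hg
  set e := fun y => deriv v y - g y with he
  have hvb := hv.bdd_deriv hx hn
  have hgb : Bdd xL xR g := B.bdd_syn hx _
  have heb : Bdd xL xR e := hvb.sub hgb
  -- The comparison function is the Taylor polynomial of `v'` with `l` terms; its degree is at most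
  -- `j` because `l ≤ j + 1`.
  set q := taylorPoly l (fun m => c (m + 1)) s with hq
  have hqdeg : q.natDegree ≤ j := (natDegree_taylorPoly _ _ _).trans (by omega)
  have hqerr : ∀ y ∈ τ.elem i, |c 1 y - q.eval y| ≤ K * (t - s) ^ l :=
    abs_sub_taylorPoly_le l (fun m => c (m + 1)) hst.le
      (fun m hm => hd (m + 1) (by omega)) (hb (l + 1) hlr)
  have hqb : Bdd xL xR (fun y => q.eval y) := τ.bdd_of_mem hx (τ.eval_mem hqdeg)
  have hon : ∀ {f : ℝ → ℝ}, Bdd xL xR f → IntegrableOn f (Ioo s t) := fun hf =>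
    hf.integrable.mono_measure (Measure.restrict_mono (τ.openElem_subset i) le_rfl)
  -- Orthogonality localizes to one element, since the test space contains the cut-off of `g - q` to
  -- that element.
  have horth : ∫ y in Ioo s t, e y * (g y - q.eval y) = 0 := by
    have h1 := B.ip_sub_proj hx hvb
      (τ.indicator_mem i (τ.sub_mem (B.syn_mem (B.coef (deriv v))) (τ.eval_mem hqdeg)))
    rw [ip_eq hx] at h1
    rw [← h1, show Ioo s t = τ.openElem i from rfl, ← inter_eq_self_of_subset_left
      (τ.openElem_subset i), ← Measure.restrict_restrict (τ.measurableSet_openElem i),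
      ← integral_indicator (τ.measurableSet_openElem i)]
    congr 1
    ext y
    by_cases hy : y ∈ τ.openElem i <;> simp [hy, he, hg]
    left
    rw [inter_eq_self_of_subset_left (τ.openElem_subset i)]
    simp [hy]
  -- Pythagoras on the element: `v' - q` is the orthogonal sum of `e` and `g - q`, so `e` is no
  -- larger than the Taylor remainder in `L²`.
  have hsq : ∫ y in Ioo s t, e y * e y ≤ (t - s) * (K * (t - s) ^ l) ^ 2 := by
    have hgq := hgb.sub hqb
    have i2 : IntegrableOn (fun y => e y * e y + 2 * (e y * (g y - q.eval y))) (Ioo s t) :=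
      (hon (heb.mul heb)).add ((hon (heb.mul hgq)).const_mul 2)
    have h1 : ∫ y in Ioo s t, e y * e y
        ≤ ∫ y in Ioo s t, (e y * e y + 2 * (e y * (g y - q.eval y))
            + (g y - q.eval y) * (g y - q.eval y)) := by
      rw [integral_add i2 (hon (hgq.mul hgq)), integral_add (hon (heb.mul heb)) ((hon (heb.mul hgq)).const_mul 2),
        integral_const_mul, horth]
      have : 0 ≤ ∫ y in Ioo s t, (g y - q.eval y) * (g y - q.eval y) :=
        integral_nonneg fun y => mul_self_nonneg _
      linarith
    refine h1.trans ?_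
    have h2 : ∫ y in Ioo s t, (e y * e y + 2 * (e y * (g y - q.eval y))
            + (g y - q.eval y) * (g y - q.eval y)) ≤ ∫ _ in Ioo s t, (K * (t - s) ^ l) ^ 2 := by
      refine setIntegral_mono_on (i2.add (hon (hgq.mul hgq))) (integrable_const _) measurableSet_Ioo fun y hy => ?_
      have h3 := hqerr y (τ.openElem_subset_elem i hy)
      rw [← (Mesh.SmoothBound.hasDerivAt_chain (by omega) h0 hd hy).deriv] at h3
      have h4 : e y * e y + 2 * (e y * (g y - q.eval y)) + (g y - q.eval y) * (g y - q.eval y)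
          = |deriv v y - q.eval y| ^ 2 := by
        rw [sq_abs]
        simp only [he]
        ring
      rw [h4]
      exact pow_le_pow_left₀ (abs_nonneg _) h3 2
    refine h2.trans (le_of_eq ?_)
    simp [hst.le]
  have hint : ∫ y in Ioo s t, |e y| ≤ (t - s) * (K * (t - s) ^ l) := by
    have h1 := sq_integral_abs_le hst (hon heb) (hon (heb.mul heb))
    have hts : 0 < t - s := sub_pos.2 hst
    refine le_of_sq_le_sq ?_ (by positivity)
    calc _ ≤ _ := h1
      _ ≤ (t - s) * ((t - s) * (K * (t - s) ^ l) ^ 2) := mul_le_mul_of_nonneg_left hsq hts.le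
      _ = _ := by ring
  -- The error vanishes at the left node of the element; integrating `e` from there gains the last
  -- power of the mesh size.
  have h1 := B.sub_interp_sub hx hv hn (τ.node_mem i.castSucc) hxx
  rw [B.interp_node hx hv hn, sub_self, sub_zero] at h1
  rw [h1]
  calc |∫ y in s..x, e y| ≤ ∫ y in s..x, |e y| := intervalIntegral.abs_integral_le_integral_abs hxi.1
    _ ≤ ∫ y in Ioo s t, |e y| := by
      rw [intervalIntegral.integral_of_le hxi.1, integral_Ioc_eq_integral_Ioo]
      exact setIntegral_mono_set (hon heb).abs (Filter.Eventually.of_forall fun y => abs_nonneg _)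
        (LE.le.eventuallyLE (Ioo_subset_Ioo le_rfl hxi.2))
    _ ≤ (t - s) * (K * (t - s) ^ l) := hint
    _ = K * (t - s) ^ (l + 1) := by ring
    _ ≤ K * τ.size ^ (l + 1) := by
      have := τ.length_le_size i
      have h0 : 0 ≤ t - s := sub_nonneg.2 hst.le
      gcongr

/-- The `H¹`-projection is unique. -/
lemma eq_interp (hx : xL < xR) {v w : ℝ → ℝ} (hw : w ∈ τ.V (j + 1)) (h0 : w xL = v xL)
    (h : ∀ q ∈ τ.PiecewisePoly j, ip xL xR (deriv w) q = ip xL xR (deriv v) q) {x : ℝ}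
    (hxx : x ∈ Icc xL xR) : w x = B.interp v x := by
  have hdm : deriv w ∈ τ.PiecewisePoly j := τ.deriv_mem hw.1
  have hc : B.coef (deriv w) = B.coef (deriv v) := by
    ext α
    exact h _ (B.mem α)
  have h1 := τ.integral_eq_sub hx hw.2 (fun i x hxi => τ.hasDerivAt_of_mem hw.1 hxi)
    (τ.bdd_of_mem hx hdm) (left_mem_Icc.2 hx.le) hxx
  have h2 := B.ae_eq_syn hdm
  rw [hc] at h2
  have h3 : ∫ y in xL..x, deriv w y = ∫ y in xL..x, B.syn (B.coef (deriv v)) y := by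
    rw [intervalIntegral.integral_of_le hxx.1, intervalIntegral.integral_of_le hxx.1,
      integral_Ioc_eq_integral_Ioo, integral_Ioc_eq_integral_Ioo]
    exact integral_congr_ae (ae_mono (Measure.restrict_mono (Ioo_subset_Ioo le_rfl hxx.2) le_rfl) h2)
  rw [interp, ← h3, h1, h0]
  ring

lemma interp_sub (hx : xL < xR) {v w : ℝ → ℝ} {n r n' r' : ℕ} {K K' : ℝ}
    (hv : τ.SmoothBound n r K v) (hw : τ.SmoothBound n' r' K' w) (hn : 2 ≤ n) (hn' : 2 ≤ n')
    {x : ℝ} (hxx : x ∈ Icc xL xR) :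
    B.interp (fun x => v x - w x) x = B.interp v x - B.interp w x := by
  have hL : xL ∈ Icc xL xR := left_mem_Icc.2 hx.le
  have h1 : B.coef (deriv fun x => v x - w x) = B.coef (deriv v) - B.coef (deriv w) := by
    rw [← B.coef_sub hx (hv.bdd_deriv hx hn) (hw.bdd_deriv hx hn')]
    refine B.coef_congr hx (τ.ae_of_openElem hx fun i x hxi => ?_)
    exact ((hv.hasDerivAt (by omega) hxi).sub (hw.hasDerivAt (by omega) hxi)).deriv
  rw [interp, interp, interp, h1]
  have h2 : B.syn (B.coef (deriv v) - B.coef (deriv w))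
      = fun x => B.syn (B.coef (deriv v)) x - B.syn (B.coef (deriv w)) x := by
    ext x
    simp [syn, sub_mul]
  rw [h2, intervalIntegral.integral_sub ((B.bdd_syn hx _).intervalIntegrable hx hL hxx)
    ((B.bdd_syn hx _).intervalIntegrable hx hL hxx)]
  ring

lemma interp_smul (a : ℝ) (v : ℝ → ℝ) (x : ℝ) :
    B.interp (fun x => a * v x) x = a * B.interp v x := by
  have h1 : B.coef (deriv fun x => a * v x) = a • B.coef (deriv v) := by
    rw [← B.coef_smul]
    congr 1
    ext x
    exact deriv_const_mul_field a
  rw [interp, interp, h1]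
  have h2 : B.syn (a • B.coef (deriv v)) = fun x => a * B.syn (B.coef (deriv v)) x := by
    ext x
    simp [syn, Finset.mul_sum, mul_assoc]
  rw [h2, intervalIntegral.integral_const_mul]
  ring

end Mesh.ONB

/-! ### Weak derivatives -/

/-- Primitives of test functions with mean value zero are test functions. -/
lemma isTest_primitive {s t α β : ℝ} (hα : s < α) (hβ : β < t) {g : ℝ → ℝ}
    (hg : ContDiff ℝ (⊤ : ℕ∞) g) (hsupp : ∀ x, x ∉ Icc α β → g x = 0)
    (hint : ∫ x in s..t, g x = 0) :
    ContDiff ℝ (⊤ : ℕ∞) (fun x => ∫ y in s..x, g y) ∧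
      HasCompactSupport (fun x => ∫ y in s..x, g y) ∧
      tsupport (fun x => ∫ y in s..x, g y) ⊆ Ioo s t ∧
      deriv (fun x => ∫ y in s..x, g y) = g := by
  have hder : ∀ x, HasDerivAt (fun x => ∫ y in s..x, g y) (g x) x := fun x =>
    intervalIntegral.integral_hasDerivAt_right (hg.continuous.intervalIntegrable _ _)
      hg.continuous.stronglyMeasurable.stronglyMeasurableAtFilter hg.continuous.continuousAt
  have hder' : deriv (fun x => ∫ y in s..x, g y) = g := funext fun x => (hder x).deriv
  -- To the left of `α` the integrand vanishes; to the right of `β` the integral has already reached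
  -- its full value, which is zero.
  have hzero : ∀ x, x ∉ Icc α β → ∫ y in s..x, g y = 0 := by
    intro x hx
    by_cases hxα : x < α
    · rw [intervalIntegral.integral_congr (g := fun _ => 0), intervalIntegral.integral_zero]
      intro y hy
      refine hsupp y fun h => ?_
      have : y ≤ max s x := hy.2
      exact absurd (h.1.trans this) (not_le.2 (max_lt hα hxα))
    · have hxβ : β < x := by
        by_contra! h
        exact hx ⟨not_lt.1 hxα, h⟩
      rw [← intervalIntegral.integral_add_adjacent_intervals
        (hg.continuous.intervalIntegrable s t) (hg.continuous.intervalIntegrable t x), hint,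
        zero_add, intervalIntegral.integral_congr (g := fun _ => 0), intervalIntegral.integral_zero]
      intro y hy
      refine hsupp y fun h => ?_
      have : min t x ≤ y := hy.1
      exact absurd (this.trans h.2) (not_le.2 (lt_min hβ hxβ))
  have hts : tsupport (fun x => ∫ y in s..x, g y) ⊆ Icc α β := by
    refine closure_minimal (fun x hx => ?_) isClosed_Icc
    by_contra h
    exact hx (hzero x h)
  refine ⟨?_, HasCompactSupport.of_support_subset_isCompact isCompact_Icc
    ((subset_tsupport _).trans hts), hts.trans (Icc_subset_Ioo hα hβ), hder'⟩
  rw [contDiff_infty_iff_deriv, hder']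
  exact ⟨fun x => (hder x).differentiableAt, hg⟩

/-- A function whose weak derivative vanishes is constant. -/
lemma exists_ae_eq_const {s t : ℝ} (hst : s < t) {D : ℝ → ℝ} (hD : IntegrableOn D (Ioo s t))
    (h : ∀ φ : ℝ → ℝ, ContDiff ℝ (⊤ : ℕ∞) φ → HasCompactSupport φ → tsupport φ ⊆ Ioo s t →
      ∫ x in s..t, D x * deriv φ x = 0) :
    ∃ c, ∀ᵐ x ∂volume.restrict (Ioo s t), D x = c := by
  -- A fixed bump serves to correct the mean value of arbitrary test functions. Its weighted average
  -- of `D` is the required constant.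
  obtain ⟨ρ, hρs, hρc, hρd, hρr, hρ1⟩ := exists_contDiff_tsupport_subset (n := ⊤)
    (Ioo_mem_nhds (show s < (s + t) / 2 by linarith) (show (s + t) / 2 < t by linarith))
  have hρpos : 0 < ∫ x in s..t, ρ x := by
    refine intervalIntegral.integral_pos hst hρd.continuous.continuousOn
      (fun x _ => (hρr (mem_range_self x)).1) ⟨(s + t) / 2, ⟨by linarith, by linarith⟩, ?_⟩
    rw [hρ1]
    exact one_pos
  set r := ∫ x in s..t, ρ x with hr
  have hDi : IntervalIntegrable D volume s t :=
    (intervalIntegrable_iff_integrableOn_Ioo_of_le hst.le).2 hD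
  set c := (∫ x in s..t, D x * ρ x) / r with hc
  refine ⟨c, ?_⟩
  -- The function `φ - (∫ φ / ∫ ρ) ρ` has mean zero, so it is the derivative of a test function and
  -- the hypothesis applies to it.
  have key : ∀ φ : ℝ → ℝ, ContDiff ℝ (⊤ : ℕ∞) φ → HasCompactSupport φ → tsupport φ ⊆ Ioo s t →
      ∫ x in s..t, φ x * (D x - c) = 0 := by
    intro φ hφd hφc hφs
    set I := ∫ x in s..t, φ x
    have hK : IsCompact (tsupport φ ∪ tsupport ρ) := hφc.isCompact.union hρc.isCompact
    have hKne : (tsupport φ ∪ tsupport ρ).Nonempty :=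
      ⟨(s + t) / 2, Or.inr (subset_tsupport _ (by simp [hρ1]))⟩
    have hKs : tsupport φ ∪ tsupport ρ ⊆ Ioo s t := union_subset hφs hρs
    have hinf := hK.sInf_mem hKne
    have hsup := hK.sSup_mem hKne
    have hsub : ∀ x ∈ tsupport φ ∪ tsupport ρ,
        x ∈ Icc (sInf (tsupport φ ∪ tsupport ρ)) (sSup (tsupport φ ∪ tsupport ρ)) :=
      fun x hx => ⟨csInf_le hK.bddBelow hx, le_csSup hK.bddAbove hx⟩
    have hφi := hφd.continuous.intervalIntegrable (μ := volume) s t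
    have hρi := hρd.continuous.intervalIntegrable (μ := volume) s t
    obtain ⟨h1, h2, h3, h4⟩ := isTest_primitive (hKs hinf).1 (hKs hsup).2
      (g := fun x => φ x - I / r * ρ x) (hφd.sub (contDiff_const.mul hρd)) (by
        intro x hx
        have hx' : x ∉ tsupport φ ∪ tsupport ρ := fun h => hx (hsub x h)
        simp only [mem_union, not_or] at hx'
        simp [image_eq_zero_of_notMem_tsupport hx'.1, image_eq_zero_of_notMem_tsupport hx'.2]) (by
        rw [intervalIntegral.integral_sub hφi (hρi.const_mul _),
          intervalIntegral.integral_const_mul]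
        change I - I / r * r = 0
        field_simp
        ring)
    have h5 := h _ h1 h2 h3
    rw [h4] at h5
    have e1 : (fun x => D x * (φ x - I / r * ρ x))
        = fun x => D x * φ x - I / r * (D x * ρ x) := by
      ext x
      ring
    have e2 : (fun x => φ x * (D x - c)) = fun x => D x * φ x - c * φ x := by
      ext x
      ring
    have hDφ := hDi.mul_continuousOn hφd.continuous.continuousOn
    have hDρ := hDi.mul_continuousOn hρd.continuous.continuousOn
    rw [e1, intervalIntegral.integral_sub hDφ (hDρ.const_mul _),
      intervalIntegral.integral_const_mul] at h5
    rw [e2, intervalIntegral.integral_sub hDφ (hφi.const_mul _),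
      intervalIntegral.integral_const_mul]
    change _ - c * I = 0
    rw [hc, ← h5]
    ring
  have h0 := isOpen_Ioo.ae_eq_zero_of_integral_contDiff_smul_eq_zero
    (f := fun x => D x - c) (U := Ioo s t) (μ := volume)
    (hD.sub (integrableOn_const (by simp))).locallyIntegrableOn ?_
  · rw [ae_restrict_iff' measurableSet_Ioo]
    filter_upwards [h0] with x hx hxi
    exact sub_eq_zero.1 (hx hxi)
  · intro φ hφd hφc hφs
    rw [← key φ hφd hφc hφs, intervalIntegral.integral_of_le hst.le, integral_Ioc_eq_integral_Ioo]
    symm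
    refine setIntegral_eq_integral_of_forall_compl_eq_zero fun x hx => ?_
    rw [image_eq_zero_of_notMem_tsupport (fun h => hx (hφs h)), zero_mul]

/-- A function with a bounded weak derivative is close to a constant. -/
lemma exists_const_of_isWeakDeriv {s t L : ℝ} (hst : s < t) {d e : ℝ → ℝ}
    (hd : IntegrableOn d (Ioo s t)) (he : AEStronglyMeasurable e (volume.restrict (Ioo s t)))
    (hL : ∀ᵐ x ∂volume.restrict (Ioo s t), |e x| ≤ L) (h : IsWeakDeriv s t d e) :
    ∃ c, ∀ᵐ x ∂volume.restrict (Ioo s t), |d x - c| ≤ L * (t - s) := by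
  have hei : IntervalIntegrable e volume s t :=
    (intervalIntegrable_iff_integrableOn_Ioo_of_le hst.le).2
      (Integrable.of_bound he L hL)
  have hdi : IntervalIntegrable d volume s t :=
    (intervalIntegrable_iff_integrableOn_Ioo_of_le hst.le).2 hd
  set E := fun x => ∫ y in s..x, e y with hE
  have hac : AbsolutelyContinuousOnInterval E s t :=
    hei.absolutelyContinuousOnInterval_intervalIntegral left_mem_uIcc
  have hEd : ∀ᵐ x, x ∈ uIoc s t → deriv E x = e x := by
    filter_upwards [hei.ae_hasDerivAt_integral] with x hx hxi
    exact (hx (uIoc_subset_uIcc hxi) s left_mem_uIcc).deriv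
  have hEi : IntervalIntegrable E volume s t := hac.continuousOn.intervalIntegrable
  -- The primitive `E` of `e` is absolutely continuous, and integration by parts shows that `d - E`
  -- has vanishing weak derivative. Since `E` starts from zero, it is bounded by `L` times the
  -- length.
  obtain ⟨c, hc⟩ := exists_ae_eq_const hst (D := fun x => d x - E x)
    (hd.sub ((intervalIntegrable_iff_integrableOn_Ioo_of_le hst.le).1 hEi)) (by
      intro φ hφd hφc hφs
      have hφac : AbsolutelyContinuousOnInterval φ s t :=
        ContDiffOn.absolutelyContinuousOnInterval (hφd.of_le (by norm_cast)).contDiffOn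
      have h1 := hac.integral_mul_deriv_eq_deriv_mul hφac
      have h2 : φ t = 0 := image_eq_zero_of_notMem_tsupport fun h => lt_irrefl _ (hφs h).2
      have h3 : φ s = 0 := image_eq_zero_of_notMem_tsupport fun h => lt_irrefl _ (hφs h).1
      have h4 : ∫ x in s..t, deriv E x * φ x = ∫ x in s..t, e x * φ x := by
        refine intervalIntegral.integral_congr_ae ?_
        filter_upwards [hEd] with x hx hxi
        rw [hx hxi]
      have hφ' : ContinuousOn (deriv φ) (uIcc s t) :=
        (hφd.continuous_deriv (by norm_cast)).continuousOn
      simp_rw [sub_mul]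
      rw [intervalIntegral.integral_sub (hdi.mul_continuousOn hφ') (hEi.mul_continuousOn hφ'),
        h φ hφd hφc hφs, h1, h2, h3, h4]
      ring)
  refine ⟨c, ?_⟩
  have hL0 : 0 ≤ L := by
    have hne : (ae (volume.restrict (Ioo s t))).NeBot := by
      rw [ae_neBot, Ne, Measure.restrict_eq_zero]
      simp [hst]
    obtain ⟨x, hx⟩ := hL.exists
    exact (abs_nonneg _).trans hx
  filter_upwards [hc, ae_restrict_mem measurableSet_Ioo] with x hx hxi
  have h1 : d x - c = E x := by linarith
  rw [h1]
  have hL' := (ae_restrict_iff' measurableSet_Ioo).1 hL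
  have h2 : ‖∫ y in s..x, e y‖ ≤ L * |x - s| := by
    refine intervalIntegral.norm_integral_le_of_norm_le_const_ae ?_
    filter_upwards [hL'] with y hy hyi
    rw [uIoc_of_le hxi.1.le] at hyi
    exact hy ⟨hyi.1, hyi.2.trans_lt hxi.2⟩
  refine h2.trans (mul_le_mul_of_nonneg_left ?_ hL0)
  rw [abs_of_pos (sub_pos.2 hxi.1)]
  linarith [hxi.2]

lemma IsBoundedCoeff.abs_le {dlo dhi : ℝ} {d : ℝ → ℝ} (h : IsBoundedCoeff xL xR dlo dhi d) :
    ∀ᵐ x ∂dom xL xR, |d x| ≤ |dlo| + |dhi| := by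
  filter_upwards [h.2] with x hx
  refine _root_.abs_le.2 ⟨?_, ?_⟩
  · linarith [neg_abs_le dlo, abs_nonneg dhi, hx.1]
  · linarith [le_abs_self dhi, abs_nonneg dlo, hx.2]

lemma IsBoundedCoeff.bdd {dlo dhi : ℝ} {d : ℝ → ℝ} (h : IsBoundedCoeff xL xR dlo dhi d) :
    Bdd xL xR d :=
  Bdd.of_bound h.1 _ h.abs_le

/-- A coefficient with bounded piecewise weak derivative is close to a piecewise constant one. -/
lemma Mesh.exists_piecewiseConst (τ : Mesh xL xR) (hx : xL < xR) {L : ℝ} {d : ℝ → ℝ}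
    (hd : Bdd xL xR d) (h : τ.HasBoundedPiecewiseWeakDeriv L d) :
    ∃ g ∈ τ.PiecewisePoly 0, ∀ᵐ x ∂dom xL xR, |d x - g x| ≤ |L| * τ.size := by
  have h1 : ∀ i, ∃ c, ∀ᵐ x ∂volume.restrict (τ.openElem i),
      |d x - c| ≤ L * (τ.node i.succ - τ.node i.castSucc) := by
    intro i
    obtain ⟨e, he, hL, hw⟩ := h i
    exact exists_const_of_isWeakDeriv (τ.node_lt i) (hd.integrable.mono_measure
      (Measure.restrict_mono (τ.openElem_subset i) le_rfl)) he hL hw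
  choose c hc using h1
  obtain ⟨g, hg⟩ := τ.exists_glue fun i _ => c i
  refine ⟨g, fun i => ⟨Polynomial.C (c i), by simp, fun x hxi => by simp [hg i x hxi]⟩, ?_⟩
  refine τ.ae_of_ae_openElem hx fun i => ?_
  filter_upwards [hc i, ae_restrict_mem (τ.measurableSet_openElem i)] with x hxc hxi
  rw [hg i x hxi]
  refine hxc.trans (mul_le_mul (le_abs_self L) (τ.length_le_size i)
    (sub_nonneg.2 (τ.node_lt i).le) (abs_nonneg L))

/-! ### Estimates for the discrete spaces -/

namespace Mesh.ONB

variable {τ : Mesh xL xR} {j : ℕ} (B : τ.ONB j)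

/-- The consistency error of the inexact friction term. -/
lemma norm_coef_friction_le (hx : xL < xR) {dlo dhi L K : ℝ} {d v : ℝ → ℝ}
    (hd : IsBoundedCoeff xL xR dlo dhi d) (hL : τ.HasBoundedPiecewiseWeakDeriv L d)
    (hv : τ.SmoothBound (j + 2) (j + 2) K v) :
    ‖B.coef (fun x => d x * (v x - B.syn (B.coef (B.interp v)) x))‖
      ≤ Real.sqrt (xR - xL) * (|dlo| + |dhi| + |L| * (xR - xL + 1)) * K * τ.size ^ (j + 2) := by
  have hK := hv.nonneg hx
  have hh := (τ.size_pos hx).le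
  set h := τ.size with hh'
  obtain ⟨g, hg, hdg⟩ := τ.exists_piecewiseConst hx hd.bdd hL
  have hvb := hv.bdd hx (by omega)
  have hIb := B.bdd_interp hx v
  have hgb := τ.bdd_of_mem hx hg
  set w := B.interp v
  set π := B.syn (B.coef w)
  have hπb : Bdd xL xR π := B.bdd_syn hx _
  have herr : ∀ᵐ x ∂dom xL xR, |v x - w x| ≤ K * h ^ (j + 2) := by
    filter_upwards [ae_restrict_mem measurableSet_Ioo] with x hxi
    exact B.abs_sub_interp_le hx hv (by omega) (l := j + 1) le_rfl le_rfl le_rfl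
      (Ioo_subset_Icc_self hxi)
  have h1 : l2norm xL xR (fun x => d x * (v x - w x))
      ≤ Real.sqrt (xR - xL) * ((|dlo| + |dhi|) * (K * h ^ (j + 2))) := by
    refine l2norm_le_of_bound hx (by positivity) ?_
    filter_upwards [herr, hd.abs_le] with x e1 e2
    rw [abs_mul]
    exact mul_le_mul e2 e1 (abs_nonneg _) (by positivity)
  -- Only order `j + 1` is available here, because the projection has degree `j`; best approximation
  -- allows a comparison with the Taylor polynomials of `v`.
  have h2 : l2norm xL xR (fun x => w x - π x) ≤
      Real.sqrt (xR - xL) * (K * h ^ (j + 2) + K * h ^ (j + 1)) := by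
    choose c h0 hcd hcb using hv
    obtain ⟨q, hq⟩ := τ.exists_glue fun i x => (taylorPoly (j + 1) (c i) (τ.node i.castSucc)).eval x
    have hqm : q ∈ τ.PiecewisePoly j := fun i =>
      ⟨_, (natDegree_taylorPoly _ _ _).trans (by omega), hq i⟩
    refine (B.l2norm_sub_proj_le hx hIb hqm).trans ?_
    refine l2norm_le_of_bound hx (by positivity) ?_
    have hqerr : ∀ᵐ x ∂dom xL xR, |v x - q x| ≤ K * h ^ (j + 1) := by
      refine τ.ae_of_openElem hx fun i x hxi => ?_
      have hxe := τ.openElem_subset_elem i hxi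
      rw [hq i x hxi, ← h0 i x hxe]
      refine (abs_sub_taylorPoly_le (j + 1) (c i) (τ.node_lt i).le
        (fun m hm => hcd i m (by omega)) (hcb i (j + 1) (by omega)) x hxe).trans ?_
      have := τ.length_le_size i
      have h3 := (sub_pos.2 (τ.node_lt i)).le
      gcongr
    filter_upwards [herr, hqerr] with x e1 e2
    calc |w x - q x| = |(v x - q x) - (v x - w x)| := by congr 1; ring
      _ ≤ |v x - q x| + |v x - w x| := abs_sub _ _
      _ ≤ _ := by linarith
  have hwπ := hIb.sub hπb
  have h3 : l2norm xL xR (fun x => (d x - g x) * (w x - π x))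
      ≤ |L| * h * l2norm xL xR (fun x => w x - π x) := by
    rw [← abs_of_nonneg (show 0 ≤ |L| * h by positivity), ← l2norm_smul]
    refine l2norm_mono hx ((Bdd.const _).mul hwπ) ?_
    filter_upwards [hdg] with x e1
    rw [abs_mul, abs_mul]
    refine mul_le_mul_of_nonneg_right (e1.trans (le_abs_self _)) (abs_nonneg _)
  -- The missing power of the mesh size is recovered by replacing `d` with `d - g` in front of `w -
  -- π`.
  have hcoef : B.coef (fun x => d x * (v x - π x))
      = B.coef (fun x => d x * (v x - w x)) + B.coef (fun x => (d x - g x) * (w x - π x)) := by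
    -- A piecewise constant factor can be moved to the test function without raising its degree, and
    -- `w - π` is orthogonal to the result.
    have e1 : B.coef (fun x => g x * (w x - π x)) = 0 := by
      ext α
      rw [coef_apply]
      have : ip xL xR (fun x => g x * (w x - π x)) (B.φ α)
          = ip xL xR (fun x => w x - π x) (fun x => g x * B.φ α x) := by
        simp only [ip]
        congr 1
        ext x
        ring
      rw [this]
      exact B.ip_sub_proj hx hIb (τ.mul_mem hg (B.mem α))
    have e2 := B.coef_add hx (hd.bdd.mul (hvb.sub hIb)) ((hd.bdd.sub hgb).mul hwπ)
    have e3 := B.coef_add hx ((hd.bdd.mul (hvb.sub hIb)).add ((hd.bdd.sub hgb).mul hwπ))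
      (hgb.mul hwπ)
    rw [e1, e2, add_zero] at e3
    rw [← e3]
    congr 1
    ext x
    ring
  rw [hcoef]
  have h4 := B.norm_coef_le hx (hd.bdd.mul (hvb.sub hIb))
  have h5 := B.norm_coef_le hx ((hd.bdd.sub hgb).mul hwπ)
  have hsz := τ.size_le hx
  calc _ ≤ _ := norm_add_le _ _
    _ ≤ Real.sqrt (xR - xL) * ((|dlo| + |dhi|) * (K * h ^ (j + 2)))
        + |L| * h * (Real.sqrt (xR - xL) * (K * h ^ (j + 2) + K * h ^ (j + 1))) := by
      refine add_le_add (h4.trans h1) (h5.trans (h3.trans ?_))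
      exact mul_le_mul_of_nonneg_left h2 (by positivity)
    _ = Real.sqrt (xR - xL) * (|dlo| + |dhi| + |L| * (h + 1)) * K * h ^ (j + 2) := by ring
    _ ≤ _ := by gcongr

lemma norm_coef_mul_le (hx : xL < xR) {D : ℝ} (hD : 0 ≤ D) {d v : ℝ → ℝ} (hd : Bdd xL xR d)
    (hdD : ∀ᵐ x ∂dom xL xR, |d x| ≤ D) (hv : Bdd xL xR v) :
    ‖B.coef (fun x => d x * v x)‖ ≤ D * l2norm xL xR v := by
  refine (B.norm_coef_le hx (hd.mul hv)).trans ?_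
  rw [← abs_of_nonneg hD, ← l2norm_smul]
  refine l2norm_mono hx ((Bdd.const _).mul hv) ?_
  filter_upwards [hdD] with x e1
  rw [abs_mul, abs_mul]
  exact mul_le_mul_of_nonneg_right (e1.trans (le_abs_self _)) (abs_nonneg _)

lemma inner_coef_mul_syn_nonneg (hx : xL < xR) {d : ℝ → ℝ} (hd : Bdd xL xR d)
    (h0 : ∀ᵐ x ∂dom xL xR, 0 ≤ d x) (c : EuclideanSpace ℝ (Fin B.n)) :
    0 ≤ inner ℝ (B.coef (fun x => d x * B.syn c x)) c := by
  rw [B.inner_coef hx (hd.mul (B.bdd_syn hx c)), ip_eq hx]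
  refine integral_nonneg_of_ae ?_
  filter_upwards [h0] with x h
  simp only [Pi.zero_apply]
  rw [mul_assoc]
  exact mul_nonneg h (mul_self_nonneg _)

/-- Skew-symmetry of the discrete differential operator. -/
lemma inner_coef_deriv_add (hx : xL < xR) {U V : ℝ → ℝ} (hU : U ∈ τ.Q (j + 1))
    (hV : V ∈ τ.V (j + 1)) :
    inner ℝ (B.coef (deriv V)) (B.coef U) + inner ℝ (B.coef (deriv U)) (B.coef V) = 0 := by
  have hUb := τ.bdd_of_mem hx hU.1.1
  have hVb := τ.bdd_of_mem hx hV.1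
  have hU' : deriv U ∈ τ.PiecewisePoly j := τ.deriv_mem hU.1.1
  have hV' : deriv V ∈ τ.PiecewisePoly j := τ.deriv_mem hV.1
  have hU'b := τ.bdd_of_mem hx hU'
  have hV'b := τ.bdd_of_mem hx hV'
  -- Both derivatives are already in the range of the projection, so the coefficient products equal
  -- the full `L²` products with `U` and `V`. Their sum is the integral of `(U V)'`, which vanishes
  -- since `U` does at both ends.
  rw [real_inner_comm, real_inner_comm (B.coef V), B.inner_coef hx hUb, B.inner_coef hx hVb,
    ← ip_congr hx Filter.EventuallyEq.rfl (B.ae_eq_syn hV'),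
    ← ip_congr hx Filter.EventuallyEq.rfl (B.ae_eq_syn hU'), ip_eq hx, ip_eq hx,
    ← integral_add (hUb.mul hV'b).integrable (hVb.mul hU'b).integrable]
  have h1 := τ.integral_eq_sub hx (hU.1.2.mul hV.2)
    (fun i x hxi => (τ.hasDerivAt_of_mem hU.1.1 hxi).mul (τ.hasDerivAt_of_mem hV.1 hxi))
    ((hU'b.mul hVb).add (hUb.mul hV'b)) (left_mem_Icc.2 hx.le) (right_mem_Icc.2 hx.le)
  rw [intervalIntegral.integral_of_le hx.le, integral_Ioc_eq_integral_Ioo] at h1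
  simp only [Pi.mul_apply, hU.2.1, hU.2.2, zero_mul, sub_zero] at h1
  rw [← h1]
  congr 1
  ext x
  ring

/-- A Poincaré-type inequality. -/
lemma l2norm_le (hx : xL < xR) {V : ℝ → ℝ} (hV : V ∈ τ.V (j + 1)) :
    l2norm xL xR V ≤ ‖B.coef V‖ + τ.size * ‖B.coef (deriv V)‖ := by
  have hVb := τ.bdd_of_mem hx hV.1
  have hV' : deriv V ∈ τ.PiecewisePoly j := τ.deriv_mem hV.1
  have hV'b := τ.bdd_of_mem hx hV'
  have hh := (τ.size_pos hx).le
  -- Constants belong to `P_j` for every `j`, so the projection error is at most the distance to the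
  -- left nodal values. On each element that distance is controlled by the integral of `|V'|`.
  obtain ⟨q, hq⟩ := τ.exists_glue fun i _ => V (τ.node i.castSucc)
  have hqm : q ∈ τ.PiecewisePoly 0 := fun i =>
    ⟨Polynomial.C (V (τ.node i.castSucc)), by simp, fun x hxi => by simp [hq i x hxi]⟩
  have hqb := τ.bdd_of_mem hx hqm
  have hqj := τ.piecewisePoly_mono (Nat.zero_le j) hqm
  have h1 : l2norm xL xR V ≤ l2norm xL xR (B.syn (B.coef V))
      + l2norm xL xR (fun x => V x - B.syn (B.coef V) x) := by
    have := l2norm_add_le hx (B.bdd_syn hx (B.coef V)) (hVb.sub (B.bdd_syn hx (B.coef V)))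
    simpa using this
  rw [B.l2norm_syn hx] at h1
  refine h1.trans (add_le_add le_rfl ((B.l2norm_sub_proj_le hx hVb hqj).trans ?_))
  rw [← B.l2norm_eq_norm_coef hx hV']
  refine le_of_sq_le_sq ?_ (mul_nonneg hh (l2norm_nonneg _))
  rw [mul_pow, l2norm_sq hx, l2norm_sq hx, ip_eq hx, ip_eq hx,
    τ.integral_eq_sum hx ((hVb.sub hqb).mul (hVb.sub hqb)).integrable,
    τ.integral_eq_sum hx (hV'b.mul hV'b).integrable, Finset.mul_sum]
  refine Finset.sum_le_sum fun i _ => ?_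
  set s := τ.node i.castSucc with hs
  set t := τ.node i.succ with ht
  have hst : s < t := τ.node_lt i
  have hon : ∀ {f : ℝ → ℝ}, Bdd xL xR f → IntegrableOn f (Ioo s t) := fun hf =>
    hf.integrable.mono_measure (Measure.restrict_mono (τ.openElem_subset i) le_rfl)
  set J := ∫ y in Ioo s t, |deriv V y|
  have hJ := sq_integral_abs_le hst (hon hV'b) (hon (hV'b.mul hV'b))
  have hpt : ∀ x ∈ τ.openElem i, (V x - q x) * (V x - q x) ≤ J ^ 2 := by
    intro x hxi
    have hxe := τ.openElem_subset_elem i hxi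
    rw [hq i x hxi, ← τ.integral_eq_sub hx hV.2 (fun i x hxi => τ.hasDerivAt_of_mem hV.1 hxi) hV'b
      (τ.node_mem _) (τ.elem_subset i hxe), ← sq, ← sq_abs]
    refine pow_le_pow_left₀ (abs_nonneg _) ?_ 2
    calc |∫ y in s..x, deriv V y| ≤ ∫ y in s..x, |deriv V y| :=
          intervalIntegral.abs_integral_le_integral_abs hxe.1
      _ ≤ J := by
        rw [intervalIntegral.integral_of_le hxe.1, integral_Ioc_eq_integral_Ioo]
        exact setIntegral_mono_set (hon hV'b).abs
          (Filter.Eventually.of_forall fun y => abs_nonneg _)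
          (LE.le.eventuallyLE (Ioo_subset_Ioo le_rfl hxe.2))
  have hlen := τ.length_le_size i
  have h0 : 0 ≤ ∫ x in τ.openElem i, deriv V x * deriv V x :=
    integral_nonneg fun x => mul_self_nonneg _
  calc ∫ x in τ.openElem i, (V x - q x) * (V x - q x) ≤ ∫ _ in τ.openElem i, J ^ 2 :=
        setIntegral_mono_on (hon ((hVb.sub hqb).mul (hVb.sub hqb)))
          (integrableOn_const (by simp [Mesh.openElem])) (τ.measurableSet_openElem i) hpt
    _ = (t - s) * J ^ 2 := by simp [Mesh.openElem, ← hs, ← ht, hst.le]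
    _ ≤ (t - s) * ((t - s) * ∫ x in Ioo s t, deriv V x * deriv V x) :=
        mul_le_mul_of_nonneg_left hJ (sub_nonneg.2 hst.le)
    _ = (t - s) ^ 2 * ∫ x in τ.openElem i, deriv V x * deriv V x := by
        rw [← mul_assoc, ← sq]
        rfl
    _ ≤ _ := by
        have := (sub_pos.2 hst).le
        gcongr

end Mesh.ONB

/-! ### Mixed partial derivatives on a space-time rectangle -/

/-- Prepending `j` spatial directions to a list of directions in space-time. -/
def prependX {l : ℕ} (m : Fin l → ℝ × ℝ) : (j : ℕ) → Fin (l + j) → ℝ × ℝ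
  | 0 => m
  | j + 1 => Fin.cons (0, 1) (prependX m j)

lemma norm_cons_le {l : ℕ} {m : Fin l → ℝ × ℝ} (hm : ∀ i, ‖m i‖ ≤ 1) {w : ℝ × ℝ} (hw : ‖w‖ ≤ 1) :
    ∀ i, ‖(Fin.cons w m : Fin (l + 1) → ℝ × ℝ) i‖ ≤ 1 := by
  intro i
  refine Fin.cases ?_ (fun i => ?_) i
  · simpa using hw
  · simpa using hm i

lemma norm_dirX_le : ‖((0, 1) : ℝ × ℝ)‖ ≤ 1 := by simp [Prod.norm_def]

lemma norm_dirT_le : ‖((1, 0) : ℝ × ℝ)‖ ≤ 1 := by simp [Prod.norm_def]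

lemma norm_prependX_le {l : ℕ} {m : Fin l → ℝ × ℝ} (hm : ∀ i, ‖m i‖ ≤ 1) (j : ℕ) :
    ∀ i, ‖prependX m j i‖ ≤ 1 := by
  induction j with
  | zero => exact hm
  | succ j ih => exact norm_cons_le ih norm_dirX_le

section Rectangle

variable {U : ℝ × ℝ → ℝ} {T s e M : ℝ} {r : ℕ}

/-- With fixed directions, evaluation is a continuous linear map on multilinear forms, so one
further differentiation just prepends the new direction. Mixed partial derivatives are handled
through this bookkeeping. -/
lemma hasFDerivWithinAt_iteratedFDerivWithin {E F : Type*} [NormedAddCommGroup E] [NormedSpace ℝ E]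
    [NormedAddCommGroup F] [NormedSpace ℝ F] {U : E → F} {S : Set E} (hS : UniqueDiffOn ℝ S)
    (hU : ContDiffOn ℝ r U S) {n : ℕ} (hn : n < r) (m : Fin n → E) {z : E} (hz : z ∈ S) :
    ∃ A : E →L[ℝ] F, HasFDerivWithinAt (fun z => iteratedFDerivWithin ℝ n U S z m) A S z ∧
      ∀ w, A w = iteratedFDerivWithin ℝ (n + 1) U S z (Fin.cons w m) := by
  have h1 := (hU.differentiableOn_iteratedFDerivWithin (by exact_mod_cast hn) hS z
    hz).hasFDerivWithinAt
  refine ⟨_, ((ContinuousMultilinearMap.apply ℝ (fun _ : Fin n => E) F m).hasFDerivAt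
    (x := iteratedFDerivWithin ℝ n U S z)).comp_hasFDerivWithinAt z h1, fun w => ?_⟩
  rw [iteratedFDerivWithin_succ_apply_left]
  simp

lemma uniqueDiffOn_rectangle (hT : 0 < T) (hse : s < e) :
    UniqueDiffOn ℝ (Icc 0 T ×ˢ Icc s e) :=
  (uniqueDiffOn_Icc hT).prod (uniqueDiffOn_Icc hse)

lemma hasDerivWithinAt_space (hT : 0 < T) (hse : s < e)
    (hU : ContDiffOn ℝ r U (Icc 0 T ×ˢ Icc s e)) {n : ℕ} (hn : n < r) (m : Fin n → ℝ × ℝ)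
    {t x : ℝ} (ht : t ∈ Icc 0 T) (hx : x ∈ Icc s e) :
    HasDerivWithinAt (fun x => iteratedFDerivWithin ℝ n U (Icc 0 T ×ˢ Icc s e) (t, x) m)
      (iteratedFDerivWithin ℝ (n + 1) U (Icc 0 T ×ˢ Icc s e) (t, x) (Fin.cons (0, 1) m))
      (Icc s e) x := by
  obtain ⟨A, hA, hA'⟩ := hasFDerivWithinAt_iteratedFDerivWithin (uniqueDiffOn_rectangle hT hse)
    hU hn m (z := (t, x)) ⟨ht, hx⟩
  rw [← hA']
  exact hA.comp_hasDerivWithinAt x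
    ((hasDerivWithinAt_const x (Icc s e) t).prodMk (hasDerivWithinAt_id x _))
    fun y hy => ⟨ht, hy⟩

lemma hasDerivWithinAt_time (hT : 0 < T) (hse : s < e)
    (hU : ContDiffOn ℝ r U (Icc 0 T ×ˢ Icc s e)) {n : ℕ} (hn : n < r) (m : Fin n → ℝ × ℝ)
    {t x : ℝ} (ht : t ∈ Icc 0 T) (hx : x ∈ Icc s e) :
    HasDerivWithinAt (fun t => iteratedFDerivWithin ℝ n U (Icc 0 T ×ˢ Icc s e) (t, x) m)
      (iteratedFDerivWithin ℝ (n + 1) U (Icc 0 T ×ˢ Icc s e) (t, x) (Fin.cons (1, 0) m))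
      (Icc 0 T) t := by
  obtain ⟨A, hA, hA'⟩ := hasFDerivWithinAt_iteratedFDerivWithin (uniqueDiffOn_rectangle hT hse)
    hU hn m (z := (t, x)) ⟨ht, hx⟩
  rw [← hA']
  have hp : HasDerivWithinAt (fun t : ℝ => (t, x)) ((1, 0) : ℝ × ℝ) (Icc 0 T) t :=
    (hasDerivWithinAt_id t _).prodMk (hasDerivWithinAt_const t (Icc 0 T) x)
  have hA2 : HasFDerivWithinAt (fun z => iteratedFDerivWithin ℝ n U (Icc 0 T ×ˢ Icc s e) z m) A
      (Icc 0 T ×ˢ Icc s e) ((fun t : ℝ => (t, x)) t) := hA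
  have hmap : MapsTo (fun t : ℝ => (t, x)) (Icc 0 T) (Icc 0 T ×ˢ Icc s e) := fun y hy => ⟨hy, hx⟩
  exact hA2.comp_hasDerivWithinAt t hp hmap

lemma abs_iteratedFDerivWithin_le
    (hM : ∀ n ≤ r, ∀ z ∈ Icc 0 T ×ˢ Icc s e,
      ‖iteratedFDerivWithin ℝ n U (Icc 0 T ×ˢ Icc s e) z‖ ≤ M)
    {n : ℕ} (hn : n ≤ r) {m : Fin n → ℝ × ℝ} (hm : ∀ i, ‖m i‖ ≤ 1)
    {t x : ℝ} (ht : t ∈ Icc 0 T) (hx : x ∈ Icc s e) :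
    |iteratedFDerivWithin ℝ n U (Icc 0 T ×ˢ Icc s e) (t, x) m| ≤ M := by
  have h1 := hM n hn (t, x) ⟨ht, hx⟩
  refine ((iteratedFDerivWithin ℝ n U (Icc 0 T ×ˢ Icc s e) (t, x)).le_opNorm m).trans ?_
  have h2 : ∏ i, ‖m i‖ ≤ 1 := Finset.prod_le_one (fun i _ => norm_nonneg _) fun i _ => hm i
  calc _ ≤ ‖iteratedFDerivWithin ℝ n U (Icc 0 T ×ˢ Icc s e) (t, x)‖ * 1 :=
        mul_le_mul_of_nonneg_left h2 (norm_nonneg _)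
    _ ≤ M := by rwa [mul_one]

lemma abs_time_sub_le (hT : 0 < T) (hse : s < e)
    (hU : ContDiffOn ℝ r U (Icc 0 T ×ˢ Icc s e))
    (hM : ∀ n ≤ r, ∀ z ∈ Icc 0 T ×ˢ Icc s e,
      ‖iteratedFDerivWithin ℝ n U (Icc 0 T ×ˢ Icc s e) z‖ ≤ M)
    {n : ℕ} (hn : n < r) {m : Fin n → ℝ × ℝ} (hm : ∀ i, ‖m i‖ ≤ 1)
    {t t' x : ℝ} (ht : t ∈ Icc 0 T) (ht' : t' ∈ Icc 0 T) (hx : x ∈ Icc s e) :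
    |iteratedFDerivWithin ℝ n U (Icc 0 T ×ˢ Icc s e) (t', x) m
      - iteratedFDerivWithin ℝ n U (Icc 0 T ×ˢ Icc s e) (t, x) m| ≤ M * |t' - t| :=
  (convex_Icc 0 T).norm_image_sub_le_of_norm_hasDerivWithin_le
    (f := fun t => iteratedFDerivWithin ℝ n U (Icc 0 T ×ˢ Icc s e) (t, x) m)
    (fun _ hy => hasDerivWithinAt_time hT hse hU hn m hy hx)
    (fun _ hy => abs_iteratedFDerivWithin_le hM hn (norm_cons_le hm norm_dirT_le) hy hx) ht ht'

/-- After subtracting the linear part, the time derivative is bounded by `M |t' - t|` between the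
two times; the mean value inequality gives the second factor. -/
lemma abs_time_taylor_le (hT : 0 < T) (hse : s < e)
    (hU : ContDiffOn ℝ r U (Icc 0 T ×ˢ Icc s e))
    (hM : ∀ n ≤ r, ∀ z ∈ Icc 0 T ×ˢ Icc s e,
      ‖iteratedFDerivWithin ℝ n U (Icc 0 T ×ˢ Icc s e) z‖ ≤ M)
    {n : ℕ} (hn : n + 1 < r) {m : Fin n → ℝ × ℝ} (hm : ∀ i, ‖m i‖ ≤ 1)
    {t t' x : ℝ} (ht : t ∈ Icc 0 T) (ht' : t' ∈ Icc 0 T) (hx : x ∈ Icc s e) :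
    |iteratedFDerivWithin ℝ n U (Icc 0 T ×ˢ Icc s e) (t', x) m
      - iteratedFDerivWithin ℝ n U (Icc 0 T ×ˢ Icc s e) (t, x) m
      - (t' - t) * iteratedFDerivWithin ℝ (n + 1) U (Icc 0 T ×ˢ Icc s e) (t, x)
          (Fin.cons (1, 0) m)| ≤ M * (t' - t) ^ 2 := by
  have hM0 : 0 ≤ M := (norm_nonneg _).trans (hM 0 (Nat.zero_le _) (t, x) ⟨ht, hx⟩)
  have hsub : uIcc t t' ⊆ Icc 0 T := uIcc_subset_Icc ht ht'
  set g := iteratedFDerivWithin ℝ (n + 1) U (Icc 0 T ×ˢ Icc s e) (t, x) (Fin.cons (1, 0) m)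
  have h1 := (convex_uIcc t t').norm_image_sub_le_of_norm_hasDerivWithin_le
    (f := fun y => iteratedFDerivWithin ℝ n U (Icc 0 T ×ˢ Icc s e) (y, x) m - y * g)
    (f' := fun y => iteratedFDerivWithin ℝ (n + 1) U (Icc 0 T ×ˢ Icc s e) (y, x)
      (Fin.cons (1, 0) m) - 1 * g) (C := M * |t' - t|)
    (fun y hy => ((hasDerivWithinAt_time hT hse hU (by omega) m (hsub hy) hx).mono hsub).sub
      ((hasDerivWithinAt_id y _).mul_const g))
    (fun y hy => by
      rw [one_mul]
      refine (abs_time_sub_le hT hse hU hM hn (norm_cons_le hm norm_dirT_le) ht (hsub hy)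
        hx).trans (mul_le_mul_of_nonneg_left ?_ hM0)
      exact abs_sub_left_of_mem_uIcc hy) left_mem_uIcc right_mem_uIcc
  rw [mul_assoc, Real.norm_eq_abs, Real.norm_eq_abs, ← sq, sq_abs] at h1
  refine le_trans (le_of_eq ?_) h1
  congr 1
  ring

/-- The symmetry extends to the boundary because the rectangle is contained in the closure of its
interior. -/
lemma iteratedFDerivWithin_comm (hT : 0 < T) (hse : s < e) (hr : 2 ≤ r)
    (hU : ContDiffOn ℝ r U (Icc 0 T ×ˢ Icc s e)) {z : ℝ × ℝ} (hz : z ∈ Icc 0 T ×ˢ Icc s e)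
    (v w : ℝ × ℝ) :
    iteratedFDerivWithin ℝ 2 U (Icc 0 T ×ˢ Icc s e) z ![v, w]
      = iteratedFDerivWithin ℝ 2 U (Icc 0 T ×ˢ Icc s e) z ![w, v] := by
  rw [iteratedFDerivWithin_two_apply _ (uniqueDiffOn_rectangle hT hse) hz,
    iteratedFDerivWithin_two_apply _ (uniqueDiffOn_rectangle hT hse) hz]
  refine (hU z hz).isSymmSndFDerivWithinAt (n := r) ?_ (uniqueDiffOn_rectangle hT hse) ?_ hz v w
  · simp only [minSmoothness_of_isRCLikeNormedField]
    exact_mod_cast hr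
  · rw [interior_prod_eq, closure_prod_eq, interior_Icc, interior_Icc, closure_Ioo hT.ne,
      closure_Ioo hse.ne]
    exact hz

end Rectangle

/-! ### Consequences of piecewise smoothness in space-time -/

/-- The time derivative on the time interval `[0, T]`. -/
noncomputable def timeDeriv (T : ℝ) (u : ℝ → ℝ → ℝ) (t x : ℝ) : ℝ :=
  derivWithin (fun s => u s x) (Icc 0 T) t

lemma timeDeriv_eq_deriv {T t : ℝ} (ht : t ∈ Ioo 0 T) (u : ℝ → ℝ → ℝ) (x : ℝ) :
    timeDeriv T u t x = deriv (fun s => u s x) t :=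
  derivWithin_of_mem_nhds (Icc_mem_nhds ht.1 ht.2)

namespace Mesh.PiecewiseSmooth

variable {τ : Mesh xL xR} {T M : ℝ} {j : ℕ} {u : ℝ → ℝ → ℝ}

/-- The `l`-th spatial derivative on the `i`-th element, for a time derivative in the directions
`m`. -/
noncomputable def part (τ : Mesh xL xR) (T : ℝ) (u : ℝ → ℝ → ℝ) (i : Fin τ.N) {n : ℕ}
    (m : Fin n → ℝ × ℝ) (t : ℝ) (l : ℕ) (x : ℝ) : ℝ :=
  iteratedFDerivWithin ℝ (n + l) (fun z : ℝ × ℝ => u z.1 z.2) (Icc 0 T ×ˢ τ.elem i) (t, x)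
    (prependX m l)

lemma part_zero (i : Fin τ.N) (t x : ℝ) :
    part τ T u i (![] : Fin 0 → ℝ × ℝ) t 0 x = u t x := by
  simp [part]

lemma hasDerivWithinAt_part (h : τ.PiecewiseSmooth T (j + 3) M u) (hT : 0 < T) (i : Fin τ.N)
    {n : ℕ} (m : Fin n → ℝ × ℝ) {t : ℝ} (ht : t ∈ Icc 0 T) {l : ℕ} (hl : n + l < j + 3) {x : ℝ}
    (hx : x ∈ τ.elem i) :
    HasDerivWithinAt (part τ T u i m t l) (part τ T u i m t (l + 1) x) (τ.elem i) x :=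
  hasDerivWithinAt_space hT (τ.node_lt i) (h i).1 hl (prependX m l) ht hx

lemma abs_part_le (h : τ.PiecewiseSmooth T (j + 3) M u) (i : Fin τ.N)
    {n : ℕ} {m : Fin n → ℝ × ℝ} (hm : ∀ i, ‖m i‖ ≤ 1) {t : ℝ} (ht : t ∈ Icc 0 T) {l : ℕ}
    (hl : n + l ≤ j + 3) {x : ℝ} (hx : x ∈ τ.elem i) : |part τ T u i m t l x| ≤ M :=
  abs_iteratedFDerivWithin_le (h i).2 hl (norm_prependX_le hm l) ht hx

lemma abs_part_sub_le (h : τ.PiecewiseSmooth T (j + 3) M u) (hT : 0 < T) (i : Fin τ.N)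
    {n : ℕ} {m : Fin n → ℝ × ℝ} (hm : ∀ i, ‖m i‖ ≤ 1) {t t' : ℝ} (ht : t ∈ Icc 0 T)
    (ht' : t' ∈ Icc 0 T) {l : ℕ} (hl : n + l < j + 3) {x : ℝ} (hx : x ∈ τ.elem i) :
    |part τ T u i m t' l x - part τ T u i m t l x| ≤ M * |t' - t| :=
  abs_time_sub_le hT (τ.node_lt i) (h i).1 (h i).2 hl (norm_prependX_le hm l) ht ht' hx

lemma norm_nil_le : ∀ i, ‖(![] : Fin 0 → ℝ × ℝ) i‖ ≤ 1 := fun i => i.elim0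

lemma norm_single_le : ∀ i, ‖(![(1, 0)] : Fin 1 → ℝ × ℝ) i‖ ≤ 1 := by
  intro i
  simp [Prod.norm_def]

lemma part_single (h : τ.PiecewiseSmooth T (j + 3) M u) (hT : 0 < T) (i : Fin τ.N)
    {t : ℝ} (ht : t ∈ Icc 0 T) {x : ℝ} (hx : x ∈ τ.elem i) :
    part τ T u i ![(1, 0)] t 0 x = timeDeriv T u t x := by
  have h1 := hasDerivWithinAt_time hT (τ.node_lt i) (h i).1 (n := 0) (by omega) ![] ht hx
  simp only [iteratedFDerivWithin_zero_apply] at h1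
  exact (h1.derivWithin (uniqueDiffOn_Icc hT t ht)).symm

lemma smoothBound (h : τ.PiecewiseSmooth T (j + 3) M u) (hT : 0 < T) {t : ℝ} (ht : t ∈ Icc 0 T) :
    τ.SmoothBound (j + 2) (j + 2) M (u t) := fun i =>
  ⟨part τ T u i ![] t, fun x _ => part_zero i t x,
    fun l hl _ hx => h.hasDerivWithinAt_part hT i _ ht (by omega) hx,
    fun l hl _ hx => h.abs_part_le i norm_nil_le ht (by omega) hx⟩

lemma smoothBound_timeDeriv (h : τ.PiecewiseSmooth T (j + 3) M u) (hT : 0 < T) {t : ℝ}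
    (ht : t ∈ Icc 0 T) : τ.SmoothBound (j + 2) (j + 2) M (timeDeriv T u t) := fun i =>
  ⟨part τ T u i ![(1, 0)] t, fun x hx => h.part_single hT i ht hx,
    fun l hl _ hx => h.hasDerivWithinAt_part hT i _ ht (by omega) hx,
    fun l hl _ hx => h.abs_part_le i norm_single_le ht (by omega) hx⟩

lemma smoothBound_sub (h : τ.PiecewiseSmooth T (j + 3) M u) (hT : 0 < T) {t t' : ℝ}
    (ht : t ∈ Icc 0 T) (ht' : t' ∈ Icc 0 T) :
    τ.SmoothBound (j + 2) (j + 2) (M * |t' - t|) (fun x => u t' x - u t x) := fun i =>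
  ⟨fun l x => part τ T u i ![] t' l x - part τ T u i ![] t l x,
    fun x _ => by simp only [part_zero],
    fun l hl _ hx => (h.hasDerivWithinAt_part hT i _ ht' (by omega) hx).sub
      (h.hasDerivWithinAt_part hT i _ ht (by omega) hx),
    fun l hl _ hx => h.abs_part_sub_le hT i norm_nil_le ht ht' (by omega) hx⟩

/-- The bound covers only `j + 1` spatial derivatives: of the `j + 3` available orders, one is the
time derivative and one pays for the Lipschitz bound in time. This is the origin of the order `h^k`
for time differences. -/
lemma smoothBound_timeDeriv_sub (h : τ.PiecewiseSmooth T (j + 3) M u) (hT : 0 < T) {t t' : ℝ}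
    (ht : t ∈ Icc 0 T) (ht' : t' ∈ Icc 0 T) :
    τ.SmoothBound (j + 2) (j + 1) (M * |t' - t|)
      (fun x => timeDeriv T u t' x - timeDeriv T u t x) := fun i =>
  ⟨fun l x => part τ T u i ![(1, 0)] t' l x - part τ T u i ![(1, 0)] t l x,
    fun x hx => by simp only [h.part_single hT i ht hx, h.part_single hT i ht' hx],
    fun l hl _ hx => (h.hasDerivWithinAt_part hT i _ ht' (by omega) hx).sub
      (h.hasDerivWithinAt_part hT i _ ht (by omega) hx),
    fun l hl _ hx => h.abs_part_sub_le hT i norm_single_le ht ht' (by omega) hx⟩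

/-- A bound on the remainder and its first spatial derivative is enough, because that is all the
stability of the `H¹`-projection needs. -/
lemma smoothBound_remainder (h : τ.PiecewiseSmooth T (j + 3) M u) (hT : 0 < T) {t t' : ℝ}
    (ht : t ∈ Icc 0 T) (ht' : t' ∈ Icc 0 T) :
    τ.SmoothBound (j + 2) 1 (M * (t' - t) ^ 2)
      (fun x => u t' x - u t x - (t' - t) * timeDeriv T u t x) := fun i => by
  refine ⟨fun l x => part τ T u i ![] t' l x - part τ T u i ![] t l x
      - (t' - t) * part τ T u i ![(1, 0)] t l x,
    fun x hx => by simp only [part_zero, h.part_single hT i ht hx],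
    fun l hl _ hx => ((h.hasDerivWithinAt_part hT i _ ht' (by omega) hx).sub
      (h.hasDerivWithinAt_part hT i _ ht (by omega) hx)).sub
      ((h.hasDerivWithinAt_part hT i _ ht (by omega) hx).const_mul _), fun l hl x hx => ?_⟩
  have key := abs_time_taylor_le hT (τ.node_lt i) (h i).1 (h i).2 (n := 0 + l) (by omega)
    (norm_prependX_le norm_nil_le l) ht ht' hx
  refine le_trans (le_of_eq ?_) key
  have hl' : l = 0 ∨ l = 1 := by omega
  rcases hl' with rfl | rfl
  · rfl
  · have := iteratedFDerivWithin_comm hT (τ.node_lt i) (by omega) (h i).1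
      (z := (t, x)) ⟨ht, hx⟩ (1, 0) (0, 1)
    have h2 : part τ T u i ![(1, 0)] t 1 x = iteratedFDerivWithin ℝ 2
        (fun z : ℝ × ℝ => u z.1 z.2) (Icc 0 T ×ˢ Icc (τ.node i.castSucc) (τ.node i.succ))
        (t, x) ![(0, 1), (1, 0)] := rfl
    simp only [h2, ← this]
    rfl

end Mesh.PiecewiseSmooth

section Energy

/-! ### Energy estimates -/

/-- If `f' ≤ 2 κ √f`, then `√f` grows at most linearly. -/
lemma sqrt_le_of_deriv_le {S κ : ℝ} (hκ : 0 ≤ κ) {f f' : ℝ → ℝ}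
    (hf0 : ∀ t ∈ Icc 0 S, 0 ≤ f t) (hd : ∀ t ∈ Icc 0 S, HasDerivWithinAt f (f' t) (Icc 0 S) t)
    (hle : ∀ t ∈ Icc 0 S, f' t ≤ 2 * κ * √(f t)) {t : ℝ} (ht : t ∈ Icc 0 S) :
    √(f t) ≤ √(f 0) + κ * t := by
  have h00 : (0 : ℝ) ∈ Icc 0 S := ⟨le_rfl, ht.1.trans ht.2⟩
  -- The shift by `δ` keeps the barrier positive and makes its derivative strictly larger than that
  -- of `f` at any contact point. The square root of `f`, which need not be differentiable at zeros,
  -- is never differentiated.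
  have key : ∀ δ > 0, √(f t) ≤ √(f 0) + δ + (κ + δ) * t := by
    intro δ hδ
    have h1 : f t ≤ (√(f 0) + δ + (κ + δ) * t) ^ 2 := by
      refine image_le_of_deriv_right_lt_deriv_boundary (f := f) (f' := f') (a := 0) (b := S)
        (B := fun t => (√(f 0) + δ + (κ + δ) * t) ^ 2)
        (B' := fun t => 2 * (√(f 0) + δ + (κ + δ) * t) * (κ + δ))
        (fun s hs => (hd s hs).continuousWithinAt) (fun s hs => ?_) ?_ (fun s => ?_)
        (fun s hs heq => ?_) ht
      · exact (hd s (Ico_subset_Icc_self hs)).mono_of_mem_nhdsWithin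
          (Filter.mem_of_superset (Icc_mem_nhdsGE hs.2) (Icc_subset_Icc hs.1 le_rfl))
      · have h2 := Real.sq_sqrt (hf0 0 h00)
        have h3 := Real.sqrt_nonneg (f 0)
        simp only [mul_zero, add_zero]
        nlinarith
      · have h4 : HasDerivAt (fun t => √(f 0) + δ + (κ + δ) * t) (κ + δ) s := by
          simpa using ((hasDerivAt_id s).const_mul (κ + δ)).const_add (√(f 0) + δ)
        refine (h4.pow 2).congr_deriv ?_
        norm_num
      · have hpos : 0 < √(f 0) + δ + (κ + δ) * s := by
          have h3 := Real.sqrt_nonneg (f 0)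
          have h5 := mul_nonneg (add_nonneg hκ hδ.le) hs.1
          linarith
        have h6 := hle s (Ico_subset_Icc_self hs)
        rw [heq, Real.sqrt_sq hpos.le] at h6
        refine h6.trans_lt ?_
        nlinarith
    have hpos : 0 ≤ √(f 0) + δ + (κ + δ) * t := by
      have h3 := Real.sqrt_nonneg (f 0)
      have h5 := mul_nonneg (add_nonneg hκ hδ.le) ht.1
      linarith
    exact Real.sqrt_le_iff.2 ⟨hpos, h1⟩
  refine le_of_forall_pos_le_add fun ε hε => ?_
  have h1t : 0 < 1 + t := by linarith [ht.1]
  refine (key (ε / (1 + t)) (by positivity)).trans (le_of_eq ?_)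
  field_simp
  ring

section EnergyNorm

variable {E : Type*} [NormedAddCommGroup E]

/-- The weighted norm of a pair. -/
noncomputable def energyNorm (a b : ℝ) (y z : E) : ℝ := √(a * ‖y‖ ^ 2 + b * ‖z‖ ^ 2)

lemma norm_le_energyNorm_left {a b : ℝ} (ha : 0 < a) (hb : 0 < b) (y z : E) :
    ‖y‖ ≤ (√a)⁻¹ * energyNorm a b y z := by
  have h : √a * ‖y‖ ≤ energyNorm a b y z := by
    refine Real.le_sqrt_of_sq_le ?_
    rw [mul_pow, Real.sq_sqrt ha.le]
    have : 0 ≤ b * ‖z‖ ^ 2 := by positivity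
    linarith
  have h2 : 0 < √a := Real.sqrt_pos.2 ha
  rw [inv_mul_eq_div, le_div_iff₀ h2]
  linarith

lemma norm_le_energyNorm_right {a b : ℝ} (ha : 0 < a) (hb : 0 < b) (y z : E) :
    ‖z‖ ≤ (√b)⁻¹ * energyNorm a b y z := by
  have := norm_le_energyNorm_left hb ha z y
  rwa [energyNorm, add_comm] at this

end EnergyNorm

variable {E : Type*} [NormedAddCommGroup E] [InnerProductSpace ℝ E]

/-- The energy estimate for a damped system with a skew-symmetric principal part. -/
lemma energyNorm_le {a b S R : ℝ} (ha : 0 < a) (hb : 0 < b) (hR : 0 ≤ R) {y z ρ σ G N P A : ℝ → E}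
    (hy : ∀ t ∈ Icc 0 S, HasDerivWithinAt y (ρ t - a⁻¹ • N t) (Icc 0 S) t)
    (hz : ∀ t ∈ Icc 0 S, HasDerivWithinAt z (σ t - b⁻¹ • (P t + G t + A t)) (Icc 0 S) t)
    (hskew : ∀ t ∈ Icc 0 S, inner ℝ (N t) (y t) + inner ℝ (P t) (z t) = 0)
    (hA : ∀ t ∈ Icc 0 S, 0 ≤ inner ℝ (A t) (z t))
    (hρ : ∀ t ∈ Icc 0 S, ‖ρ t‖ ≤ R) (hσ : ∀ t ∈ Icc 0 S, ‖σ t‖ ≤ R)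
    (hG : ∀ t ∈ Icc 0 S, ‖G t‖ ≤ R) {t : ℝ} (ht : t ∈ Icc 0 S) :
    energyNorm a b (y t) (z t) ≤ energyNorm a b (y 0) (z 0)
      + (a + b + 1) * ((√a)⁻¹ + (√b)⁻¹) * R * t := by
  have hc : 0 ≤ (a + b + 1) * ((√a)⁻¹ + (√b)⁻¹) * R := by positivity
  refine sqrt_le_of_deriv_le (f := fun t => a * ‖y t‖ ^ 2 + b * ‖z t‖ ^ 2)
    (f' := fun t => a * (2 * inner ℝ (y t) (ρ t - a⁻¹ • N t))
      + b * (2 * inner ℝ (z t) (σ t - b⁻¹ • (P t + G t + A t)))) hc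
    (fun t _ => by positivity)
    (fun t ht => ((hy t ht).norm_sq.const_mul a).add ((hz t ht).norm_sq.const_mul b))
    (fun t ht => ?_) ht
  -- The weights `a` and `b` cancel the inverse factors in the equations, so that the skew terms add
  -- up to zero; the damping term has a favourable sign and is dropped.
  have e1 : a * (2 * inner ℝ (y t) (ρ t - a⁻¹ • N t))
      + b * (2 * inner ℝ (z t) (σ t - b⁻¹ • (P t + G t + A t)))
      = 2 * (a * inner ℝ (y t) (ρ t) + b * inner ℝ (z t) (σ t) - inner ℝ (z t) (G t)
        - inner ℝ (A t) (z t) - (inner ℝ (N t) (y t) + inner ℝ (P t) (z t))) := by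
    simp only [inner_sub_right, inner_smul_right, inner_add_right]
    rw [real_inner_comm (y t) (N t), real_inner_comm (z t) (P t), real_inner_comm (z t) (A t)]
    field_simp
    ring
  rw [e1, hskew t ht]
  have i1 := (real_inner_le_norm (y t) (ρ t)).trans
    (mul_le_mul_of_nonneg_left (hρ t ht) (norm_nonneg _))
  have i2 := (real_inner_le_norm (z t) (σ t)).trans
    (mul_le_mul_of_nonneg_left (hσ t ht) (norm_nonneg _))
  have i3 := ((neg_le_abs _).trans (abs_real_inner_le_norm (z t) (G t))).trans
    (mul_le_mul_of_nonneg_left (hG t ht) (norm_nonneg _))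
  have i4 := hA t ht
  have n1 := norm_le_energyNorm_left ha hb (y t) (z t)
  have n2 := norm_le_energyNorm_right ha hb (y t) (z t)
  have hE : √(a * ‖y t‖ ^ 2 + b * ‖z t‖ ^ 2) = energyNorm a b (y t) (z t) := rfl
  rw [hE]
  set F := energyNorm a b (y t) (z t)
  have j1 := mul_le_mul_of_nonneg_left i1 ha.le
  have j2 := mul_le_mul_of_nonneg_left i2 hb.le
  have hny := norm_nonneg (y t)
  have hnz := norm_nonneg (z t)
  calc _ ≤ 2 * (a * (‖y t‖ * R) + b * (‖z t‖ * R) + ‖z t‖ * R) := by linarith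
    _ ≤ 2 * ((a + b + 1) * R * (‖y t‖ + ‖z t‖)) := by
      have k1 : 0 ≤ (b + 1) * (‖y t‖ * R) := by positivity
      have k2 : 0 ≤ a * (‖z t‖ * R) := by positivity
      nlinarith
    _ ≤ 2 * ((a + b + 1) * R * ((√a)⁻¹ * F + (√b)⁻¹ * F)) := by gcongr
    _ = _ := by ring

/-- The derivative is a limit of difference quotients, which are bounded by `K`; this turns
Lipschitz bounds in time into bounds for `y'` and `z'`. -/
lemma norm_deriv_le_of_lip {E : Type*} [NormedAddCommGroup E] [NormedSpace ℝ E] {T K : ℝ}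
    (hT : 0 < T) {y : ℝ → E} {y' : E}
    (hK : ∀ s ∈ Icc 0 T, ∀ t ∈ Icc 0 T, ‖y t - y s‖ ≤ K * |t - s|) {t : ℝ} (ht : t ∈ Icc 0 T)
    (hd : HasDerivWithinAt y y' (Icc 0 T) t) : ‖y'‖ ≤ K := by
  have hne : (nhdsWithin t (Icc 0 T \ {t})).NeBot :=
    accPt_principal_iff_nhdsWithin.1 ((uniqueDiffOn_Icc hT).uniqueDiffWithinAt ht).accPt
  refine le_of_tendsto (hasDerivWithinAt_iff_tendsto_slope.1 hd).norm ?_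
  filter_upwards [self_mem_nhdsWithin] with s hs
  have hst : 0 < |s - t| := abs_pos.2 (sub_ne_zero.2 hs.2)
  rw [slope_def_module, norm_smul, norm_inv, Real.norm_eq_abs, inv_mul_le_iff₀ hst, mul_comm]
  exact hK t ht s hs.1

/-- Stability of the damped system: bounds for the solution and for the principal part. -/
theorem exists_stability_const {a b T D : ℝ} (ha : 0 < a) (hb : 0 < b) (hT : 0 < T) (hD : 0 ≤ D) :
    ∃ C, 0 ≤ C ∧ ∀ (n : ℕ) (A : EuclideanSpace ℝ (Fin n) →ₗ[ℝ] EuclideanSpace ℝ (Fin n))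
      (y z ρ σ G N P : ℝ → EuclideanSpace ℝ (Fin n)) (R R' : ℝ),
      (∀ c, ‖A c‖ ≤ D * ‖c‖) → (∀ c, 0 ≤ inner ℝ (A c) c) →
      (∀ t ∈ Icc 0 T, HasDerivWithinAt y (ρ t - a⁻¹ • N t) (Icc 0 T) t) →
      (∀ t ∈ Icc 0 T, HasDerivWithinAt z (σ t - b⁻¹ • (P t + G t + A (z t))) (Icc 0 T) t) →
      (∀ t ∈ Icc 0 T, inner ℝ (N t) (y t) + inner ℝ (P t) (z t) = 0) →
      (∀ s ∈ Icc 0 T, ∀ t ∈ Icc 0 T,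
        inner ℝ (N t - N s) (y t - y s) + inner ℝ (P t - P s) (z t - z s) = 0) →
      y 0 = 0 → z 0 = 0 →
      (∀ t ∈ Icc 0 T, ‖ρ t‖ ≤ R ∧ ‖σ t‖ ≤ R ∧ ‖G t‖ ≤ R) →
      (∀ s ∈ Icc 0 T, ∀ t ∈ Icc 0 T, ‖ρ t - ρ s‖ ≤ R' * |t - s| ∧ ‖σ t - σ s‖ ≤ R' * |t - s| ∧
        ‖G t - G s‖ ≤ R' * |t - s|) →
      ∀ t ∈ Icc 0 T, ‖y t‖ ≤ C * R ∧ ‖z t‖ ≤ C * R ∧ ‖N t‖ ≤ C * (R + R') ∧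
        ‖P t‖ ≤ C * (R + R') := by
  set ca := (√a)⁻¹ with hca
  set cb := (√b)⁻¹ with hcb
  have hca0 : 0 ≤ ca := by positivity
  have hcb0 : 0 ≤ cb := by positivity
  set κ := (a + b + 1) * (ca + cb) with hκ
  have hκ0 : 0 ≤ κ := by positivity
  -- The constant is the sum of those needed for `y`, `z`, `N` and `P`; it is chosen before the
  -- dimension `n`.
  refine ⟨ca * κ * T + cb * κ * T + a + a * ca * κ * (1 + T)
    + (b + 1 + D * (cb * κ * T) + b * cb * κ * (1 + T)), by positivity, ?_⟩
  intro n A y z ρ σ G N P R R' hAb hA0 hy hz hsk hsk' hy0 hz0 hR hR' t ht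
  have h0T : (0 : ℝ) ∈ Icc 0 T := ⟨le_rfl, hT.le⟩
  have hR0 : 0 ≤ R := (norm_nonneg _).trans (hR 0 h0T).1
  have hR'0 : 0 ≤ R' := by
    have := (norm_nonneg _).trans (hR' 0 h0T T ⟨hT.le, le_rfl⟩).1
    rw [sub_zero, abs_of_pos hT] at this
    exact nonneg_of_mul_nonneg_left this hT
  have hE : ∀ t ∈ Icc 0 T, energyNorm a b (y t) (z t) ≤ κ * R * t := by
    intro t ht
    have := energyNorm_le ha hb hR0 hy hz hsk (fun t _ => hA0 _) (fun t ht => (hR t ht).1)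
      (fun t ht => (hR t ht).2.1) (fun t ht => (hR t ht).2.2) ht
    rw [hy0, hz0] at this
    simpa [energyNorm] using this
  -- The shifted difference with step `δ` solves the same system on `[0, T - δ]`, with data bounded
  -- by `R' δ`. Its initial value is `(y δ, z δ)`, which is bounded by `κ R δ` because the solution
  -- starts from zero. No bound for the initial derivatives is needed.
  have hΔ : ∀ s ∈ Icc 0 T, ∀ t ∈ Icc 0 T, s ≤ t →
      energyNorm a b (y t - y s) (z t - z s) ≤ κ * (R + R' * T) * |t - s| := by
    intro s hs t ht hst
    set δ := t - s with hδ
    have hδ0 : 0 ≤ δ := sub_nonneg.2 hst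
    have hsub : ∀ r ∈ Icc 0 (T - δ), r ∈ Icc 0 T ∧ r + δ ∈ Icc 0 T := fun r hr =>
      ⟨⟨hr.1, by linarith [hr.2]⟩, ⟨by linarith [hr.1], by linarith [hr.2]⟩⟩
    have hmap : MapsTo (fun r => r + δ) (Icc 0 (T - δ)) (Icc 0 T) := fun r hr => (hsub r hr).2
    have hshift : ∀ {w : ℝ → EuclideanSpace ℝ (Fin n)} {w' : EuclideanSpace ℝ (Fin n)} {r : ℝ},
        HasDerivWithinAt w w' (Icc 0 T) (r + δ) →
        HasDerivWithinAt (fun r => w (r + δ)) w' (Icc 0 (T - δ)) r := by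
      intro w w' r hw
      have h1 : HasDerivWithinAt (fun r => r + δ) 1 (Icc 0 (T - δ)) r :=
        (hasDerivWithinAt_id r _).add_const δ
      have := HasDerivWithinAt.scomp r hw h1 hmap
      rw [one_smul] at this
      exact this
    have hst' : Icc 0 (T - δ) ⊆ Icc 0 T := fun r hr => (hsub r hr).1
    have hs' : s ∈ Icc 0 (T - δ) := ⟨hs.1, by linarith [ht.2]⟩
    have habs : ∀ r : ℝ, |r + δ - r| = δ := fun r => by
      rw [add_sub_cancel_left, abs_of_nonneg hδ0]
    have key := energyNorm_le (S := T - δ) (R := R' * δ) ha hb (by positivity)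
      (y := fun r => y (r + δ) - y r) (z := fun r => z (r + δ) - z r)
      (ρ := fun r => ρ (r + δ) - ρ r) (σ := fun r => σ (r + δ) - σ r)
      (G := fun r => G (r + δ) - G r) (N := fun r => N (r + δ) - N r)
      (P := fun r => P (r + δ) - P r) (A := fun r => A (z (r + δ) - z r))
      (fun r hr => ((hshift (hy _ (hsub r hr).2)).sub ((hy r (hsub r hr).1).mono hst')).congr_deriv
        (by rw [smul_sub]; abel))
      (fun r hr => ((hshift (hz _ (hsub r hr).2)).sub ((hz r (hsub r hr).1).mono hst')).congr_deriv
        (by rw [map_sub]; simp only [smul_sub, smul_add]; abel))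
      (fun r hr => hsk' _ (hsub r hr).1 _ (hsub r hr).2) (fun r hr => hA0 _)
      (fun r hr => by simpa only [habs] using (hR' r (hsub r hr).1 (r + δ) (hsub r hr).2).1)
      (fun r hr => by simpa only [habs] using (hR' r (hsub r hr).1 (r + δ) (hsub r hr).2).2.1)
      (fun r hr => by simpa only [habs] using (hR' r (hsub r hr).1 (r + δ) (hsub r hr).2).2.2) hs'
    have e1 : s + δ = t := by rw [hδ]; ring
    simp only [e1, zero_add, hy0, hz0, sub_zero] at key
    have hδT : δ ∈ Icc 0 T := ⟨hδ0, by linarith [ht.2, hs.1]⟩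
    rw [abs_of_nonneg hδ0]
    calc _ ≤ _ := key
      _ ≤ κ * R * δ + κ * (R' * δ) * T := by
        refine add_le_add (hE δ hδT) ?_
        exact mul_le_mul_of_nonneg_left hs.2 (by positivity)
      _ = _ := by ring
  have hΔ' : ∀ s ∈ Icc 0 T, ∀ t ∈ Icc 0 T,
      energyNorm a b (y t - y s) (z t - z s) ≤ κ * (R + R' * T) * |t - s| := by
    intro s hs t ht
    rcases le_total s t with h | h
    · exact hΔ s hs t ht h
    · have := hΔ t ht s hs h
      rw [abs_sub_comm, energyNorm, norm_sub_rev (y s), norm_sub_rev (z s)] at this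
      exact this
  have hE' : energyNorm a b (y t) (z t) ≤ κ * R * T :=
    (hE t ht).trans (mul_le_mul_of_nonneg_left ht.2 (by positivity))
  have b1 : ‖y t‖ ≤ ca * (κ * R * T) :=
    (norm_le_energyNorm_left ha hb (y t) (z t)).trans (mul_le_mul_of_nonneg_left hE' hca0)
  have b2 : ‖z t‖ ≤ cb * (κ * R * T) :=
    (norm_le_energyNorm_right ha hb (y t) (z t)).trans (mul_le_mul_of_nonneg_left hE' hcb0)
  have b3 : ‖ρ t - a⁻¹ • N t‖ ≤ ca * (κ * (R + R' * T)) := by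
    refine norm_deriv_le_of_lip hT (fun s hs t ht => ?_) ht (hy t ht)
    rw [mul_assoc]
    exact (norm_le_energyNorm_left ha hb _ (z t - z s)).trans
      (mul_le_mul_of_nonneg_left (hΔ' s hs t ht) hca0)
  have b4 : ‖σ t - b⁻¹ • (P t + G t + A (z t))‖ ≤ cb * (κ * (R + R' * T)) := by
    refine norm_deriv_le_of_lip hT (fun s hs t ht => ?_) ht (hz t ht)
    rw [mul_assoc]
    exact (norm_le_energyNorm_right ha hb (y t - y s) _).trans
      (mul_le_mul_of_nonneg_left (hΔ' s hs t ht) hcb0)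
  have hRT : R + R' * T ≤ (1 + T) * (R + R') := by nlinarith [mul_nonneg hT.le hR0]
  -- With `y'` and `z'` bounded, the equations are solved for the principal parts.
  have b5 : ‖N t‖ ≤ a * (R + ca * (κ * (R + R' * T))) := by
    have e : N t = a • (ρ t - (ρ t - a⁻¹ • N t)) := by
      rw [sub_sub_cancel, smul_smul, mul_inv_cancel₀ ha.ne', one_smul]
    rw [e, norm_smul, Real.norm_eq_abs, abs_of_pos ha]
    exact mul_le_mul_of_nonneg_left
      ((norm_sub_le _ _).trans (add_le_add (hR t ht).1 b3)) ha.le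
  have b6 : ‖P t‖ ≤ b * (R + cb * (κ * (R + R' * T))) + R + D * (cb * (κ * R * T)) := by
    have e : P t = b • (σ t - (σ t - b⁻¹ • (P t + G t + A (z t)))) - G t - A (z t) := by
      rw [sub_sub_cancel, smul_smul, mul_inv_cancel₀ hb.ne', one_smul]
      abel
    rw [e]
    refine (norm_sub_le _ _).trans (add_le_add ((norm_sub_le _ _).trans
      (add_le_add ?_ (hR t ht).2.2)) ((hAb _).trans (mul_le_mul_of_nonneg_left b2 hD)))
    rw [norm_smul, Real.norm_eq_abs, abs_of_pos hb]
    exact mul_le_mul_of_nonneg_left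
      ((norm_sub_le _ _).trans (add_le_add (hR t ht).2.1 b4)) hb.le
  have hRR : R ≤ R + R' := le_add_of_nonneg_right hR'0
  set X1 := ca * κ * T
  set X2 := cb * κ * T
  set X3 := a * ca * κ * (1 + T)
  set X4 := b * cb * κ * (1 + T)
  have x1 : 0 ≤ X1 := by positivity
  have x2 : 0 ≤ X2 := by positivity
  have x3 : 0 ≤ X3 := by positivity
  have x4 : 0 ≤ X4 := by positivity
  have x5 : 0 ≤ D * X2 := by positivity
  refine ⟨b1.trans ?_, b2.trans ?_, b5.trans ?_, b6.trans ?_⟩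
  · calc _ = X1 * R := by ring
      _ ≤ _ := mul_le_mul_of_nonneg_right (by linarith) hR0
  · calc _ = X2 * R := by ring
      _ ≤ _ := mul_le_mul_of_nonneg_right (by linarith) hR0
  · calc _ ≤ a * ((R + R') + ca * (κ * ((1 + T) * (R + R')))) := by gcongr
      _ = (a + X3) * (R + R') := by ring
      _ ≤ _ := mul_le_mul_of_nonneg_right (by linarith) (by positivity)
  · calc _ ≤ b * ((R + R') + cb * (κ * ((1 + T) * (R + R')))) + (R + R')
          + D * (cb * (κ * (R + R') * T)) := by gcongr
      _ = (b + 1 + D * X2 + X4) * (R + R') := by ring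
      _ ≤ _ := mul_le_mul_of_nonneg_right (by linarith) (by positivity)

/-! ### Differentiability in time -/

lemma hasDerivWithinAt_of_quadratic {F : Type*} [NormedAddCommGroup F] [NormedSpace ℝ F]
    {S : Set ℝ} {w : ℝ → F} {w' : F} {t K : ℝ}
    (h : ∀ s ∈ S, ‖w s - w t - (s - t) • w'‖ ≤ K * (s - t) ^ 2) : HasDerivWithinAt w w' S t := by
  rw [hasDerivWithinAt_iff_isLittleO]
  have h1 : (fun s => w s - w t - (s - t) • w') =O[nhdsWithin t S] fun s => (s - t) ^ 2 := by
    refine Asymptotics.IsBigO.of_bound K ?_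
    filter_upwards [self_mem_nhdsWithin] with s hs
    refine (h s hs).trans (le_of_eq ?_)
    rw [Real.norm_eq_abs, abs_of_nonneg (sq_nonneg _)]
  have h2 : (fun s : ℝ => (s - t) ^ 2) =o[nhds t] fun s => s - t := by
    have := Asymptotics.isLittleO_pow_sub_sub t (m := 2) (by norm_num)
    simpa using this
  exact h1.trans_isLittleO (h2.mono nhdsWithin_le_nhds)

/-- A constant continuation of `G` beyond the end points reduces the claim to the two-sided
fundamental theorem, so that `t = 0` and `t = T` are included. -/
lemma hasDerivWithinAt_integral_of_continuousOn {F : Type*} [NormedAddCommGroup F]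
    [NormedSpace ℝ F] [CompleteSpace F] {T : ℝ} (hT : 0 < T) {G : ℝ → F}
    (hG : ContinuousOn G (Icc 0 T)) {t : ℝ} (ht : t ∈ Icc 0 T) :
    HasDerivWithinAt (fun t => ∫ s in (0 : ℝ)..t, G s) (G t) (Icc 0 T) t := by
  set G' : ℝ → F := IccExtend hT.le ((Icc 0 T).domRestrict G)
  have hG' : Continuous G' := (continuousOn_iff_continuous_domRestrict.1 hG).Icc_extend'
  have heq : ∀ s ∈ Icc 0 T, G' s = G s := fun s hs => by
    simp only [G']
    rw [IccExtend_of_mem _ _ hs]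
    rfl
  have h1 : HasDerivWithinAt (fun t => ∫ s in (0 : ℝ)..t, G' s) (G' t) (Icc 0 T) t :=
    (intervalIntegral.integral_hasDerivAt_right (hG'.intervalIntegrable _ _)
      hG'.stronglyMeasurable.stronglyMeasurableAtFilter hG'.continuousAt).hasDerivWithinAt
  rw [heq t ht] at h1
  refine h1.congr_of_mem (fun r hr => ?_) ht
  refine intervalIntegral.integral_congr fun s hs => (heq s ?_).symm
  rw [uIcc_of_le hr.1] at hs
  exact ⟨hs.1, hs.2.trans hr.2⟩

end Energy

namespace Mesh.ONB

variable {τ : Mesh xL xR} {j : ℕ} (B : τ.ONB j)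

lemma norm_coef_le_of_bound (hx : xL < xR) {v : ℝ → ℝ} (hv : Bdd xL xR v) {K : ℝ} (hK : 0 ≤ K)
    (h : ∀ᵐ x ∂dom xL xR, |v x| ≤ K) : ‖B.coef v‖ ≤ √(xR - xL) * K :=
  (B.norm_coef_le hx hv).trans (l2norm_le_of_bound hx hK h)

/-- Testing with the basis determines the coefficients. -/
lemma coef_eq_of_forall {v : ℝ → ℝ} {c : EuclideanSpace ℝ (Fin B.n)}
    (h : ∀ α, ip xL xR v (B.φ α) = c α) : B.coef v = c := by
  ext α
  exact h α

lemma coef_sum (hx : xL < xR) {ι : Type*} [Fintype ι] {u : ι → ℝ → ℝ}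
    (hu : ∀ r, Bdd xL xR (u r)) (c : ι → ℝ) :
    B.coef (fun x => ∑ r, c r * u r x) = ∑ r, c r • B.coef (u r) := by
  refine B.coef_eq_of_forall fun α => ?_
  rw [ip_sum_left hx (fun r => (Bdd.const _).mul (hu r)) (B.bdd_φ hx α)]
  simp [ip_smul_left]

/-! ### Continuity and differentiability of coefficients in time -/

lemma continuousOn_coef (hx : xL < xR) {w : ℝ → ℝ → ℝ} {S : Set ℝ} {K : ℝ} (hK : 0 ≤ K)
    (hw : ∀ t ∈ S, Bdd xL xR (w t))
    (h : ∀ t ∈ S, ∀ t' ∈ S, ∀ᵐ x ∂dom xL xR, |w t' x - w t x| ≤ K * |t' - t|) :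
    ContinuousOn (fun t => B.coef (w t)) S := by
  have hlip : LipschitzOnWith (Real.toNNReal (√(xR - xL) * K)) (fun t => B.coef (w t)) S := by
    refine LipschitzOnWith.of_dist_le_mul fun t' ht' t ht => ?_
    rw [Real.coe_toNNReal _ (by positivity), dist_eq_norm,
      ← B.coef_sub hx (hw t' ht') (hw t ht), Real.dist_eq, mul_assoc]
    exact B.norm_coef_le_of_bound hx ((hw t' ht').sub (hw t ht)) (by positivity) (h t ht t' ht')
  exact hlip.continuousOn

/-- The `H¹`-projection commutes with the time derivative: it is linear and bounded by `v` and its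
first spatial derivative, and the Taylor remainder in time is quadratically small in both. -/
lemma hasDerivWithinAt_coef_interp (hx : xL < xR) {T M : ℝ} (hT : 0 < T) {u : ℝ → ℝ → ℝ}
    (hu : τ.PiecewiseSmooth T (j + 3) M u) {t : ℝ} (ht : t ∈ Icc 0 T) :
    HasDerivWithinAt (fun t => B.coef (B.interp (u t))) (B.coef (B.interp (timeDeriv T u t)))
      (Icc 0 T) t := by
  refine hasDerivWithinAt_of_quadratic
    (K := √(xR - xL) * (M * (1 + τ.size))) fun s hs => ?_
  have h1 := hu.smoothBound hT ht
  have h2 := hu.smoothBound hT hs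
  have h3 := hu.smoothBound_timeDeriv hT ht
  have h4 := hu.smoothBound_remainder hT ht hs
  have hM := h1.nonneg hx
  have hh := (τ.size_pos hx).le
  set v := fun x => u s x - u t x - (s - t) * timeDeriv T u t x with hv
  have hI : ∀ x ∈ Icc xL xR, B.interp v x
      = B.interp (u s) x - B.interp (u t) x - (s - t) * B.interp (timeDeriv T u t) x := by
    intro x hxx
    rw [hv, B.interp_sub hx (h2.sub h1) (h3.smul (s - t)) (by omega) (by omega) hxx,
      B.interp_sub hx h2 h1 (by omega) (by omega) hxx, B.interp_smul]
  have hc : B.coef (B.interp (u s)) - B.coef (B.interp (u t))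
      - (s - t) • B.coef (B.interp (timeDeriv T u t)) = B.coef (B.interp v) := by
    rw [← B.coef_smul, ← B.coef_sub hx (B.bdd_interp hx _) (B.bdd_interp hx _),
      ← B.coef_sub hx ((B.bdd_interp hx _).sub (B.bdd_interp hx _))
        ((Bdd.const _).mul (B.bdd_interp hx _))]
    refine B.coef_congr hx ?_
    filter_upwards [ae_restrict_mem measurableSet_Ioo] with x hxi
    exact (hI x (Ioo_subset_Icc_self hxi)).symm
  rw [hc, mul_assoc]
  refine B.norm_coef_le_of_bound hx (B.bdd_interp hx v) (by positivity) ?_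
  filter_upwards [ae_restrict_mem measurableSet_Ioo] with x hxi
  have e1 := B.abs_sub_interp_le hx h4 (by omega) (l := 0) (by omega) (by omega) (by omega)
    (Ioo_subset_Icc_self hxi)
  have e2 := h4.abs_le hx (Ioo_subset_Icc_self hxi)
  calc |B.interp v x| = |v x - (v x - B.interp v x)| := by rw [sub_sub_cancel]
    _ ≤ |v x| + |v x - B.interp v x| := abs_sub _ _
    _ ≤ M * (s - t) ^ 2 + M * (s - t) ^ 2 * τ.size ^ (0 + 1) := add_le_add e2 e1
    _ = _ := by ring

/-- The friction operator on the coefficients. -/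
noncomputable def friction (hx : xL < xR) {d : ℝ → ℝ} (hd : Bdd xL xR d) :
    EuclideanSpace ℝ (Fin B.n) →ₗ[ℝ] EuclideanSpace ℝ (Fin B.n) where
  toFun c := B.coef fun x => d x * B.syn c x
  map_add' c c' := by
    rw [← B.coef_add hx (hd.mul (B.bdd_syn hx c)) (hd.mul (B.bdd_syn hx c'))]
    congr 1
    ext x
    simp only [syn, PiLp.add_apply, add_mul, Finset.sum_add_distrib]
    ring
  map_smul' r c := by
    rw [RingHom.id_apply, ← B.coef_smul]
    congr 1
    ext x
    simp only [syn, PiLp.smul_apply, smul_eq_mul, mul_assoc, ← Finset.mul_sum]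
    ring

section InTime

variable {T : ℝ} {X : Set (ℝ → ℝ)} {u u' : ℝ → ℝ → ℝ}

lemma continuousOn_point (hT : 0 < T) (h : IsH1InTime xL xR T X u u') {x : ℝ}
    (hxx : x ∈ Icc xL xR) : ContinuousOn (fun t => u t x) (Icc 0 T) := by
  have hi : IntervalIntegrable (fun t => u' t x) volume 0 T := by
    rw [intervalIntegrable_iff_integrableOn_Ioo_of_le hT.le]
    exact (h.memLp x hxx).integrable one_le_two
  have h1 := intervalIntegral.continuousOn_primitive_interval' hi left_mem_uIcc
  rw [uIcc_of_le hT.le] at h1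
  exact (continuousOn_const.add h1).congr fun t ht => h.eq_integral x hxx t ht

/-- The coefficients of a function in a finite-dimensional space of piecewise polynomials, and
those of its derivative, depend on finitely many point values. -/
lemma exists_coef_eq_sum (hx : xL < xR) (k : ℕ) :
    ∃ (s : Fin τ.N × Fin (k + 1) → ℝ) (c c' : Fin τ.N × Fin (k + 1) → EuclideanSpace ℝ (Fin B.n)),
      (∀ r, s r ∈ Icc xL xR) ∧ ∀ v ∈ τ.PiecewisePoly k,
        B.coef v = ∑ r, v (s r) • c r ∧ B.coef (deriv v) = ∑ r, v (s r) • c' r := by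
  obtain ⟨s, l, l', hs, hl, hl', h⟩ := τ.exists_lagrange k
  refine ⟨s, fun r => B.coef (l r), fun r => B.coef (l' r), hs, fun v hv => ⟨?_, ?_⟩⟩
  · rw [← B.coef_sum hx fun r => τ.bdd_of_mem hx (hl r)]
    exact B.coef_congr hx (τ.ae_of_openElem hx fun i x hxi => (h v hv i x hxi).1)
  · rw [← B.coef_sum hx fun r => τ.bdd_of_mem hx (hl' r)]
    exact B.coef_congr hx (τ.ae_of_openElem hx fun i x hxi => (h v hv i x hxi).2)

lemma continuousOn_coef_inTime {k : ℕ} (hX : ∀ v ∈ X, v ∈ τ.PiecewisePoly k) (hx : xL < xR)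
    (hT : 0 < T) (h : IsH1InTime xL xR T X u u') :
    ContinuousOn (fun t => B.coef (u t)) (Icc 0 T) ∧
      ContinuousOn (fun t => B.coef (deriv (u t))) (Icc 0 T) := by
  obtain ⟨s, c, c', hs, hc⟩ := B.exists_coef_eq_sum hx k
  constructor
  · refine ContinuousOn.congr (f := fun t => ∑ r, u t (s r) • c r) ?_
      fun t ht => (hc _ (hX _ (h.mem t ht))).1
    exact continuousOn_finsetSum _ fun r _ =>
      (continuousOn_point hT h (hs r)).smul continuousOn_const
  · refine ContinuousOn.congr (f := fun t => ∑ r, u t (s r) • c' r) ?_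
      fun t ht => (hc _ (hX _ (h.mem t ht))).2
    exact continuousOn_finsetSum _ fun r _ =>
      (continuousOn_point hT h (hs r)).smul continuousOn_const

/-- Coefficients are fixed combinations of point values, so they are primitives of the coefficients
of `u'`. If these agree almost everywhere with a continuous function, the coefficients are
differentiable at every time, which the energy argument requires. -/
lemma hasDerivWithinAt_coef_inTime {k : ℕ} (hX : ∀ v ∈ X, v ∈ τ.PiecewisePoly k) (hx : xL < xR)
    (hT : 0 < T) (h : IsH1InTime xL xR T X u u')
    {G : ℝ → EuclideanSpace ℝ (Fin B.n)} (hG : ContinuousOn G (Icc 0 T))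
    (hGu : ∀ᵐ t ∂volume.restrict (Ioo 0 T), B.coef (u' t) = G t) {t : ℝ} (ht : t ∈ Icc 0 T) :
    HasDerivWithinAt (fun t => B.coef (u t)) (G t) (Icc 0 T) t := by
  obtain ⟨s, c, c', hs, hc⟩ := B.exists_coef_eq_sum hx k
  have h0T : (0 : ℝ) ∈ Icc 0 T := ⟨le_rfl, hT.le⟩
  have hi : ∀ r, IntervalIntegrable (fun t => u' t (s r)) volume 0 T := fun r => by
    rw [intervalIntegrable_iff_integrableOn_Ioo_of_le hT.le]
    exact (h.memLp _ (hs r)).integrable one_le_two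
  have hprim : ∀ t ∈ Icc 0 T, B.coef (u t) = B.coef (u 0) + ∫ σ in (0 : ℝ)..t, G σ := by
    intro t ht
    have hsub : uIcc 0 t ⊆ uIcc 0 T := by
      rw [uIcc_of_le ht.1, uIcc_of_le hT.le]
      exact Icc_subset_Icc le_rfl ht.2
    have h1 : ∫ σ in (0 : ℝ)..t, G σ = ∫ σ in (0 : ℝ)..t, ∑ r, u' σ (s r) • c r := by
      rw [intervalIntegral.integral_of_le ht.1, intervalIntegral.integral_of_le ht.1,
        integral_Ioc_eq_integral_Ioo, integral_Ioc_eq_integral_Ioo]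
      have hmono := Measure.restrict_mono (μ := volume) (Ioo_subset_Ioo (le_refl (0 : ℝ)) ht.2) le_rfl
      refine integral_congr_ae ?_
      filter_upwards [ae_mono hmono hGu, ae_restrict_mem measurableSet_Ioo] with σ h2 h3
      rw [← h2]
      exact (hc _ (hX _ (h.mem' σ ⟨h3.1.le, h3.2.le.trans ht.2⟩))).1
    rw [h1, intervalIntegral.integral_finsetSum fun r _ =>
        ⟨((hi r).mono_set hsub).1.smul_const _, ((hi r).mono_set hsub).2.smul_const _⟩,
      (hc _ (hX _ (h.mem t ht))).1, (hc _ (hX _ (h.mem 0 h0T))).1, ← Finset.sum_add_distrib]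
    refine Finset.sum_congr rfl fun r _ => ?_
    rw [intervalIntegral.integral_smul_const, ← add_smul, ← h.eq_integral _ (hs r) t ht]
  exact ((hasDerivWithinAt_integral_of_continuousOn hT hG ht).const_add _).congr_of_mem hprim ht

end InTime

end Mesh.ONB

/-! ### Consistency errors as coefficient vectors -/

lemma Mesh.V_sub (τ : Mesh xL xR) {k : ℕ} {v w : ℝ → ℝ} (hv : v ∈ τ.V k) (hw : w ∈ τ.V k) :
    (fun x => v x - w x) ∈ τ.V k :=
  ⟨τ.sub_mem hv.1 hw.1, hv.2.sub hw.2⟩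

lemma Mesh.Q_sub (τ : Mesh xL xR) {k : ℕ} {v w : ℝ → ℝ} (hv : v ∈ τ.Q k) (hw : w ∈ τ.Q k) :
    (fun x => v x - w x) ∈ τ.Q k :=
  ⟨τ.V_sub hv.1 hw.1, by simp [hv.2.1, hw.2.1], by simp [hv.2.2, hw.2.2]⟩

namespace Mesh.ONB

variable {τ : Mesh xL xR} {j : ℕ} (B : τ.ONB j)

lemma coef_deriv_sub (hx : xL < xR) {k : ℕ} {v w : ℝ → ℝ} (hv : v ∈ τ.PiecewisePoly k)
    (hw : w ∈ τ.PiecewisePoly k) :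
    B.coef (deriv fun x => v x - w x) = B.coef (deriv v) - B.coef (deriv w) := by
  rw [← B.coef_sub hx (τ.bdd_of_mem hx (τ.deriv_mem hv)) (τ.bdd_of_mem hx (τ.deriv_mem hw))]
  exact B.coef_congr hx (τ.ae_of_openElem hx fun i x hxi =>
    ((τ.hasDerivAt_of_mem hv hxi).sub (τ.hasDerivAt_of_mem hw hxi)).deriv)

lemma syn_sub (c c' : EuclideanSpace ℝ (Fin B.n)) (x : ℝ) :
    B.syn (c - c') x = B.syn c x - B.syn c' x := by
  simp [syn, sub_mul]

lemma coef_interp_sub (hx : xL < xR) {v w : ℝ → ℝ} {r r' : ℕ} {K K' : ℝ}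
    (hv : τ.SmoothBound (j + 2) r K v) (hw : τ.SmoothBound (j + 2) r' K' w) :
    B.coef (B.interp fun x => v x - w x) = B.coef (B.interp v) - B.coef (B.interp w) := by
  rw [← B.coef_sub hx (B.bdd_interp hx _) (B.bdd_interp hx _)]
  refine B.coef_congr hx ?_
  filter_upwards [ae_restrict_mem measurableSet_Ioo] with x hxi
  exact B.interp_sub hx hv hw (by omega) (by omega) (Ioo_subset_Icc_self hxi)

lemma norm_coef_interp_sub_le (hx : xL < xR) {v : ℝ → ℝ} {r : ℕ} {K : ℝ}
    (hv : τ.SmoothBound (j + 2) r K v) {l : ℕ} (hl : l ≤ j + 1) (hlr : l + 1 ≤ r) :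
    ‖B.coef (B.interp v) - B.coef v‖ ≤ √(xR - xL) * (K * τ.size ^ (l + 1)) := by
  have hK := hv.nonneg hx
  have hh := (τ.size_pos hx).le
  have hvb := hv.bdd hx (by omega)
  rw [norm_sub_rev, ← B.coef_sub hx hvb (B.bdd_interp hx _)]
  refine B.norm_coef_le_of_bound hx (hvb.sub (B.bdd_interp hx _)) (by positivity) ?_
  filter_upwards [ae_restrict_mem measurableSet_Ioo] with x hxi
  exact B.abs_sub_interp_le hx hv (by omega) hl (by omega) hlr (Ioo_subset_Icc_self hxi)

/-- The value at the right end is inherited from `v` because the `H¹`-projection is exact at the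
nodes, the last of which is `xR`. -/
lemma interp_mem_Q (hx : xL < xR) {v : ℝ → ℝ} {r : ℕ} {K : ℝ}
    (hv : τ.SmoothBound (j + 2) r K v) (hL : v xL = 0) (hR : v xR = 0) :
    B.interp v ∈ τ.Q (j + 1) := by
  refine ⟨B.interp_mem hx v, by rw [B.interp_left, hL], ?_⟩
  have := B.interp_node hx hv (by omega) (Fin.last τ.N)
  rw [τ.node_last] at this
  rw [this, hR]

/-- The friction consistency error as a function of the exact solution. -/
noncomputable def frictionError (d v : ℝ → ℝ) : EuclideanSpace ℝ (Fin B.n) :=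
  B.coef fun x => d x * (v x - B.syn (B.coef (B.interp v)) x)

lemma frictionError_eq (hx : xL < xR) {d v : ℝ → ℝ} (hd : Bdd xL xR d) (hv : Bdd xL xR v) :
    B.frictionError d v
      = B.coef (fun x => d x * v x) - B.friction hx hd (B.coef (B.interp v)) := by
  change _ = _ - B.coef _
  rw [← B.coef_sub hx (hd.mul hv) (hd.mul (B.bdd_syn hx _)), frictionError]
  congr 1
  ext x
  ring

/-- Linearity lets the same friction estimate, applied to a difference in time of the exact
solution, give the Lipschitz bound. -/
lemma frictionError_sub (hx : xL < xR) {d v w : ℝ → ℝ} {r r' : ℕ} {K K' : ℝ} (hd : Bdd xL xR d)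
    (hv : τ.SmoothBound (j + 2) r K v) (hw : τ.SmoothBound (j + 2) r' K' w) :
    B.frictionError d (fun x => v x - w x) = B.frictionError d v - B.frictionError d w := by
  have hvb := hv.bdd hx (by omega)
  have hwb := hw.bdd hx (by omega)
  rw [frictionError, frictionError, frictionError, B.coef_interp_sub hx hv hw,
    ← B.coef_sub hx (hd.mul (hvb.sub (B.bdd_syn hx _))) (hd.mul (hwb.sub (B.bdd_syn hx _)))]
  congr 1
  ext x
  rw [B.syn_sub]
  ring

end Mesh.ONB

/-! ### The exact solution in time -/

section Evolution

variable {τ : Mesh xL xR} {j : ℕ} (B : τ.ONB j) {T M a b : ℝ} {d : ℝ → ℝ}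
  {f g p m ph mh ph' mh' : ℝ → ℝ → ℝ}

lemma Mesh.PiecewiseSmooth.abs_deriv_sub_le {u : ℝ → ℝ → ℝ} (hu : τ.PiecewiseSmooth T (j + 3) M u)
    (hx : xL < xR) (hT : 0 < T) {t t' : ℝ} (ht : t ∈ Icc 0 T) (ht' : t' ∈ Icc 0 T) :
    ∀ᵐ x ∂dom xL xR, |deriv (u t') x - deriv (u t) x| ≤ M * |t' - t| := by
  refine τ.ae_of_openElem hx fun i x hxi => ?_
  have h1 := (hu.smoothBound hT ht).hasDerivAt (by omega) hxi
  have h2 := (hu.smoothBound hT ht').hasDerivAt (by omega) hxi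
  have h3 := (hu.smoothBound_sub hT ht ht').abs_deriv_le (by omega) (by omega) hxi
  rw [← (h2.sub h1).deriv]
  exact h3

lemma continuousOn_coef_deriv (hx : xL < xR) (hT : 0 < T) {u : ℝ → ℝ → ℝ}
    (hu : τ.PiecewiseSmooth T (j + 3) M u) :
    ContinuousOn (fun t => B.coef (deriv (u t))) (Icc 0 T) :=
  B.continuousOn_coef hx ((hu.smoothBound hT ⟨le_rfl, hT.le⟩).nonneg hx)
    (fun _ ht => (hu.smoothBound hT ht).bdd_deriv hx (by omega))
    fun _ ht _ ht' => hu.abs_deriv_sub_le hx hT ht ht'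

lemma continuousOn_coef_timeDeriv (hx : xL < xR) (hT : 0 < T) {u : ℝ → ℝ → ℝ}
    (hu : τ.PiecewiseSmooth T (j + 3) M u) :
    ContinuousOn (fun t => B.coef (timeDeriv T u t)) (Icc 0 T) := by
  refine B.continuousOn_coef hx ((hu.smoothBound hT ⟨le_rfl, hT.le⟩).nonneg hx)
    (fun _ ht => (hu.smoothBound_timeDeriv hT ht).bdd hx (by omega)) fun t ht t' ht' => ?_
  filter_upwards [ae_restrict_mem measurableSet_Ioo] with x hxi
  exact (hu.smoothBound_timeDeriv_sub hT ht ht').abs_le hx (Ioo_subset_Icc_self hxi)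

lemma continuousOn_coef_mul (hx : xL < xR) (hT : 0 < T) {u : ℝ → ℝ → ℝ}
    (hu : τ.PiecewiseSmooth T (j + 3) M u) {dlo dhi : ℝ} (hd : IsBoundedCoeff xL xR dlo dhi d) :
    ContinuousOn (fun t => B.coef fun x => d x * u t x) (Icc 0 T) := by
  have hM := (hu.smoothBound hT ⟨le_rfl, hT.le⟩).nonneg hx
  refine B.continuousOn_coef hx (K := (|dlo| + |dhi|) * M) (by positivity)
    (fun _ ht => hd.bdd.mul ((hu.smoothBound hT ht).bdd hx (by omega))) fun t ht t' ht' => ?_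
  filter_upwards [ae_restrict_mem measurableSet_Ioo, hd.abs_le] with x hxi hdx
  rw [← mul_sub, abs_mul, mul_assoc]
  exact mul_le_mul hdx ((hu.smoothBound_sub hT ht ht').abs_le hx (Ioo_subset_Icc_self hxi))
    (abs_nonneg _) (by positivity)

/-- The evolution of the projected discrete pressure. -/
lemma hasDerivWithinAt_coef_pressure (hx : xL < xR) (hT : 0 < T) (ha : 0 < a)
    (hsol : IsSolution xL xR T a b d f g p m)
    (hp : τ.PiecewiseSmooth T (j + 3) M p) (hm : τ.PiecewiseSmooth T (j + 3) M m)
    (hph : IsH1InTime xL xR T (τ.Q (j + 1)) ph ph')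
    (hmh : IsH1InTime xL xR T (τ.V (j + 1)) mh mh')
    (heq : ∀ᵐ t ∂volume.restrict (Ioo 0 T), ∀ q ∈ τ.PiecewisePoly j,
      ip xL xR (fun x => a * ph' t x) q + ip xL xR (deriv (mh t)) q = ip xL xR (f t) q)
    {t : ℝ} (ht : t ∈ Icc 0 T) :
    HasDerivWithinAt (fun t => B.coef (ph t))
      (B.coef (timeDeriv T p t) + a⁻¹ • (B.coef (deriv (m t)) - B.coef (deriv (mh t))))
      (Icc 0 T) t := by
  refine B.hasDerivWithinAt_coef_inTime (k := j + 1) (fun v hv => hv.1.1) hx hT hph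
    (G := fun t => B.coef (timeDeriv T p t)
      + a⁻¹ • (B.coef (deriv (m t)) - B.coef (deriv (mh t)))) ?_ ?_ ht
  · exact (continuousOn_coef_timeDeriv B hx hT hp).add (((continuousOn_coef_deriv B hx hT hm).sub
      (B.continuousOn_coef_inTime (k := j + 1) (fun v hv => hv.1) hx hT hmh).2).const_smul a⁻¹)
  · filter_upwards [heq, hsol.eq_p, ae_restrict_mem measurableSet_Ioo] with t h1 h2 htT
    have htT' := Ioo_subset_Icc_self htT
    -- The exact equation eliminates `f`. What remains is continuous in time although the equations
    -- hold only almost everywhere.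
    have hf : B.coef (f t) = a • B.coef (timeDeriv T p t) + B.coef (deriv (m t)) := by
      rw [← B.coef_smul, ← B.coef_add hx
        ((Bdd.const _).mul ((hp.smoothBound_timeDeriv hT htT').bdd hx (by omega)))
        ((hm.smoothBound hT htT').bdd_deriv hx (by omega))]
      refine (B.coef_congr hx ?_).symm
      filter_upwards [h2] with x hx2
      rw [timeDeriv_eq_deriv htT, hx2]
    have h3 : a • B.coef (ph' t) + B.coef (deriv (mh t)) = B.coef (f t) := by
      rw [← B.coef_smul]
      ext α
      exact h1 _ (B.mem α)
    have h4 : a • B.coef (ph' t)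
        = a • B.coef (timeDeriv T p t) + (B.coef (deriv (m t)) - B.coef (deriv (mh t))) := by
      rw [eq_sub_of_add_eq h3, hf]
      abel
    rw [← inv_smul_smul₀ ha.ne' (B.coef (ph' t)), h4, smul_add, inv_smul_smul₀ ha.ne']

/-- The evolution of the projected discrete mass flux. -/
lemma hasDerivWithinAt_coef_flux (hx : xL < xR) (hT : 0 < T) (hb : 0 < b) {dlo dhi : ℝ}
    (hd : IsBoundedCoeff xL xR dlo dhi d) (hsol : IsSolution xL xR T a b d f g p m)
    (hp : τ.PiecewiseSmooth T (j + 3) M p) (hm : τ.PiecewiseSmooth T (j + 3) M m)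
    (hph : IsH1InTime xL xR T (τ.Q (j + 1)) ph ph')
    (hmh : IsH1InTime xL xR T (τ.V (j + 1)) mh mh')
    (heq : ∀ᵐ t ∂volume.restrict (Ioo 0 T), ∃ w, τ.IsL2Proj j (mh t) w ∧
      ∀ v ∈ τ.PiecewisePoly j,
        ip xL xR (fun x => b * mh' t x) v + ip xL xR (deriv (ph t)) v
          + ip xL xR (fun x => d x * w x) v = ip xL xR (g t) v)
    {t : ℝ} (ht : t ∈ Icc 0 T) :
    HasDerivWithinAt (fun t => B.coef (mh t))
      (B.coef (timeDeriv T m t) + b⁻¹ • (B.coef (deriv (p t)) - B.coef (deriv (ph t))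
        + (B.coef (fun x => d x * m t x) - B.friction hx hd.bdd (B.coef (mh t)))))
      (Icc 0 T) t := by
  refine B.hasDerivWithinAt_coef_inTime (k := j + 1) (fun v hv => hv.1) hx hT hmh
    (G := fun t => B.coef (timeDeriv T m t) + b⁻¹ • (B.coef (deriv (p t)) - B.coef (deriv (ph t))
        + (B.coef (fun x => d x * m t x) - B.friction hx hd.bdd (B.coef (mh t))))) ?_ ?_ ht
  · have hc := B.continuousOn_coef_inTime (k := j + 1) (fun v hv => hv.1) hx hT hmh
    have hc' := B.continuousOn_coef_inTime (k := j + 1) (fun v hv => hv.1.1) hx hT hph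
    have hA : Continuous (B.friction hx hd.bdd) := LinearMap.continuous_of_finiteDimensional _
    exact (continuousOn_coef_timeDeriv B hx hT hm).add
      ((((continuousOn_coef_deriv B hx hT hp).sub hc'.2).add
        ((continuousOn_coef_mul B hx hT hm hd).sub (hA.comp_continuousOn hc.1))).const_smul b⁻¹)
  · filter_upwards [heq, hsol.eq_m, ae_restrict_mem measurableSet_Ioo] with t h1 h2 htT
    obtain ⟨w, hw, h1⟩ := h1
    have htT' := Ioo_subset_Icc_self htT
    have hg : B.coef (g t) = b • B.coef (timeDeriv T m t) + B.coef (deriv (p t))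
        + B.coef (fun x => d x * m t x) := by
      have i1 := (Bdd.const b).mul ((hm.smoothBound_timeDeriv hT htT').bdd hx (by omega))
      have i2 := (hp.smoothBound hT htT').bdd_deriv hx (by omega)
      have i3 := hd.bdd.mul ((hm.smoothBound hT htT').bdd hx (by omega))
      rw [← B.coef_smul, ← B.coef_add hx i1 i2, ← B.coef_add hx (i1.add i2) i3]
      refine (B.coef_congr hx ?_).symm
      filter_upwards [h2] with x hx2
      rw [timeDeriv_eq_deriv htT, hx2]
    have hwc : B.coef w = B.coef (mh t) := by
      ext α
      exact hw.2 _ (B.mem α)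
    -- Every `L²`-projection of `mh t` agrees almost everywhere with the one synthesized from its
    -- coefficients, so the choice of `w` is immaterial.
    have hwf : B.coef (fun x => d x * w x) = B.friction hx hd.bdd (B.coef (mh t)) := by
      rw [← hwc]
      refine B.coef_congr hx ?_
      filter_upwards [B.ae_eq_syn hw.1] with x hx3
      rw [← hx3]
    have h3 : b • B.coef (mh' t) + B.coef (deriv (ph t)) + B.coef (fun x => d x * w x)
        = B.coef (g t) := by
      rw [← B.coef_smul]
      ext α
      exact h1 _ (B.mem α)
    have h4 : b • B.coef (mh' t)
        = b • B.coef (timeDeriv T m t) + (B.coef (deriv (p t)) - B.coef (deriv (ph t))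
        + (B.coef (fun x => d x * m t x) - B.friction hx hd.bdd (B.coef (mh t)))) := by
      rw [eq_sub_of_add_eq (eq_sub_of_add_eq h3), hg, hwf]
      abel
    rw [← inv_smul_smul₀ hb.ne' (B.coef (mh' t)), h4, smul_add, inv_smul_smul₀ hb.ne']

end Evolution

/-- The error between the discrete solution and the projection of the exact one. -/
lemma exists_error_const (j : ℕ) (hx : xL < xR) {T a b : ℝ} (hT : 0 < T) (ha : 0 < a) (hb : 0 < b)
    {dlo dhi : ℝ} (hdlo : 0 < dlo) (L M : ℝ) :
    ∃ C : ℝ, ∀ (τ : Mesh xL xR) (d : ℝ → ℝ) (f g p m ph mh : ℝ → ℝ → ℝ),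
      IsBoundedCoeff xL xR dlo dhi d → τ.HasBoundedPiecewiseWeakDeriv L d →
      IsSolution xL xR T a b d f g p m →
      τ.PiecewiseSmooth T (j + 3) M p → τ.PiecewiseSmooth T (j + 3) M m →
      IsSemidiscreteSolution τ (j + 1) T a b d f g ph mh →
      τ.IsH1Proj (j + 1) (p 0) (ph 0) →
      (∃ w, τ.IsH1Proj (j + 1) (m 0) w ∧ ∀ v ∈ τ.PiecewisePoly j,
        ip xL xR (mh 0) v = ip xL xR w v) →
      ∀ t ∈ Icc 0 T, l2norm xL xR (fun x => p t x - ph t x)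
        + l2norm xL xR (fun x => m t x - mh t x) ≤ C * τ.size ^ (j + 2) := by
  obtain ⟨C₀, hC₀, hstab⟩ := exists_stability_const (D := |dlo| + |dhi|) ha hb hT (by positivity)
  set s := √(xR - xL) with hs
  set Cf := s * (|dlo| + |dhi| + |L| * (xR - xL + 1)) with hCf
  have hs0 : 0 ≤ s := Real.sqrt_nonneg _
  have hℓ : 0 < xR - xL := sub_pos.2 hx
  have hCf0 : 0 ≤ Cf := by positivity
  -- For each of the two unknowns: the projection error, the energy bound `C₀ R`, and `h` times the
  -- derivative bound `C₀ (R + R')`, with one factor `h` estimated by `xR - xL` in the part with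
  -- `R`.
  refine ⟨2 * (s * M + (C₀ * ((s + Cf) * M) + (xR - xL) * (C₀ * ((s + Cf) * M))
    + C₀ * ((s + Cf * (xR - xL)) * M))), ?_⟩
  intro τ d f g p m ph mh hd hdL hsol hp hm hdisc hinit hinit' t ht
  obtain ⟨ph', mh', hph, hmh, heq, heq'⟩ := hdisc.exists_deriv
  obtain ⟨B⟩ := τ.exists_onb hx j
  have h0T : (0 : ℝ) ∈ Icc 0 T := ⟨le_rfl, hT.le⟩
  have hM : 0 ≤ M := (hp.smoothBound hT h0T).nonneg hx
  set h := τ.size with hh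
  have hh0 : 0 ≤ h := (τ.size_pos hx).le
  have hhℓ : h ≤ xR - xL := τ.size_le hx
  let εp : ℝ → ℝ → ℝ := fun t x => B.interp (p t) x - ph t x
  let εm : ℝ → ℝ → ℝ := fun t x => B.interp (m t) x - mh t x
  have hεp : ∀ t ∈ Icc 0 T, εp t ∈ τ.Q (j + 1) := fun t ht =>
    τ.Q_sub (B.interp_mem_Q hx (hp.smoothBound hT ht) (hsol.bc_left t ht) (hsol.bc_right t ht))
      (hph.mem t ht)
  have hεm : ∀ t ∈ Icc 0 T, εm t ∈ τ.V (j + 1) := fun t ht =>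
    τ.V_sub (B.interp_mem hx _) (hmh.mem t ht)
  have cp : ∀ t ∈ Icc 0 T, B.coef (εp t) = B.coef (B.interp (p t)) - B.coef (ph t) := fun t ht =>
    B.coef_sub hx (B.bdd_interp hx _) (τ.bdd_of_mem hx (hph.mem t ht).1.1)
  have cm : ∀ t ∈ Icc 0 T, B.coef (εm t) = B.coef (B.interp (m t)) - B.coef (mh t) := fun t ht =>
    B.coef_sub hx (B.bdd_interp hx _) (τ.bdd_of_mem hx (hmh.mem t ht).1)
  have dp : ∀ t ∈ Icc 0 T,
      B.coef (deriv (εp t)) = B.coef (deriv (p t)) - B.coef (deriv (ph t)) := fun t ht => by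
    rw [← B.coef_deriv_interp hx (p t)]
    exact B.coef_deriv_sub hx (B.interp_mem hx _).1 (hph.mem t ht).1.1
  have dm : ∀ t ∈ Icc 0 T,
      B.coef (deriv (εm t)) = B.coef (deriv (m t)) - B.coef (deriv (mh t)) := fun t ht => by
    rw [← B.coef_deriv_interp hx (m t)]
    exact B.coef_deriv_sub hx (B.interp_mem hx _).1 (hmh.mem t ht).1
  have hdpos : ∀ᵐ x ∂dom xL xR, 0 ≤ d x := by
    filter_upwards [hd.2] with x hx2 using hdlo.le.trans hx2.1
  -- The data are bounded by `R` of order `h^{j+2}`, and Lipschitz in time with constant `R'` of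
  -- order `h^{j+1}`.
  have key := hstab B.n (B.friction hx hd.bdd) (fun t => B.coef (εp t)) (fun t => B.coef (εm t))
    (fun t => B.coef (B.interp (timeDeriv T p t)) - B.coef (timeDeriv T p t))
    (fun t => B.coef (B.interp (timeDeriv T m t)) - B.coef (timeDeriv T m t))
    (fun t => B.frictionError d (m t)) (fun t => B.coef (deriv (εm t)))
    (fun t => B.coef (deriv (εp t))) ((s + Cf) * M * h ^ (j + 2))
    ((s + Cf * (xR - xL)) * M * h ^ (j + 1))
    (fun c => by
      rw [← B.l2norm_syn hx c]
      exact B.norm_coef_mul_le hx (by positivity) hd.bdd hd.abs_le (B.bdd_syn hx c))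
    (fun c => B.inner_coef_mul_syn_nonneg hx hd.bdd hdpos c)
    (fun t ht => by
      refine (((B.hasDerivWithinAt_coef_interp hx hT hp ht).sub
        (hasDerivWithinAt_coef_pressure B hx hT ha hsol hp hm hph hmh heq ht)).congr_of_mem
        cp ht).congr_deriv ?_
      rw [dm t ht]
      abel)
    (fun t ht => by
      refine (((B.hasDerivWithinAt_coef_interp hx hT hm ht).sub
        (hasDerivWithinAt_coef_flux B hx hT hb hd hsol hp hm hph hmh heq' ht)).congr_of_mem
        cm ht).congr_deriv ?_
      rw [dp t ht, cm t ht, map_sub,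
        B.frictionError_eq hx hd.bdd ((hm.smoothBound hT ht).bdd hx (by omega)), ← sub_sub]
      congr 2
      abel)
    (fun t ht => B.inner_coef_deriv_add hx (hεp t ht) (hεm t ht))
    (fun r hr t ht => by
      rw [← B.coef_sub hx (τ.bdd_of_mem hx (hεp t ht).1.1) (τ.bdd_of_mem hx (hεp r hr).1.1),
        ← B.coef_sub hx (τ.bdd_of_mem hx (hεm t ht).1) (τ.bdd_of_mem hx (hεm r hr).1),
        ← B.coef_deriv_sub hx (hεp t ht).1.1 (hεp r hr).1.1,
        ← B.coef_deriv_sub hx (hεm t ht).1 (hεm r hr).1]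
      exact B.inner_coef_deriv_add hx (τ.Q_sub (hεp t ht) (hεp r hr))
        (τ.V_sub (hεm t ht) (hεm r hr)))
    (by
      rw [cp 0 h0T, sub_eq_zero]
      refine B.coef_congr hx ?_
      have h1 := hinit.2.1 0
      rw [τ.node_zero] at h1
      filter_upwards [ae_restrict_mem measurableSet_Ioo] with x hxi
      exact (B.eq_interp hx hinit.1 h1 hinit.2.2 (Ioo_subset_Icc_self hxi)).symm)
    (by
      obtain ⟨w, hw, hw'⟩ := hinit'
      rw [cm 0 h0T, sub_eq_zero]
      have h1 := hw.2.1 0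
      rw [τ.node_zero] at h1
      have h2 : B.coef (mh 0) = B.coef w := by
        ext α
        exact hw' _ (B.mem α)
      rw [h2]
      refine B.coef_congr hx ?_
      filter_upwards [ae_restrict_mem measurableSet_Ioo] with x hxi
      exact (B.eq_interp hx hw.1 h1 hw.2.2 (Ioo_subset_Icc_self hxi)).symm)
    (fun t ht => by
      have e1 : s * (M * h ^ (j + 2)) ≤ (s + Cf) * M * h ^ (j + 2) := by
        rw [mul_assoc]
        exact mul_le_mul_of_nonneg_right (by linarith) (by positivity)
      have e2 : Cf * M * h ^ (j + 2) ≤ (s + Cf) * M * h ^ (j + 2) := by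
        gcongr
        linarith
      exact ⟨(B.norm_coef_interp_sub_le hx (hp.smoothBound_timeDeriv hT ht) (l := j + 1) le_rfl
          le_rfl).trans e1,
        (B.norm_coef_interp_sub_le hx (hm.smoothBound_timeDeriv hT ht) (l := j + 1) le_rfl
          le_rfl).trans e1,
        (B.norm_coef_friction_le hx hd hdL (hm.smoothBound hT ht)).trans e2⟩)
    (fun r hr t ht => by
      -- Time differences of `∂ₜ u` allow only `l = j` in the projection estimate. The friction
      -- error keeps its full order, and its surplus factor `h` is absorbed into `xR - xL`.
      set δ := |t - r| with hδ
      have hδ0 : 0 ≤ δ := abs_nonneg _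
      have e1 : s * (M * δ * h ^ (j + 1)) ≤ (s + Cf * (xR - xL)) * M * h ^ (j + 1) * δ := by
        have : 0 ≤ Cf * (xR - xL) * (M * δ * h ^ (j + 1)) := by positivity
        linarith
      have e2 : Cf * (M * δ) * h ^ (j + 2) ≤ (s + Cf * (xR - xL)) * M * h ^ (j + 1) * δ := by
        have h1 : Cf * (M * δ) * h ^ (j + 2) = Cf * h * (M * δ * h ^ (j + 1)) := by ring
        have h2 : Cf * h * (M * δ * h ^ (j + 1)) ≤ Cf * (xR - xL) * (M * δ * h ^ (j + 1)) := by
          gcongr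
        have h3 : 0 ≤ s * (M * δ * h ^ (j + 1)) := by positivity
        linarith
      have hc : ∀ {u : ℝ → ℝ → ℝ}, τ.PiecewiseSmooth T (j + 3) M u →
          ‖(B.coef (B.interp (timeDeriv T u t)) - B.coef (timeDeriv T u t))
            - (B.coef (B.interp (timeDeriv T u r)) - B.coef (timeDeriv T u r))‖
            ≤ (s + Cf * (xR - xL)) * M * h ^ (j + 1) * δ := by
        intro u hu
        have hut := hu.smoothBound_timeDeriv hT ht
        have hur := hu.smoothBound_timeDeriv hT hr
        rw [sub_sub_sub_comm, ← B.coef_interp_sub hx hut hur,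
          ← B.coef_sub hx (hut.bdd hx (by omega)) (hur.bdd hx (by omega))]
        exact (B.norm_coef_interp_sub_le hx (hu.smoothBound_timeDeriv_sub hT hr ht) (l := j)
          (by omega) le_rfl).trans e1
      refine ⟨hc hp, hc hm, ?_⟩
      rw [← B.frictionError_sub hx hd.bdd (hm.smoothBound hT ht) (hm.smoothBound hT hr)]
      exact (B.norm_coef_friction_le hx hd hdL (hm.smoothBound_sub hT hr ht)).trans e2)
    t ht
  obtain ⟨k1, k2, k3, k4⟩ := key
  set R := (s + Cf) * M * h ^ (j + 2) with hR
  set R' := (s + Cf * (xR - xL)) * M * h ^ (j + 1) with hR'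
  have hR0 : 0 ≤ R := by positivity
  -- The triangle inequality separates the projection error from the discrete error, and the
  -- Poincaré-type inequality passes from the projected discrete error to the full one.
  have split : ∀ {u uh : ℝ → ℝ → ℝ}, τ.PiecewiseSmooth T (j + 3) M u → uh t ∈ τ.V (j + 1) →
      ‖B.coef (fun x => B.interp (u t) x - uh t x)‖ ≤ C₀ * R →
      ‖B.coef (deriv fun x => B.interp (u t) x - uh t x)‖ ≤ C₀ * (R + R') →
      l2norm xL xR (fun x => u t x - uh t x)
        ≤ s * (M * h ^ (j + 2)) + (C₀ * R + h * (C₀ * (R + R'))) := by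
    intro u uh hu huh n1 n2
    have hub := hu.smoothBound hT ht
    have hmem := τ.V_sub (B.interp_mem hx (u t)) huh
    have i1 := hub.bdd hx (by omega)
    have i2 := B.bdd_interp hx (u t)
    have tri := l2norm_add_le hx (i1.sub i2) (τ.bdd_of_mem hx hmem.1)
    simp only [sub_add_sub_cancel] at tri
    refine tri.trans (add_le_add ?_ ((B.l2norm_le hx hmem).trans
      (add_le_add n1 (mul_le_mul_of_nonneg_left n2 hh0))))
    refine l2norm_le_of_bound hx (by positivity) ?_
    filter_upwards [ae_restrict_mem measurableSet_Ioo] with x hxi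
    exact B.abs_sub_interp_le hx hub (by omega) (l := j + 1) le_rfl le_rfl le_rfl
      (Ioo_subset_Icc_self hxi)
  have s1 := split hp (hph.mem t ht).1 k1 k4
  have s2 := split hm (hmh.mem t ht) k2 k3
  have e3 : h * (C₀ * (R + R')) ≤ (xR - xL) * (C₀ * R) + C₀ * ((s + Cf * (xR - xL)) * M)
      * h ^ (j + 2) := by
    have h1 : h * (C₀ * (R + R')) = h * (C₀ * R) + C₀ * ((s + Cf * (xR - xL)) * M)
      * h ^ (j + 2) := by
      rw [hR']
      ring
    have h2 : h * (C₀ * R) ≤ (xR - xL) * (C₀ * R) :=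
      mul_le_mul_of_nonneg_right hhℓ (by positivity)
    linarith
  calc _ ≤ 2 * (s * (M * h ^ (j + 2)) + (C₀ * R + ((xR - xL) * (C₀ * R)
        + C₀ * ((s + Cf * (xR - xL)) * M) * h ^ (j + 2)))) := by linarith
    _ = _ := by
      rw [hR]
      ring

end PetrovGalerkin

theorem theorem1 (k : ℕ) (hk : 1 ≤ k) (xL xR : ℝ) (hx : xL < xR) (T : ℝ) (hT : 0 < T)
    (a b : ℝ) (ha : 0 < a) (hb : 0 < b) (dlo dhi : ℝ) (hd : 0 < dlo) (L M : ℝ) :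
    ∃ C : ℝ, ∀ (τ : PetrovGalerkin.Mesh xL xR) (d : ℝ → ℝ) (f g p m ph mh : ℝ → ℝ → ℝ),
      PetrovGalerkin.IsBoundedCoeff xL xR dlo dhi d →
      τ.HasBoundedPiecewiseWeakDeriv L d →
      PetrovGalerkin.IsSolution xL xR T a b d f g p m →
      τ.PiecewiseSmooth T (k + 2) M p →
      τ.PiecewiseSmooth T (k + 2) M m →
      PetrovGalerkin.IsSemidiscreteSolution τ k T a b d f g ph mh →
      -- `p_h(0)` is the `H¹`-projection of `p(0)`
      τ.IsH1Proj k (p 0) (ph 0) →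
      -- `m_h(0)` and the `H¹`-projection of `m(0)` have the same `L²`-projection onto `P_{k-1}(T_h)`;
      -- in particular this is the case if `m_h(0)` is the `H¹`-projection of `m(0)`
      (∃ w, τ.IsH1Proj k (m 0) w ∧ ∀ v ∈ τ.PiecewisePoly (k - 1),
        PetrovGalerkin.ip xL xR (mh 0) v = PetrovGalerkin.ip xL xR w v) →
      ∀ t ∈ Set.Icc 0 T,
        PetrovGalerkin.l2norm xL xR (fun x => p t x - ph t x)
          + PetrovGalerkin.l2norm xL xR (fun x => m t x - mh t x) ≤ C * τ.size ^ (k + 1) := by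
  -- With `k = j + 1` the truncated difference `k - 1` reduces to `j`, the degree of the test space.
  obtain ⟨j, rfl⟩ : ∃ j, k = j + 1 := ⟨k - 1, by omega⟩
  exact PetrovGalerkin.exists_error_const j hx hT ha hb hd L M
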